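/- Fix notation. For an integer $n\ge 1$ and for every prime power $p^v$ ($v\ge 1$) let $A_{p^v}\subseteq(\mathbf Z/p^v\mathbf Z)^n$ be an arbitrary (possibly empty) set. For a positive integer $q$ let $A_q\subseteq(\mathbf Z/q\mathbf Z)^n$ be the set of residue classes $a$ modulo $q$ such that $a \bmod p^v\in A_{p^v}$ for all prime powers $p^v$ exactly dividing $q$, and put $\rho(q)=|A_q|$. Let $\mathcal Q$ be the set of positive integers $q$ with $\rho(q)\ge 1$, and let $\mathcal Q_k(x)$ be the set of $q\in\mathcal Q$ with $q\le x$ having exactly $k$ distinct prime factors. For a prime $p\in\mathcal Q$ let $\lambda(p)$ be the maximum of $|H\cap A_p|$ over all affine hyperplanes $H=\{y\in(\mathbf Z/p\mathbf Z)^n : h_1y_1+\dots+h_ny_n=a\}$ with $(h_1,\dots,h_n)\ne 0$. For $q\in\mathcal Q$ let $$\Delta_q=\frac1{\rho(q)}\sum_{a\in A_q}\delta_{\{a/q\}},$$ a probability measure on $(\mathbf R/\mathbf Z)^n$, and let $\mathrm{disc}(\Delta_q)=\sup_B|\Delta_q(B)-\mathrm{vol}(B)|$, where $B$ runs over all boxes,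 i.e. images in $(\mathbf R/\mathbf Z)^n$ of products of closed intervals of $\mathbf R$ of length at most $1$. **Theorem.** For every $n\ge1$ there is a constant $C(n)$ depending only on $n$, and for all $\alpha>0$ and $x_0\ge 2$ there is an $X=X(\alpha,x_0)$, such that the following holds for every $n\ge 1$ and every family $(A_{p^v})$ as above. Suppose that $$\sum_{p\le y,\ \rho(p)\ge 1}\log p\ \ge\ \alpha y\qquad\text{for all real } y\ge x_0 .$$ Let $x\ge X$ and let $0<\delta\le 1$ be such that $$\sum_{p\le x,\ p\in\mathcal Q}\Bigl(1-\frac{\lambda(p)}{\rho(p)}\Bigr)\frac1p\ \ge\ \delta\log\log x .$$ Then for every integer $k$ with $$\frac{20(6+n)}{\delta}\log\Bigl(\frac{20(6+n)}{\delta}\Bigr)\le k\le\exp\Bigl(\sqrt{\frac{\alpha\delta\log\log x}{20(6+n)}}\Bigr)$$ the set $\mathcal Q_k(x)$ is non-empty and $$\frac1{|\mathcal Q_k(x)|}\sum_{q\in\mathcal Q_k(x)}\mathrm{disc}(\Delta_q)\ \le\ \frac{C(n)}{\alpha}\Bigl(e^{-\delta k/18}+(\log x)^{-\alpha\delta/18}\Bigr).$$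 -/

import Mathlib

open scoped ENNReal

noncomputable section

namespace CRTEquidist

/-- The set `A_q ⊆ (ℤ/qℤ)ⁿ` of all residue classes `a` modulo `q` such that `a mod p^v` lies in
`A_{p^v}` for every prime power `p^v` exactly dividing `q`. Only the values of the family `A` at the
prime powers `p^v`, `v ≥ 1`, are used. -/
def crtSet {n : ℕ} (A : (m : ℕ) → Set (Fin n → ZMod m)) (q : ℕ) : Set (Fin n → ZMod q) :=
  {a | ∀ p ∈ q.primeFactors,
    (fun i => ZMod.castHom (Nat.ordProj_dvd q p) (ZMod (p ^ q.factorization p)) (a i)) ∈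
      A (p ^ q.factorization p)}

/-- At a prime power, the set `A_q` is the given one. -/
theorem crtSet_prime_pow {n : ℕ} (A : (m : ℕ) → Set (Fin n → ZMod m)) {p v : ℕ}
    (hp : p.Prime) (hv : v ≠ 0) : crtSet A (p ^ v) = A (p ^ v) := by
  have key : ∀ (w : ℕ) (hw : w = v) (hd : p ^ w ∣ p ^ v) (a : Fin n → ZMod (p ^ v)),
      (fun i => ZMod.castHom hd (ZMod (p ^ w)) (a i)) ∈ A (p ^ w) ↔ a ∈ A (p ^ v) := by
    intro w hw hd a
    subst hw
    simp
  ext a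
  simp only [crtSet, Set.mem_ofPred_eq, Nat.primeFactors_prime_pow hv hp, Finset.mem_singleton,
    forall_eq]
  exact key _ (by simp [hp.factorization]) _ a

/-- `ρ(q) = |A_q|`. -/
def rho {n : ℕ} (A : (m : ℕ) → Set (Fin n → ZMod m)) (q : ℕ) : ℕ :=
  (crtSet A q).ncard

/-- An affine hyperplane in `(ℤ/qℤ)ⁿ`: the solution set of an equation
`h₁ x₁ + ⋯ + hₙ xₙ = a` with `h ≠ 0`. -/
def IsAffineHyperplane {n q : ℕ} (H : Set (Fin n → ZMod q)) : Prop :=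
  ∃ h : Fin n → ZMod q, h ≠ 0 ∧ ∃ a : ZMod q, H = {x | ∑ i, h i * x i = a}

/-- `λ(q)`: the maximum of `|H ∩ A_q|` over all affine hyperplanes `H` in `(ℤ/qℤ)ⁿ`. -/
def lam {n : ℕ} (A : (m : ℕ) → Set (Fin n → ZMod m)) (q : ℕ) : ℕ :=
  sSup {m : ℕ | ∃ H : Set (Fin n → ZMod q), IsAffineHyperplane H ∧ m = (H ∩ crtSet A q).ncard}

open Classical in
/-- The primes `p ≤ x` with `ρ(p) ≥ 1`. -/
def primesQ {n : ℕ} (A : (m : ℕ) → Set (Fin n → ZMod m)) (x : ℝ) : Finset ℕ :=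
  (Finset.Icc 1 ⌊x⌋₊).filter fun p => p.Prime ∧ 1 ≤ rho A p

open Classical in
/-- `𝒬_k(x)`: the positive integers `q ≤ x` with `ρ(q) ≥ 1` and exactly `k` distinct
prime factors. -/
def Qk {n : ℕ} (A : (m : ℕ) → Set (Fin n → ZMod m)) (k : ℕ) (x : ℝ) : Finset ℕ :=
  (Finset.Icc 1 ⌊x⌋₊).filter fun q => 1 ≤ rho A q ∧ q.primeFactors.card = k

/-- The point `{a/q}` of the torus `(ℝ/ℤ)ⁿ`. -/
def torusPoint {n q : ℕ} (a : Fin n → ZMod q) : Fin n → UnitAddCircle :=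
  fun i => (((a i).val / q : ℝ) : UnitAddCircle)

/-- The measure `Δ_q = ρ(q)⁻¹ ∑_{a ∈ A_q} δ_{{a/q}}` on the torus `(ℝ/ℤ)ⁿ`. -/
def Delta {n : ℕ} (A : (m : ℕ) → Set (Fin n → ZMod m)) (q : ℕ) :
    MeasureTheory.Measure (Fin n → UnitAddCircle) :=
  (rho A q : ℝ≥0∞)⁻¹ •
    MeasureTheory.Measure.sum fun a : crtSet A q => MeasureTheory.Measure.dirac (torusPoint a.1)

/-- A box in `(ℝ/ℤ)ⁿ`: the image of a product of closed intervals of `ℝ` of length at most `1`. -/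
def IsBox {n : ℕ} (B : Set (Fin n → UnitAddCircle)) : Prop :=
  ∃ l u : Fin n → ℝ, (∀ i, l i ≤ u i ∧ u i ≤ l i + 1) ∧
    B = (fun (t : Fin n → ℝ) (i : Fin n) => (t i : UnitAddCircle)) '' Set.Icc l u

/-- The box discrepancy of a measure on `(ℝ/ℤ)ⁿ`. -/
def disc {n : ℕ} (μ : MeasureTheory.Measure (Fin n → UnitAddCircle)) : ℝ :=
  sSup {d : ℝ | ∃ B : Set (Fin n → UnitAddCircle), IsBox B ∧
    d = |μ.real B - (MeasureTheory.volume : MeasureTheory.Measure (Fin n → UnitAddCircle)).real B|}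

/-- The standing assumption: `∑_{p ≤ x, ρ(p) ≥ 1} log p ≥ α x` for all `x ≥ x₀`. -/
def ManyPrimes {n : ℕ} (A : (m : ℕ) → Set (Fin n → ZMod m)) (α x₀ : ℝ) : Prop :=
  ∀ x : ℝ, x₀ ≤ x → α * x ≤ ∑ p ∈ primesQ A x, Real.log p

end CRTEquidist

end

open CRTEquidist

/-! Put L = log x, w = exp(L/k³) and y₀ = exp(L/(2k)). An inequality of Erdős–Turán–Koksma type
(`disc_le`) bounds disc(Δ_q) by a multiple of ε plus a weighted sum of |W_q(h)| over the nonzero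
frequency vectors h with entries of size at most H, where W_q(h) is the normalised exponential sum
`weylSum`. It remains to bound, for each such h, the average of |W_q(h)| over q in 𝒬_k(x).

Nearly all q have the form mP with P ≥ y₀ a prime not dividing m and with no proper prime power
above w. Split m = rt into its w-smooth part r and its rough part t. By the Chinese remainder
theorem |W_q(h)| is at most the absolute value of the sum modulo r at the frequency (tP)⁻¹h. Since r
≤ w^(k-1) is much smaller than y₀, Selberg's sieve bounds the number of P in each residue class
modulo r by the expected order of magnitude. The sum over P is thereby controlled by the mean over
all units b modulo r of the sums at frequency bh (`sum_primes_modSum_le`). This mean is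
multiplicative in r, and at a prime p exactly dividing r but not dividing h, Parseval and
Cauchy–Schwarz bound its factor by 1 - (1 - λ(p)/ρ(p))/2 (`unitMean_prime_le`).

Summing over m produces an elementary symmetric sum e_{k-1} of local sums containing these savings
(`sum_goodQk_le`). From below, |𝒬_k(x)| is at least e_{k-1} of the local sums without savings over p
≤ w, times a number of choices of P supplied by the assumption on primes (`le_card_Qk`). With σ the
sum of all the terms, e_j ≤ σ^j/j!, and e_j ≥ (σ - s)^j/j! if no j terms exceed s in total; here s
is of order log k. The savings are at least 0.48 δ log L out of a total of at most 2.2 log L, so the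
ratio of the two symmetric sums is at most exp(-δk/5) (`elemSymm_localBound_le`). The losses, coming
from s, from the primes between w and x and from the primes dividing h, are all of order log k, and
the upper bound for k forces δ log L ≥ 600 log k.

With ε of size exp(-δk/18) and H of size ε⁻², the frequency weights sum to at most k^n; the lower
bound for k absorbs k^(n+1) into exp(δk/10). The first of the two error terms in the theorem already
suffices. -/

namespace CRTEquidist

/-! ### Elementary symmetric sums and sums of reciprocals of few primes -/

open Finset

/-- The elementary symmetric sum `e_j` of the values of `f` on `S`. -/
noncomputable def elemSymm (S : Finset ℕ) (f : ℕ → ℝ) (j : ℕ) : ℝ :=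
  ∑ T ∈ S.powersetCard j, ∏ p ∈ T, f p

/-- Double counting of pairs formed by a (j+1)-set and one of its elements: the element is removed
in one direction and put back in the other. -/
theorem elemSymm_succ (S : Finset ℕ) (f : ℕ → ℝ) (j : ℕ) :
    ((j : ℝ) + 1) * elemSymm S f (j + 1) =
      ∑ T ∈ S.powersetCard j, (∏ p ∈ T, f p) * ∑ p ∈ S \ T, f p := by
  have h1 : ((j : ℝ) + 1) * elemSymm S f (j + 1) =
      ∑ T ∈ S.powersetCard (j + 1), ∑ p ∈ T, ∏ q ∈ T, f q := by
    rw [elemSymm, mul_sum]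
    refine sum_congr rfl fun T hT => ?_
    rw [sum_const, (mem_powersetCard.1 hT).2]
    simp
  rw [h1]
  simp_rw [mul_sum]
  rw [sum_sigma', sum_sigma']
  refine sum_bij' (fun a _ => ⟨a.1.erase a.2, a.2⟩) (fun a _ => ⟨insert a.2 a.1, a.2⟩) ?_ ?_ ?_ ?_ ?_
  · rintro ⟨T, p⟩ h
    simp only [mem_sigma, mem_powersetCard, mem_sdiff] at h ⊢
    refine ⟨⟨(erase_subset _ _).trans h.1.1, ?_⟩, h.1.1 h.2, by simp⟩
    rw [card_erase_of_mem h.2, h.1.2]; rfl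
  · rintro ⟨T, p⟩ h
    simp only [mem_sigma, mem_powersetCard, mem_sdiff] at h ⊢
    refine ⟨⟨insert_subset h.2.1 h.1.1, ?_⟩, by simp⟩
    rw [card_insert_of_notMem h.2.2, h.1.2]
  · rintro ⟨T, p⟩ h
    simp only [mem_sigma] at h
    simp [insert_erase h.2]
  · rintro ⟨T, p⟩ h
    simp only [mem_sigma, mem_sdiff] at h
    simp [erase_insert h.2.2]
  · rintro ⟨T, p⟩ h
    simp only [mem_sigma] at h
    simp only
    rw [mul_comm, mul_prod_erase _ _ h.2]

theorem elemSymm_nonneg {S : Finset ℕ} {f : ℕ → ℝ} (hf : ∀ p ∈ S, 0 ≤ f p) (j : ℕ) :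
    0 ≤ elemSymm S f j :=
  sum_nonneg fun _ hT => prod_nonneg fun p hp => hf p ((mem_powersetCard.1 hT).1 hp)

theorem elemSymm_zero (S : Finset ℕ) (f : ℕ → ℝ) : elemSymm S f 0 = 1 := by
  simp [elemSymm]

/-- Iterate `elemSymm_succ`, bounding the sum over the complement of T by the sum over all of S. -/
theorem elemSymm_le {S : Finset ℕ} {f : ℕ → ℝ} (hf : ∀ p ∈ S, 0 ≤ f p) (j : ℕ) :
    elemSymm S f j ≤ (∑ p ∈ S, f p) ^ j / j.factorial := by
  induction j with
  | zero => simp [elemSymm_zero]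
  | succ j ih =>
    have h1 : ((j : ℝ) + 1) * elemSymm S f (j + 1) ≤ elemSymm S f j * ∑ p ∈ S, f p := by
      rw [elemSymm_succ, elemSymm, sum_mul]
      refine sum_le_sum fun T hT => mul_le_mul_of_nonneg_left ?_ ?_
      · exact sum_le_sum_of_subset_of_nonneg sdiff_subset fun p hp _ => hf p hp
      · exact prod_nonneg fun p hp => hf p ((mem_powersetCard.1 hT).1 hp)
    have h2 : (0 : ℝ) ≤ ∑ p ∈ S, f p := sum_nonneg hf
    have h3 := mul_le_mul_of_nonneg_right ih h2
    rw [Nat.factorial_succ, le_div_iff₀ (by positivity)]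
    have h4 : (0 : ℝ) < j.factorial := by positivity
    have h5 := h1.trans h3
    rw [div_mul_eq_mul_div, le_div_iff₀ h4] at h5
    push_cast
    calc _ = ((j : ℝ) + 1) * elemSymm S f (j + 1) * j.factorial := by ring
      _ ≤ _ := h5
      _ = _ := by ring

/-- The same recursion read from below: after removing a set of at most j elements, the complement
still carries at least the total minus s. The condition on the total keeps this factor nonnegative.
-/
theorem le_elemSymm {S : Finset ℕ} {f : ℕ → ℝ} (hf : ∀ p ∈ S, 0 ≤ f p) {s : ℝ} {j : ℕ}
    (hs : ∀ T ⊆ S, #T ≤ j → ∑ p ∈ T, f p ≤ s) (hS : s ≤ ∑ p ∈ S, f p) :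
    (∑ p ∈ S, f p - s) ^ j / j.factorial ≤ elemSymm S f j := by
  induction j with
  | zero => simp [elemSymm_zero]
  | succ j ih =>
    have ih := ih fun T hT hj => hs T hT (by omega)
    have h1 : elemSymm S f j * (∑ p ∈ S, f p - s) ≤ ((j : ℝ) + 1) * elemSymm S f (j + 1) := by
      rw [elemSymm_succ, elemSymm, sum_mul]
      refine sum_le_sum fun T hT => mul_le_mul_of_nonneg_left ?_ ?_
      · rw [mem_powersetCard] at hT
        rw [← sum_sdiff hT.1]
        linarith [hs T hT.1 (by omega)]
      · exact prod_nonneg fun p hp => hf p ((mem_powersetCard.1 hT).1 hp)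
    have h3 := (mul_le_mul_of_nonneg_right ih (sub_nonneg.2 hS)).trans h1
    rw [Nat.factorial_succ, div_le_iff₀ (by positivity)]
    have h4 : (0 : ℝ) < j.factorial := by positivity
    rw [div_mul_eq_mul_div, div_le_iff₀ h4] at h3
    push_cast
    calc _ = (∑ p ∈ S, f p - s) ^ j * (∑ p ∈ S, f p - s) := by ring
      _ ≤ _ := h3
      _ = _ := by ring

/-- The largest of j + 1 distinct positive integers is at least j + 1; remove it and induct. -/
theorem sum_inv_le_harmonic (j : ℕ) :
    ∀ T : Finset ℕ, (∀ t ∈ T, 1 ≤ t) → #T = j → ∑ t ∈ T, (1 : ℝ) / t ≤ (harmonic j : ℝ) := by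
  induction j with
  | zero => intro T _ h; simp [card_eq_zero.1 h]
  | succ j ih =>
    intro T hT h
    have hne : T.Nonempty := by rw [← card_pos]; omega
    have hmax := T.max'_mem hne
    have hge : j + 1 ≤ T.max' hne := by
      have : T ⊆ Icc 1 (T.max' hne) := fun t ht => mem_Icc.2 ⟨hT t ht, T.le_max' t ht⟩
      have := card_le_card this
      simpa [h] using this
    rw [← sum_erase_add _ _ hmax, harmonic_succ]
    have h1 := ih (T.erase (T.max' hne)) (fun t ht => hT t (mem_of_mem_erase ht))
      (by rw [card_erase_of_mem hmax, h]; rfl)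
    have h2 : (1 : ℝ) / (T.max' hne : ℕ) ≤ ((j : ℝ) + 1)⁻¹ := by
      rw [one_div]
      apply inv_anti₀ (by positivity)
      exact_mod_cast hge
    push_cast
    linarith

theorem sum_inv_le_one_add_log {T : Finset ℕ} (hT : ∀ t ∈ T, 1 ≤ t) {k : ℕ}
    (h : #T ≤ k) : ∑ t ∈ T, (1 : ℝ) / t ≤ 1 + Real.log k := by
  rcases Nat.eq_zero_or_pos #T with h0 | h0
  · rw [card_eq_zero.1 h0]
    simp only [sum_empty]
    have := Real.log_natCast_nonneg k
    linarith
  · refine (sum_inv_le_harmonic _ T hT rfl).trans ((harmonic_le_one_add_log _).trans ?_)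
    gcongr

/-- A set of at most `k` primes contributes at most `1 + log k` to `∑ 1 / (p - 1)`. -/
theorem sum_inv_pred_le {T : Finset ℕ} (hT : ∀ t ∈ T, t.Prime) {k : ℕ}
    (h : #T ≤ k) : ∑ t ∈ T, (1 : ℝ) / ((t : ℝ) - 1) ≤ 1 + Real.log k := by
  have hinj : Set.InjOn (fun t : ℕ => t - 1) (T : Set ℕ) := by
    intro a ha b hb hab
    have := (hT a ha).two_le
    have := (hT b hb).two_le
    simp only at hab
    omega
  have := sum_inv_le_one_add_log (T := T.image fun t => t - 1) (k := k) ?_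
    (card_image_le.trans h)
  · rw [sum_image hinj] at this
    refine le_trans (le_of_eq (sum_congr rfl fun t ht => ?_)) this
    rw [Nat.cast_sub (hT t ht).one_le, Nat.cast_one]
  · intro t ht
    obtain ⟨a, ha, rfl⟩ := mem_image.1 ht
    have := (hT a ha).two_le
    omega

end CRTEquidist

/-! ### Mertens' upper bound from Chebyshev's inequality -/

namespace CRTEquidist

open Finset

/-- A discrete form of (log log m)' = 1/(m log m), obtained by applying 1 - 1/y ≤ log y twice. -/
theorem inv_mul_log_le {m : ℝ} (hm : 2 ≤ m) :
    1 / ((m + 1) * Real.log (m + 1)) ≤ Real.log (Real.log (m + 1)) - Real.log (Real.log m) := by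
  have h0 : 0 < Real.log m := Real.log_pos (by linarith)
  have h1 : 0 < Real.log (m + 1) := Real.log_pos (by linarith)
  rw [← Real.log_div h1.ne' h0.ne']
  have h2 := Real.one_sub_inv_le_log_of_pos (div_pos h1 h0)
  have h3 := Real.one_sub_inv_le_log_of_pos (x := (m + 1) / m) (by positivity)
  rw [Real.log_div (by linarith) (by linarith)] at h3
  refine le_trans ?_ h2
  rw [inv_div] at h3 ⊢
  have h4 : 1 - m / (m + 1) = 1 / (m + 1) := by field_simp; ring
  have h5 : 1 - Real.log m / Real.log (m + 1) =
      (Real.log (m + 1) - Real.log m) / Real.log (m + 1) := by field_simp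
  rw [h5, ← div_div, ← h4]
  gcongr

theorem theta_succ (N : ℕ) : Chebyshev.theta ((N + 1 : ℕ) : ℝ) =
    Chebyshev.theta (N : ℝ) + if (N + 1).Prime then Real.log ((N + 1 : ℕ) : ℝ) else 0 := by
  rw [Chebyshev.theta_eq_sum_Icc, Chebyshev.theta_eq_sum_Icc, Nat.floor_natCast, Nat.floor_natCast,
    sum_filter, sum_filter, sum_Icc_succ_top (by omega)]

/-- Partial summation carried out as an induction on N. The boundary term θ(N)/(N log N) is kept in
the statement so that each step needs only θ(N) ≤ N log 4; the remaining terms telescope. -/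
theorem sum_prime_inv_Ioc_le_theta {a : ℕ} (ha : 2 ≤ a) {N : ℕ} (hN : a ≤ N) :
    ∑ p ∈ (Ioc a N).filter Nat.Prime, (1 : ℝ) / p ≤
      Chebyshev.theta N / (N * Real.log N) +
        Real.log 4 * (Real.log (Real.log N) - Real.log (Real.log a) + 1 / Real.log a -
          1 / Real.log N) := by
  induction N, hN using Nat.le_induction with
  | base =>
    have := Chebyshev.theta_nonneg (a : ℝ)
    have h2 : 0 ≤ Real.log (a : ℝ) := Real.log_natCast_nonneg a
    simp only [Ioc_self, filter_empty, sum_empty, sub_self, zero_add, mul_zero, add_zero]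
    positivity
  | succ N hN ih =>
    have hN2 : (2 : ℝ) ≤ N := by exact_mod_cast ha.trans hN
    have h0 : 0 < Real.log (N : ℝ) := Real.log_pos (by linarith)
    have h1 : 0 < Real.log ((N : ℝ) + 1) := Real.log_pos (by linarith)
    have hth := Chebyshev.theta_le_log4_mul_x (x := (N : ℝ)) (by positivity)
    have hstep := inv_mul_log_le hN2
    have hmono : 1 / (((N : ℝ) + 1) * Real.log (N + 1)) ≤ 1 / (N * Real.log N) := by
      have : Real.log (N : ℝ) ≤ Real.log (N + 1) := Real.log_le_log (by linarith) (by linarith)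
      gcongr
      linarith
    have hth2 := mul_le_mul_of_nonneg_right hth (sub_nonneg.2 hmono)
    have hc : 0 < Real.log 4 := Real.log_pos (by norm_num)
    have e1 : Real.log 4 * (N : ℝ) * (1 / (N * Real.log N) - 1 / (((N : ℝ) + 1) * Real.log (N + 1)))
        = Real.log 4 * (1 / Real.log N - 1 / Real.log (N + 1) +
          1 / (((N : ℝ) + 1) * Real.log (N + 1))) := by
      have : (N : ℝ) ≠ 0 := by linarith
      field_simp
      ring
    have hstep2 := mul_le_mul_of_nonneg_left hstep hc.le
    rw [e1] at hth2
    rw [sum_filter, sum_Ioc_succ_top (by omega), ← sum_filter, theta_succ]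
    have e2 : (if (N + 1).Prime then (1 : ℝ) / ((N + 1 : ℕ) : ℝ) else 0) =
        (if (N + 1).Prime then Real.log ((N + 1 : ℕ) : ℝ) else 0) *
          (1 / (((N : ℝ) + 1) * Real.log (N + 1))) := by
      split_ifs
      · push_cast; field_simp
      · simp
    rw [e2]
    push_cast at hth2 hstep2 ih ⊢
    rw [div_eq_mul_one_div] at ih ⊢
    rw [add_mul]
    ring_nf at hth2 hstep2 ih ⊢
    linarith

/-- A form of Mertens' upper bound, with the constant from Chebyshev's inequality. -/
theorem sum_prime_inv_Ioc_le {a N : ℕ} (ha : 2 ≤ a) (hN : a ≤ N) :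
    ∑ p ∈ (Ioc a N).filter Nat.Prime, (1 : ℝ) / p ≤
      Real.log 4 * (Real.log (Real.log N) - Real.log (Real.log a) + 1 / Real.log a) := by
  refine (sum_prime_inv_Ioc_le_theta ha hN).trans ?_
  have hN2 : (2 : ℝ) ≤ N := by exact_mod_cast ha.trans hN
  have h0 : 0 < Real.log (N : ℝ) := Real.log_pos (by linarith)
  have hth := Chebyshev.theta_le_log4_mul_x (x := (N : ℝ)) (by positivity)
  have : Chebyshev.theta N / (N * Real.log N) ≤ Real.log 4 * (1 / Real.log N) := by
    rw [mul_one_div]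
    rw [div_le_div_iff₀ (by positivity) h0]
    nlinarith
  linarith

end CRTEquidist

/-! ### Selberg's sieve and an inequality of Brun–Titchmarsh type -/

namespace CRTEquidist

open Finset ArithmeticFunction

/-- Squarefree integers up to `D` which are coprime to `r`. -/
def sieveSupport (r D : ℕ) : Finset ℕ :=
  (Icc 1 D).filter fun d => Squarefree d ∧ d.Coprime r

/-- The denominator in Selberg's upper bound sieve for an arithmetic progression modulo `r`. -/
noncomputable def sieveSum (r D : ℕ) : ℝ :=
  ∑ l ∈ sieveSupport r D, (1 : ℝ) / l.totient

/-- Selberg's weights. -/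
noncomputable def sieveWeight (r D d : ℕ) : ℝ :=
  (d : ℝ) * (moebius d : ℝ) / sieveSum r D *
    ∑ m ∈ (sieveSupport r D).filter (d ∣ ·), (1 : ℝ) / m.totient

theorem mem_sieveSupport {r D d : ℕ} :
    d ∈ sieveSupport r D ↔ (1 ≤ d ∧ d ≤ D) ∧ Squarefree d ∧ d.Coprime r := by
  simp [sieveSupport]

theorem mem_sieveSupport_of_dvd {r D d l : ℕ} (hd : d ∈ sieveSupport r D) (h : l ∣ d) :
    l ∈ sieveSupport r D := by
  rw [mem_sieveSupport] at hd ⊢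
  have hpos := Nat.pos_of_dvd_of_pos h hd.1.1
  exact ⟨⟨hpos, (Nat.le_of_dvd hd.1.1 h).trans hd.1.2⟩, hd.2.1.squarefree_of_dvd h,
    hd.2.2.coprime_dvd_left h⟩

theorem one_mem_sieveSupport {r D : ℕ} (hD : 1 ≤ D) : 1 ∈ sieveSupport r D := by
  simp [mem_sieveSupport, hD]

theorem sieveSum_pos {r D : ℕ} (hD : 1 ≤ D) : 0 < sieveSum r D := by
  refine sum_pos (fun l hl => ?_) ⟨1, one_mem_sieveSupport hD⟩
  have : 0 < l.totient := Nat.totient_pos.2 (mem_sieveSupport.1 hl).1.1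
  positivity

theorem sieveWeight_one {r D : ℕ} (hD : 1 ≤ D) : sieveWeight r D 1 = 1 := by
  have := (sieveSum_pos (r := r) hD).ne'
  simp only [sieveWeight, Nat.cast_one, moebius_apply_one, Int.cast_one, one_dvd, filter_true,
    mul_one]
  rw [← sieveSum]
  field_simp

/-- This crude bound costs only a power of D in the remainder of the sieve, which is harmless
because D will be a small power of the range. -/
theorem abs_sieveWeight_le {r D d : ℕ} (hD : 1 ≤ D) : |sieveWeight r D d| ≤ d := by
  have hS := sieveSum_pos (r := r) hD
  rw [sieveWeight, abs_mul, abs_div, abs_mul, Nat.abs_cast, abs_of_pos hS]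
  have h1 : |((moebius d : ℤ) : ℝ)| ≤ 1 := by exact_mod_cast abs_moebius_le_one (n := d)
  have h2 : 0 ≤ ∑ m ∈ (sieveSupport r D).filter (d ∣ ·), (1 : ℝ) / m.totient :=
    sum_nonneg fun _ _ => by positivity
  rw [abs_of_nonneg h2]
  have h3 : ∑ m ∈ (sieveSupport r D).filter (d ∣ ·), (1 : ℝ) / m.totient ≤ sieveSum r D :=
    sum_le_sum_of_subset_of_nonneg (filter_subset _ _) fun _ _ _ => by positivity
  rw [div_mul_eq_mul_div, div_le_iff₀ hS]
  calc (d : ℝ) * |((moebius d : ℤ) : ℝ)| * _ ≤ (d : ℝ) * 1 * sieveSum r D := by gcongr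
    _ = _ := by ring

theorem sum_moebius_divisors (n : ℕ) :
    ∑ d ∈ n.divisors, moebius d = if n = 1 then 1 else 0 := by
  have := congrArg (fun f => f n) coe_zeta_mul_moebius
  simp only [coe_zeta_mul_apply, one_apply] at this
  exact this

/-- Write m = le with l and e coprime: the sum becomes μ(l) times the sum of μ over the divisors of
e. -/
theorem sum_moebius_between {l m : ℕ} (hl : l ∣ m) (hm : Squarefree m) :
    ∑ d ∈ m.divisors.filter (l ∣ ·), moebius d = if m = l then moebius l else 0 := by
  obtain ⟨e, rfl⟩ := hl
  have hm0 := hm.ne_zero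
  have hl0 : l ≠ 0 := left_ne_zero_of_mul hm0
  have he0 : e ≠ 0 := right_ne_zero_of_mul hm0
  have hco : l.Coprime e := Nat.coprime_of_squarefree_mul hm
  have h1 : (l * e).divisors.filter (l ∣ ·) = e.divisors.image (l * ·) := by
    ext d
    simp only [mem_filter, Nat.mem_divisors, mem_image]
    constructor
    · rintro ⟨⟨h1, -⟩, f, rfl⟩
      exact ⟨f, ⟨Nat.dvd_of_mul_dvd_mul_left (Nat.pos_of_ne_zero hl0) h1, he0⟩, rfl⟩
    · rintro ⟨f, ⟨h1, -⟩, rfl⟩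
      exact ⟨⟨Nat.mul_dvd_mul_left l h1, hm0⟩, dvd_mul_right _ _⟩
  rw [h1, sum_image fun a _ b _ hab => Nat.eq_of_mul_eq_mul_left (Nat.pos_of_ne_zero hl0) hab]
  have h2 : ∀ f ∈ e.divisors, moebius (l * f) = moebius l * moebius f := fun f hf =>
    isMultiplicative_moebius.map_mul_of_coprime
      (hco.coprime_dvd_right (Nat.dvd_of_mem_divisors hf))
  rw [sum_congr rfl h2, ← mul_sum, sum_moebius_divisors e]
  have h3 : l * e = l ↔ e = 1 := by
    constructor
    · intro h; exact Nat.eq_of_mul_eq_mul_left (Nat.pos_of_ne_zero hl0) (by rw [h, mul_one])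
    · rintro rfl; simp
  simp [h3]

/-- These sums are the variables in which Selberg's quadratic form is diagonal. After interchanging
the summations, the Möbius sum over l ∣ d ∣ m leaves only m = l. -/
theorem sum_sieveWeight_div {r D l : ℕ} (hl : l ∈ sieveSupport r D) :
    ∑ d ∈ (sieveSupport r D).filter (l ∣ ·), sieveWeight r D d / d =
      (moebius l : ℝ) / (sieveSum r D * l.totient) := by
  have h1 : ∀ d ∈ (sieveSupport r D).filter (l ∣ ·), sieveWeight r D d / d =
      ∑ m ∈ sieveSupport r D, if d ∣ m then
        (moebius d : ℝ) * (1 / (sieveSum r D * m.totient)) else 0 := by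
    intro d hd
    have hd0 : (d : ℝ) ≠ 0 := by
      have := (mem_sieveSupport.1 (mem_filter.1 hd).1).1.1
      positivity
    rw [sieveWeight, sum_filter, mul_sum, sum_div]
    refine sum_congr rfl fun m _ => ?_
    split_ifs
    · field_simp
    · simp
  rw [sum_congr rfl h1, sum_comm]
  have h2 : ∀ m ∈ sieveSupport r D, (∑ d ∈ (sieveSupport r D).filter (l ∣ ·), if d ∣ m then
        (moebius d : ℝ) * (1 / (sieveSum r D * m.totient)) else 0) =
      if m = l then (moebius l : ℝ) / (sieveSum r D * l.totient) else 0 := by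
    intro m hm
    have h3 : ((sieveSupport r D).filter (l ∣ ·)).filter (· ∣ m) =
        m.divisors.filter (l ∣ ·) := by
      ext d
      simp only [mem_filter, Nat.mem_divisors]
      have := (mem_sieveSupport.1 hm).1.1
      constructor
      · rintro ⟨⟨-, h1⟩, h2⟩; exact ⟨⟨h2, by omega⟩, h1⟩
      · rintro ⟨⟨h2, -⟩, h1⟩; exact ⟨⟨mem_sieveSupport_of_dvd hm h2, h1⟩, h2⟩
    rw [← sum_filter, h3, ← sum_mul, ← Int.cast_sum]
    by_cases hlm : l ∣ m
    · rw [sum_moebius_between hlm (mem_sieveSupport.1 hm).2.1]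
      split_ifs with h
      · subst h; rw [mul_one_div]
      · simp
    · have : m.divisors.filter (l ∣ ·) = ∅ := by
        refine filter_eq_empty_iff.2 fun d hd h => hlm (h.trans (Nat.dvd_of_mem_divisors hd))
      rw [this, if_neg (by rintro rfl; exact hlm dvd_rfl)]
      simp
  rw [sum_congr rfl h2, sum_ite_eq' _ l, if_pos hl]

/-- Since 1/lcm(a,b) = gcd(a,b)/(ab) and gcd(a,b) is the sum of φ(l) over its divisors l, the form
becomes a sum of φ(l) times squares of the sums in `sum_sieveWeight_div`. Each term equals
1/(S²φ(l)), where S is the sieve sum, and the total is S/S². -/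
theorem sum_sieveWeight_lcm {r D : ℕ} (hD : 1 ≤ D) :
    ∑ a ∈ sieveSupport r D, ∑ b ∈ sieveSupport r D,
      sieveWeight r D a * sieveWeight r D b / (Nat.lcm a b : ℝ) = 1 / sieveSum r D := by
  have h1 : ∀ a ∈ sieveSupport r D, ∀ b ∈ sieveSupport r D,
      sieveWeight r D a * sieveWeight r D b / (Nat.lcm a b : ℝ) =
      ∑ l ∈ sieveSupport r D, (l.totient : ℝ) * ((if l ∣ a then sieveWeight r D a / a else 0) *
        (if l ∣ b then sieveWeight r D b / b else 0)) := by
    intro a ha b hb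
    have ha0 := (mem_sieveSupport.1 ha).1.1
    have hb0 := (mem_sieveSupport.1 hb).1.1
    have hg : (Nat.gcd a b : ℝ) = ∑ l ∈ sieveSupport r D,
        if l ∣ a ∧ l ∣ b then (l.totient : ℝ) else 0 := by
      rw [← sum_filter]
      conv_lhs => rw [← Nat.sum_totient (Nat.gcd a b)]
      rw [Nat.cast_sum]
      refine sum_congr ?_ fun _ _ => rfl
      ext l
      simp only [Nat.mem_divisors, Nat.dvd_gcd_iff, mem_filter]
      constructor
      · rintro ⟨h, -⟩; exact ⟨mem_sieveSupport_of_dvd ha h.1, h⟩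
      · rintro ⟨-, h⟩; exact ⟨h, (Nat.gcd_pos_of_pos_left b ha0).ne'⟩
    have hl : (Nat.lcm a b : ℝ) * Nat.gcd a b = a * b := by
      exact_mod_cast (mul_comm _ _).trans (Nat.gcd_mul_lcm a b)
    have hl0 : (Nat.lcm a b : ℝ) ≠ 0 := by
      exact_mod_cast (Nat.lcm_pos ha0 hb0).ne'
    have e : sieveWeight r D a * sieveWeight r D b / (Nat.lcm a b : ℝ) =
        (Nat.gcd a b : ℝ) * (sieveWeight r D a / a * (sieveWeight r D b / b)) := by
      have : (a : ℝ) ≠ 0 := by positivity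
      have : (b : ℝ) ≠ 0 := by positivity
      field_simp
      linear_combination (-sieveWeight r D a * sieveWeight r D b) * hl
    rw [e, hg, sum_mul]
    refine sum_congr rfl fun l _ => ?_
    by_cases h1 : l ∣ a <;> by_cases h2 : l ∣ b <;> simp [h1, h2]
  rw [sum_congr rfl fun a ha => sum_congr rfl (h1 a ha)]
  have h2 : ∀ a ∈ sieveSupport r D, (∑ b ∈ sieveSupport r D, ∑ l ∈ sieveSupport r D,
      (l.totient : ℝ) * ((if l ∣ a then sieveWeight r D a / a else 0) *
        (if l ∣ b then sieveWeight r D b / b else 0))) =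
      ∑ l ∈ sieveSupport r D, ∑ b ∈ sieveSupport r D,
      (l.totient : ℝ) * ((if l ∣ a then sieveWeight r D a / a else 0) *
        (if l ∣ b then sieveWeight r D b / b else 0)) := fun a _ => sum_comm
  rw [sum_congr rfl h2, sum_comm]
  have h3 : ∀ l ∈ sieveSupport r D, (∑ a ∈ sieveSupport r D, ∑ b ∈ sieveSupport r D,
      (l.totient : ℝ) * ((if l ∣ a then sieveWeight r D a / a else 0) *
        (if l ∣ b then sieveWeight r D b / b else 0))) =
      1 / sieveSum r D ^ 2 * (1 / l.totient) := by
    intro l hl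
    simp_rw [← mul_sum, ← sum_mul, ← sum_filter]
    rw [sum_sieveWeight_div hl]
    have h4 : (moebius l : ℝ) ^ 2 = 1 := by
      exact_mod_cast moebius_sq_eq_one_of_squarefree (mem_sieveSupport.1 hl).2.1
    have h5 : (0 : ℝ) < l.totient := by
      exact_mod_cast Nat.totient_pos.2 (mem_sieveSupport.1 hl).1.1
    have h6 := sieveSum_pos (r := r) hD
    field_simp
    exact h4
  rw [sum_congr rfl h3, ← mul_sum, ← sieveSum]
  have h6 := sieveSum_pos (r := r) hD
  field_simp

theorem abs_card_modEq_sub_le {q : ℕ} (hq : 0 < q) (N v : ℕ) :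
    |(#{x ∈ Ioc 0 N | x ≡ v [MOD q]} : ℝ) - N / q| ≤ 1 := by
  have h := Nat.Ioc_filter_modEq_card 0 N hq v
  have hq' : (0 : ℚ) < q := by exact_mod_cast hq
  have h1 : |(#{x ∈ Ioc 0 N | x ≡ v [MOD q]} : ℚ) - N / q| ≤ 1 := by
    have h' : (#{x ∈ Ioc 0 N | x ≡ v [MOD q]} : ℚ) =
        ((max (⌊((N : ℚ) - v) / q⌋ - ⌊(((0 : ℕ) : ℚ) - v) / q⌋) 0 : ℤ) : ℚ) := by
      rw [← h]; simp
    rw [h']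
    have a1 := Int.floor_le (((N : ℚ) - v) / q)
    have a2 := Int.lt_floor_add_one (((N : ℚ) - v) / q)
    have b1 := Int.floor_le ((((0 : ℕ) : ℚ) - v) / q)
    have b2 := Int.lt_floor_add_one ((((0 : ℕ) : ℚ) - v) / q)
    have hN : 0 ≤ (N : ℚ) / q := by positivity
    have e : ((N : ℚ) - v) / q = N / q + (((0 : ℕ) : ℚ) - v) / q := by
      field_simp; push_cast; ring
    push_cast at *
    rw [abs_le]
    constructor
    · have := le_max_left ((⌊((N : ℚ) - v) / q⌋ : ℚ) - (⌊((0 : ℚ) - v) / q⌋ : ℚ)) 0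
      linarith
    · have : max ((⌊((N : ℚ) - v) / q⌋ : ℚ) - (⌊((0 : ℚ) - v) / q⌋ : ℚ)) 0 ≤ N / q + 1 :=
        max_le (by linarith) (by linarith)
      linarith
  have := (Rat.cast_le (K := ℝ)).2 h1
  simpa using this

theorem abs_card_modEq_dvd_sub_le {r e : ℕ} (hr : 0 < r) (he : 0 < e) (hco : e.Coprime r)
    (N c : ℕ) :
    |(#{x ∈ Ioc 0 N | x ≡ c [MOD r] ∧ e ∣ x} : ℝ) - N / (r * e)| ≤ 1 := by
  obtain ⟨v, hv1, hv2⟩ := Nat.chineseRemainder hco.symm c 0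
  have := abs_card_modEq_sub_le (Nat.mul_pos hr he) N v
  rw [Nat.cast_mul] at this
  convert this using 6 with x
  rw [← Nat.modEq_and_modEq_iff_modEq_mul hco.symm, ← Nat.modEq_zero_iff_dvd]
  exact ⟨fun h => ⟨h.1.trans hv1.symm, h.2.trans hv2.symm⟩,
    fun h => ⟨h.1.trans hv1, h.2.trans hv2⟩⟩

/-- Selberg's upper bound sieve for the primes of an arithmetic progression. -/
theorem card_primes_modEq_le {r D : ℕ} (hr : 0 < r) (hD : 1 ≤ D) (N c : ℕ) :
    (#{p ∈ Ioc D N | p.Prime ∧ p ≡ c [MOD r]} : ℝ) ≤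
      N / (r * sieveSum r D) + (D : ℝ) ^ 4 := by
  set s := sieveSupport r D
  set I := (Ioc 0 N).filter fun x => x ≡ c [MOD r]
  have h1 : (#{p ∈ Ioc D N | p.Prime ∧ p ≡ c [MOD r]} : ℝ) ≤
      ∑ x ∈ I, (∑ d ∈ s.filter (· ∣ x), sieveWeight r D d) ^ 2 := by
    rw [card_eq_sum_ones, Nat.cast_sum]
    have hsub : (Ioc D N).filter (fun p => p.Prime ∧ p ≡ c [MOD r]) ⊆ I := by
      intro p hp
      simp only [I, mem_filter, mem_Ioc] at hp ⊢
      exact ⟨⟨hp.2.1.pos, hp.1.2⟩, hp.2.2⟩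
    refine le_trans (le_of_eq (sum_congr rfl fun p hp => ?_))
      (sum_le_sum_of_subset_of_nonneg hsub fun _ _ _ => sq_nonneg _)
    -- A prime p > D has no divisor in the sieve support except 1, so the square at p equals 1.
    have : s.filter (· ∣ p) = {1} := by
      ext d
      simp only [mem_filter, mem_singleton, mem_Ioc] at hp ⊢
      constructor
      · rintro ⟨h, hd⟩
        rcases (Nat.dvd_prime hp.2.1).1 hd with h1 | h1
        · exact h1
        · have := (mem_sieveSupport.1 h).1.2
          omega
      · rintro rfl
        exact ⟨one_mem_sieveSupport hD, one_dvd _⟩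
    rw [this, sum_singleton, sieveWeight_one hD]
    simp
  refine h1.trans ?_
  have h2 : ∑ x ∈ I, (∑ d ∈ s.filter (· ∣ x), sieveWeight r D d) ^ 2 =
      ∑ a ∈ s, ∑ b ∈ s, sieveWeight r D a * sieveWeight r D b *
        (#{x ∈ Ioc 0 N | x ≡ c [MOD r] ∧ Nat.lcm a b ∣ x} : ℝ) := by
    have e1 : ∀ x ∈ I, (∑ d ∈ s.filter (· ∣ x), sieveWeight r D d) ^ 2 =
        ∑ a ∈ s, ∑ b ∈ s, if Nat.lcm a b ∣ x then
          sieveWeight r D a * sieveWeight r D b else 0 := by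
      intro x _
      rw [sq, sum_filter, sum_mul_sum]
      refine sum_congr rfl fun a _ => sum_congr rfl fun b _ => ?_
      by_cases h1 : a ∣ x <;> by_cases h2 : b ∣ x <;> simp [Nat.lcm_dvd_iff, h1, h2]
    rw [sum_congr rfl e1, sum_comm]
    refine sum_congr rfl fun a _ => ?_
    rw [sum_comm]
    refine sum_congr rfl fun b _ => ?_
    rw [← sum_filter, sum_const, nsmul_eq_mul, mul_comm, filter_filter]
  rw [h2]
  have h3 : ∀ a ∈ s, ∀ b ∈ s, sieveWeight r D a * sieveWeight r D b *
        (#{x ∈ Ioc 0 N | x ≡ c [MOD r] ∧ Nat.lcm a b ∣ x} : ℝ) ≤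
      (N / r : ℝ) * (sieveWeight r D a * sieveWeight r D b / (Nat.lcm a b : ℝ)) + D * D := by
    intro a ha b hb
    have ha' := mem_sieveSupport.1 ha
    have hb' := mem_sieveSupport.1 hb
    have hl := abs_card_modEq_dvd_sub_le hr (Nat.lcm_pos ha'.1.1 hb'.1.1)
      ((ha'.2.2.mul_left hb'.2.2).coprime_dvd_left (Nat.lcm_dvd_mul a b)) N c
    have hwa := (abs_sieveWeight_le (r := r) (d := a) hD).trans
      (Nat.cast_le.2 ha'.1.2 : (a : ℝ) ≤ D)
    have hwb := (abs_sieveWeight_le (r := r) (d := b) hD).trans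
      (Nat.cast_le.2 hb'.1.2 : (b : ℝ) ≤ D)
    have hab : |sieveWeight r D a * sieveWeight r D b| ≤ D * D := by
      rw [abs_mul]; gcongr
    have hkey : |sieveWeight r D a * sieveWeight r D b *
        ((#{x ∈ Ioc 0 N | x ≡ c [MOD r] ∧ Nat.lcm a b ∣ x} : ℝ) - N / (r * Nat.lcm a b))| ≤
        D * D * 1 := by
      rw [abs_mul]; gcongr
    have := (abs_le.1 hkey).2
    have e : (N / r : ℝ) * (sieveWeight r D a * sieveWeight r D b / (Nat.lcm a b : ℝ)) =
        sieveWeight r D a * sieveWeight r D b * (N / (r * Nat.lcm a b)) := by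
      rw [div_mul_div_comm, mul_div_assoc', mul_comm (N : ℝ)]
    rw [e]
    linarith
  refine (sum_le_sum fun a ha => sum_le_sum (h3 a ha)).trans ?_
  simp_rw [sum_add_distrib, ← mul_sum]
  rw [sum_sieveWeight_lcm hD]
  have hcard : (#s : ℝ) ≤ D := by
    have : #s ≤ #(Icc 1 D) := card_le_card (filter_subset _ _)
    exact_mod_cast this.trans (by simp)
  simp only [sum_const, nsmul_eq_mul]
  -- At most D² pairs, each with remainder at most D², account for the term D⁴.
  have : (#s : ℝ) * (#s * (D * D)) ≤ D * (D * (D * D)) := by gcongr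
  rw [div_mul_div_comm, mul_one]
  linarith [show (D : ℝ) * (D * (D * D)) = D ^ 4 by ring]

theorem sum_inv_sq_le (D : ℕ) : ∑ m ∈ Icc 1 (D + 1), (1 : ℝ) / (m : ℝ) ^ 2 ≤ 2 - 1 / (D + 1) := by
  induction D with
  | zero => norm_num
  | succ D ih =>
    rw [sum_Icc_succ_top (by omega)]
    push_cast
    have hD : (0 : ℝ) ≤ D := by positivity
    have : (1 : ℝ) / (D + 1 + 1) ^ 2 ≤ 1 / (D + 1) - 1 / (D + 1 + 1) := by
      rw [div_sub_div _ _ (by positivity) (by positivity), div_le_div_iff₀ (by positivity)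
        (by positivity)]
      nlinarith
    linarith

theorem sum_inv_sq_le_two (D : ℕ) : ∑ m ∈ Icc 1 D, (1 : ℝ) / (m : ℝ) ^ 2 ≤ 2 := by
  cases D with
  | zero => simp
  | succ D =>
    have h : (0 : ℝ) ≤ 1 / (D + 1) := by positivity
    linarith [sum_inv_sq_le D]

/-- If `g` injects `s` into `t ×ˢ u` compatibly with the values, the sum over `s` is at most
the product of the sums over `t` and `u`. -/
theorem sum_le_sum_mul_sum {s t u : Finset ℕ} {F f g : ℕ → ℝ} (φ : ℕ → ℕ × ℕ)
    (hφ : ∀ n ∈ s, φ n ∈ t ×ˢ u) (hinj : Set.InjOn φ s)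
    (hF : ∀ n ∈ s, F n = f (φ n).1 * g (φ n).2) (hf : ∀ a ∈ t, 0 ≤ f a) (hg : ∀ b ∈ u, 0 ≤ g b) :
    ∑ n ∈ s, F n ≤ (∑ a ∈ t, f a) * ∑ b ∈ u, g b := by
  rw [sum_mul_sum, ← sum_product', sum_congr rfl hF,
    ← sum_image (f := fun x : ℕ × ℕ => f x.1 * g x.2) hinj]
  refine sum_le_sum_of_subset_of_nonneg (image_subset_iff.2 hφ) fun x hx _ => ?_
  rw [mem_product] at hx
  exact mul_nonneg (hf _ hx.1) (hg _ hx.2)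

/-- Every n ≤ D is b²a with a squarefree, so the harmonic sum is at most the product of the sums of
1/b² and 1/a; the constant 2 bounds the former. -/
theorem log_le_two_mul_sum_squarefree (D : ℕ) :
    Real.log D ≤ 2 * ∑ d ∈ (Icc 1 D).filter Squarefree, (1 : ℝ) / d := by
  rcases Nat.eq_zero_or_pos D with h | hD
  · subst h; simp
  have h1 : Real.log D ≤ ∑ n ∈ Icc 1 D, (1 : ℝ) / n := by
    have h2 := log_add_one_le_harmonic D
    have h3 : Real.log D ≤ Real.log (D + 1) := Real.log_le_log (by positivity) (by linarith)
    rw [harmonic_eq_sum_Icc] at h2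
    push_cast at h2
    simp_rw [one_div]
    linarith
  refine h1.trans ?_
  choose a b hab using Nat.sq_mul_squarefree
  have hpos : ∀ n ∈ Icc 1 D, 0 < b n ∧ 0 < a n := fun n hn => by
    have h := (mem_Icc.1 hn).1
    have e := (hab n).1
    constructor <;> (refine Nat.pos_of_ne_zero fun h0 => ?_; rw [h0] at e; simp at e; omega)
  have := sum_le_sum_mul_sum (s := Icc 1 D) (t := Icc 1 D) (u := (Icc 1 D).filter Squarefree)
    (F := fun n => (1 : ℝ) / n) (f := fun m => (1 : ℝ) / (m : ℝ) ^ 2) (g := fun d => (1 : ℝ) / d)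
    (fun n => (b n, a n)) ?_ ?_ ?_ (fun _ _ => by positivity) (fun _ _ => by positivity)
  · refine this.trans (mul_le_mul_of_nonneg_right (sum_inv_sq_le_two D) ?_)
    exact sum_nonneg fun _ _ => by positivity
  · intro n hn
    have hp := hpos n hn
    have e := (hab n).1
    have hn' := (mem_Icc.1 hn)
    have h1 : a n ≤ n := Nat.le_of_dvd hn'.1 ⟨b n ^ 2, by rw [mul_comm]; exact e.symm⟩
    have h2 : b n ≤ n := Nat.le_of_dvd hn'.1 ⟨b n * a n, by rw [← mul_assoc, ← sq]; exact e.symm⟩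
    simp only [mem_product, mem_Icc, mem_filter]
    exact ⟨⟨hp.1, by omega⟩, ⟨hp.2, by omega⟩, (hab n).2⟩
  · intro n _ m _ h
    simp only [Prod.mk.injEq] at h
    rw [← (hab n).1, ← (hab m).1, h.1, h.2]
  · intro n hn
    have e : (b n : ℝ) ^ 2 * a n = n := by exact_mod_cast (hab n).1
    simp only
    rw [← e, one_div_mul_one_div]

/-- The sum is bounded by the product of 1 + 1/p over p ∣ r, and (1 + 1/p)(1 - 1/p) ≤ 1. -/
theorem sum_squarefree_divisors_inv_le {r : ℕ} (hr : 0 < r) :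
    ∑ d ∈ r.divisors.filter Squarefree, (1 : ℝ) / d ≤ r / r.totient := by
  have h1 : ∑ d ∈ r.divisors.filter Squarefree, (1 : ℝ) / d ≤
      ∏ p ∈ r.primeFactors, (1 + 1 / (p : ℝ)) := by
    rw [prod_one_add]
    have hinj : Set.InjOn Nat.primeFactors (r.divisors.filter Squarefree : Finset ℕ) := by
      intro a ha b hb h
      simp only [coe_filter, Set.mem_ofPred_eq] at ha hb
      rw [← Nat.prod_primeFactors_of_squarefree ha.2, ← Nat.prod_primeFactors_of_squarefree hb.2, h]
    have h2 : ∀ d ∈ r.divisors.filter Squarefree,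
        (1 : ℝ) / d = ∏ p ∈ d.primeFactors, 1 / (p : ℝ) := by
      intro d hd
      conv_lhs => rw [← Nat.prod_primeFactors_of_squarefree (mem_filter.1 hd).2]
      push_cast
      rw [prod_div_distrib, prod_const_one]
    rw [sum_congr rfl h2, ← sum_image (f := fun t : Finset ℕ => ∏ p ∈ t, 1 / (p : ℝ)) hinj]
    refine sum_le_sum_of_subset_of_nonneg (image_subset_iff.2 fun d hd => ?_) fun t _ _ =>
      prod_nonneg fun _ _ => by positivity
    rw [mem_filter, Nat.mem_divisors] at hd
    exact mem_powerset.2 (Nat.primeFactors_mono hd.1.1 hr.ne')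
  refine h1.trans ?_
  have h2 : (r.totient : ℝ) = r * ∏ p ∈ r.primeFactors, (1 - (p : ℝ)⁻¹) := by
    have := congrArg (fun x : ℚ => (x : ℝ)) (Nat.totient_eq_mul_prod_factors r)
    push_cast at this
    exact this
  have h3 : (0 : ℝ) < r.totient := by exact_mod_cast Nat.totient_pos.2 hr
  have h4 : (0 : ℝ) < r := by exact_mod_cast hr
  rw [le_div_iff₀ h3, h2, mul_left_comm, ← prod_mul_distrib]
  refine mul_le_of_le_one_right h4.le (prod_le_one (fun p hp => ?_) fun p hp => ?_) <;>
    have hp1 : (1 : ℝ) ≤ p := by exact_mod_cast (Nat.prime_of_mem_primeFactors hp).one_le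
  · have : (p : ℝ)⁻¹ ≤ 1 := inv_le_one_of_one_le₀ hp1
    exact mul_nonneg (by positivity) (by linarith)
  · rw [one_div]
    nlinarith [sq_nonneg ((p : ℝ)⁻¹)]

/-- Lower bound for the sieve denominator. A squarefree d splits as gcd(d,r) times a cofactor
coprime to r, so restricting to integers coprime to r loses at most the factor r/φ(r). -/
theorem totient_mul_log_le_sieveSum {r D : ℕ} (hr : 0 < r) :
    (r.totient : ℝ) * Real.log D ≤ 2 * (r * sieveSum r D) := by
  have h1 : ∑ d ∈ (Icc 1 D).filter Squarefree, (1 : ℝ) / d ≤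
      (∑ d ∈ r.divisors.filter Squarefree, (1 : ℝ) / d) *
        ∑ l ∈ sieveSupport r D, (1 : ℝ) / l := by
    refine sum_le_sum_mul_sum (fun d => (d.gcd r, d / d.gcd r)) ?_ ?_ ?_
      (fun _ _ => by positivity) (fun _ _ => by positivity)
    · intro d hd
      simp only [mem_filter, mem_Icc] at hd
      have hg : 0 < d.gcd r := Nat.gcd_pos_of_pos_left _ hd.1.1
      have hd' : d.gcd r * (d / d.gcd r) = d := Nat.mul_div_cancel' (Nat.gcd_dvd_left d r)
      have hsq : Squarefree (d.gcd r * (d / d.gcd r)) := by rw [hd']; exact hd.2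
      simp only [mem_product, mem_filter, Nat.mem_divisors, mem_sieveSupport]
      refine ⟨⟨⟨Nat.gcd_dvd_right d r, hr.ne'⟩, hd.2.squarefree_of_dvd (Nat.gcd_dvd_left d r)⟩,
        ⟨Nat.div_pos (Nat.le_of_dvd hd.1.1 (Nat.gcd_dvd_left d r)) hg,
          (Nat.div_le_self _ _).trans hd.1.2⟩,
        hd.2.squarefree_of_dvd (Nat.div_dvd_of_dvd (Nat.gcd_dvd_left d r)), ?_⟩
      refine Nat.Coprime.symm (Nat.coprime_of_dvd fun p hp hpr hpd => ?_)
      have h2 : p ∣ d.gcd r :=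
        Nat.dvd_gcd (hpd.trans (Nat.div_dvd_of_dvd (Nat.gcd_dvd_left d r))) hpr
      exact Nat.not_coprime_of_dvd_of_dvd hp.one_lt h2 hpd (Nat.coprime_of_squarefree_mul hsq)
    · intro a _ b _ h
      simp only [Prod.mk.injEq] at h
      rw [← Nat.mul_div_cancel' (Nat.gcd_dvd_left a r), ← Nat.mul_div_cancel' (Nat.gcd_dvd_left b r),
        h.2, h.1]
    · intro d _
      have hd' : ((d.gcd r : ℕ) : ℝ) * ((d / d.gcd r : ℕ) : ℝ) = d := by
        exact_mod_cast Nat.mul_div_cancel' (Nat.gcd_dvd_left d r)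
      simp only
      rw [one_div_mul_one_div, hd']
  have h2 : ∑ l ∈ sieveSupport r D, (1 : ℝ) / l ≤ sieveSum r D := by
    refine sum_le_sum fun l hl => ?_
    have : 0 < l.totient := Nat.totient_pos.2 (mem_sieveSupport.1 hl).1.1
    have h3 : (l.totient : ℝ) ≤ l := by exact_mod_cast Nat.totient_le l
    gcongr
  have h3 : (0 : ℝ) < r.totient := by exact_mod_cast Nat.totient_pos.2 hr
  have h4 : ∑ d ∈ (Icc 1 D).filter Squarefree, (1 : ℝ) / d ≤ r / r.totient * sieveSum r D := by
    refine h1.trans (mul_le_mul (sum_squarefree_divisors_inv_le hr) h2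
      (sum_nonneg fun _ _ => by positivity) (by positivity))
  have h5 := (log_le_two_mul_sum_squarefree D).trans (mul_le_mul_of_nonneg_left h4 zero_le_two)
  have h6 := mul_le_mul_of_nonneg_left h5 h3.le
  refine h6.trans (le_of_eq ?_)
  field_simp

/-- An inequality of Brun–Titchmarsh type. -/
theorem card_primes_modEq_le_totient {r D : ℕ} (hr : 0 < r) (hD : 2 ≤ D) (N c : ℕ) :
    (#{p ∈ Ioc D N | p.Prime ∧ p ≡ c [MOD r]} : ℝ) ≤
      2 * N / (r.totient * Real.log D) + (D : ℝ) ^ 4 := by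
  refine (card_primes_modEq_le hr (by omega) N c).trans (add_le_add_left ?_ _)
  have h1 := totient_mul_log_le_sieveSum (D := D) hr
  have h2 := sieveSum_pos (r := r) (D := D) (by omega)
  have h3 : (0 : ℝ) < r.totient := by exact_mod_cast Nat.totient_pos.2 hr
  have h4 : 0 < Real.log D := Real.log_pos (by exact_mod_cast hD)
  have h5 : (0 : ℝ) < r := by exact_mod_cast hr
  rw [div_le_div_iff₀ (by positivity) (by positivity)]
  have h6 : (0 : ℝ) ≤ N := by positivity
  nlinarith [mul_le_mul_of_nonneg_left h1 h6]

end CRTEquidist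

/-! ### Trapezoid functions on the circle and their Fourier series -/

namespace CRTEquidist

open Finset

theorem fourier_add_eq (h : ℤ) (x y : UnitAddCircle) :
    fourier h (x + y) = fourier h x * fourier h y := by
  simp only [fourier_apply, smul_add, AddCircle.toCircle_add, Circle.coe_mul]

theorem norm_fourier_apply (h : ℤ) (x : UnitAddCircle) : ‖fourier h x‖ = 1 := by
  rw [fourier_apply, Circle.norm_coe]

/-- The trapezoid function with plateau `[ε, c]` and support `[0, c + ε]`. -/
noncomputable def trapezoid (ε c t : ℝ) : ℝ :=
  max 0 (min 1 (min (t / ε) ((c + ε - t) / ε)))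

/-- The value at `t - s` of the `1`-periodic function agreeing with `B₂` on `[0, 1]`. -/
noncomputable def shiftedBernoulli (t s : ℝ) : ℝ :=
  if s ≤ t then bernoulliFun 2 (t - s) else bernoulliFun 2 (t - s + 1)

/-- The slope of the periodic B₂ jumps by -2 at the integers, so four translates reproduce the kinks
at 0, ε, c and c + ε, while their quadratic and linear parts cancel up to the constant c. This
reduces the Fourier series of the trapezoid to that of B₂. -/
theorem trapezoid_eq {ε c t : ℝ} (hε : 0 < ε) (hc : ε ≤ c) (ht0 : 0 ≤ t) :
    trapezoid ε c t = c - 1 / (2 * ε) * (shiftedBernoulli t 0 - shiftedBernoulli t ε -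
      shiftedBernoulli t c + shiftedBernoulli t (c + ε)) := by
  simp only [shiftedBernoulli, bernoulliFun_two, if_pos ht0, trapezoid]
  rcases lt_or_ge t ε with h1 | h1
  · rw [if_neg (by linarith), if_neg (by linarith), if_neg (by linarith)]
    have a1 : t / ε ≤ 1 := by rw [div_le_one hε]; exact h1.le
    have a2 : t / ε ≤ (c + ε - t) / ε := by gcongr; linarith
    rw [min_eq_left a2, min_eq_right a1, max_eq_right (by positivity)]
    field_simp
    ring
  · rw [if_pos h1]
    have b1 : 1 ≤ t / ε := by rw [one_le_div hε]; exact h1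
    rcases lt_or_ge t c with h2 | h2
    · rw [if_neg (by linarith), if_neg (by linarith)]
      have a2 : 1 ≤ (c + ε - t) / ε := by rw [one_le_div hε]; linarith
      rw [min_eq_left (le_min b1 a2), max_eq_right zero_le_one]
      field_simp
      ring
    · rw [if_pos h2]
      have a1 : (c + ε - t) / ε ≤ 1 := by rw [div_le_one hε]; linarith
      rw [min_eq_right (a1.trans b1), min_eq_right a1]
      rcases lt_or_ge t (c + ε) with h3 | h3
      · rw [if_neg (by linarith), max_eq_right (div_nonneg (by linarith) hε.le)]
        field_simp
        ring
      · rw [if_pos h3, max_eq_left (div_nonpos_of_nonpos_of_nonneg (by linarith) hε.le)]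
        field_simp
        ring

/-- The term h = 0 is 0 by the convention 1/0 = 0, in agreement with the mean value 0 of B₂. -/
theorem hasSum_shiftedBernoulli {t s : ℝ} (ht : t ∈ Set.Ico (0 : ℝ) 1) (hs : s ∈ Set.Icc (0 : ℝ) 1) :
    HasSum (fun h : ℤ => 1 / (h : ℂ) ^ 2 *
      (fourier h (t : UnitAddCircle) * fourier h ((-s : ℝ) : UnitAddCircle)))
      ((2 * Real.pi ^ 2 * shiftedBernoulli t s : ℝ) : ℂ) := by
  have key : ∀ x ∈ Set.Icc (0 : ℝ) 1, (x : UnitAddCircle) = t + ((-s : ℝ) : UnitAddCircle) →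
      HasSum (fun h : ℤ => 1 / (h : ℂ) ^ 2 *
        (fourier h (t : UnitAddCircle) * fourier h ((-s : ℝ) : UnitAddCircle)))
        ((2 * Real.pi ^ 2 * bernoulliFun 2 x : ℝ) : ℂ) := by
    intro x hx hxt
    have := hasSum_one_div_pow_mul_fourier_mul_bernoulliFun le_rfl hx
    simp_rw [hxt, fourier_add_eq] at this
    convert! this using 1
    rw [mul_pow, Complex.I_sq]
    rw [Nat.factorial_two]
    push_cast
    ring
  rw [shiftedBernoulli]
  split_ifs with h
  · refine key _ ⟨by linarith, by linarith [ht.2, hs.1]⟩ ?_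
    rw [← AddCircle.coe_add, sub_eq_add_neg]
  · refine key _ ⟨by linarith [ht.1, hs.2], by linarith⟩ ?_
    have : t - s + 1 = t + -s + 1 := by ring
    rw [this, AddCircle.coe_add_period, AddCircle.coe_add]

/-- Real functions on the circle with values in `[0, 1]` and Fourier coefficients of the size of
those of a trapezoid with slopes of size `1 / ε`. -/
structure HasTrapezoidSeries (ε : ℝ) (f : UnitAddCircle → ℝ) (c : ℝ) (coef : ℤ → ℂ) : Prop where
  nonneg : ∀ y, 0 ≤ f y
  le_one : ∀ y, f y ≤ 1
  hasSum : ∀ y, HasSum (fun h => coef h * fourier h y) (f y : ℂ)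
  coef_zero : coef 0 = c
  mean_nonneg : 0 ≤ c
  mean_le_one : c ≤ 1
  norm_coef_le : ∀ h : ℤ, h ≠ 0 → ‖coef h‖ ≤ 1 / |(h : ℝ)|
  norm_coef_le_sq : ∀ h : ℤ, h ≠ 0 → ‖coef h‖ ≤ 1 / (ε * (h : ℝ) ^ 2)

/-- The constants 1 and 0 replace the trapezoid when an arc is too long for a majorant or too short
for a minorant. -/
theorem hasTrapezoidSeries_const {ε : ℝ} (hε : 0 < ε) {c : ℝ} (hc0 : 0 ≤ c) (hc1 : c ≤ 1) :
    HasTrapezoidSeries ε (fun _ => c) c (fun h => if h = 0 then (c : ℂ) else 0) where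
  nonneg _ := hc0
  le_one _ := hc1
  hasSum y := by
    convert! hasSum_ite_eq (0 : ℤ) (c : ℂ) using 2 with h
    split_ifs with h0
    · subst h0; simp
    · simp
  coef_zero := by simp
  mean_nonneg := hc0
  mean_le_one := hc1
  norm_coef_le h h0 := by simp [h0]
  norm_coef_le_sq h h0 := by simp [h0]; positivity

theorem norm_one_sub_fourier_le (h : ℤ) (s : ℝ) :
    ‖1 - fourier h ((-s : ℝ) : UnitAddCircle)‖ ≤ 2 * Real.pi * |(h : ℝ)| * |s| := by
  rw [fourier_coe_apply, norm_sub_rev]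
  have := Real.norm_exp_I_mul_ofReal_sub_one_le (x := 2 * Real.pi * h * (-s))
  convert! this using 1
  · congr 3
    push_cast
    ring
  · rw [Real.norm_eq_abs, abs_mul, abs_mul, abs_mul, abs_neg, abs_of_pos Real.pi_pos, abs_two]

theorem norm_one_sub_fourier_le_two (h : ℤ) (y : UnitAddCircle) : ‖1 - fourier h y‖ ≤ 2 := by
  refine (norm_sub_le _ _).trans ?_
  rw [norm_fourier_apply, norm_one]
  norm_num

/-- The alternating combination of four characters factors as (1 - e(-hε))(1 - e(-hc)). Bounding the
first factor by 2π|h|ε and the second by 2 gives the coefficient bound 1/|h|; bounding both by 2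
gives 1/(εh²), which makes the series absolutely summable. -/
theorem exists_hasTrapezoidSeries {ε c : ℝ} (hε : 0 < ε) (hc : ε ≤ c) (hc1 : c + ε ≤ 1) (a : ℝ) :
    ∃ f coef, HasTrapezoidSeries ε f c coef ∧
      ∀ t ∈ Set.Ico (0 : ℝ) 1, f ((a + t : ℝ) : UnitAddCircle) = trapezoid ε c t := by
  have hrep : ∀ y : UnitAddCircle, ∃ t ∈ Set.Ico (0 : ℝ) 1, y = ((a + t : ℝ) : UnitAddCircle) := by
    intro y
    have hy : y ∈ ((↑) : ℝ → UnitAddCircle) '' Set.Ico a (a + 1) := by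
      rw [AddCircle.coe_image_Ico_eq]; trivial
    obtain ⟨x, hx, rfl⟩ := hy
    exact ⟨x - a, ⟨by linarith [hx.1], by linarith [hx.2]⟩, by congr 1; ring⟩
  have hinj : ∀ t ∈ Set.Ico (0 : ℝ) 1, ∀ t' ∈ Set.Ico (0 : ℝ) 1,
      ((a + t : ℝ) : UnitAddCircle) = ((a + t' : ℝ) : UnitAddCircle) → t = t' := by
    intro t ht t' ht' h
    have := (AddCircle.coe_eq_coe_iff_of_mem_Ico (p := (1 : ℝ)) (a := a)
      (x := a + t) (y := a + t') ⟨by linarith [ht.1], by linarith [ht.2]⟩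
      ⟨by linarith [ht'.1], by linarith [ht'.2]⟩).1 h
    linarith
  choose τ hτ hτe using hrep
  set E : ℤ → ℝ → ℂ := fun h s => fourier h ((s : ℝ) : UnitAddCircle) with hE
  have hEadd : ∀ h s s', E h (s + s') = E h s * E h s' := fun h s s' => by
    simp only [hE, AddCircle.coe_add, fourier_add_eq]
  have hE0 : ∀ h, E h 0 = 1 := fun h => by simp [hE]
  set K : ℤ → ℂ := fun h => -(1 / (4 * Real.pi ^ 2 * ε * (h : ℂ) ^ 2)) *
      (E h (-a) * ((1 - E h (-ε)) * (1 - E h (-c)))) with hK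
  have hnorm : ∀ h : ℤ, ‖K h‖ = 1 / (4 * Real.pi ^ 2 * ε * (h : ℝ) ^ 2) *
      (‖1 - E h (-ε)‖ * ‖1 - E h (-c)‖) := by
    intro h
    simp only [hK]
    rw [norm_mul, norm_mul, norm_mul, norm_fourier_apply, one_mul]
    congr 1
    rw [norm_neg]
    simp only [norm_div, norm_mul, norm_pow, Complex.norm_real, Complex.norm_intCast, norm_one,
      Real.norm_eq_abs, abs_of_pos hε, abs_of_pos Real.pi_pos, sq_abs]
    norm_num
  refine ⟨fun y => trapezoid ε c (τ y), fun h => if h = 0 then (c : ℂ) else K h,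
    ⟨fun y => le_max_left _ _, fun y => max_le zero_le_one (min_le_left _ _), fun y => ?_, by simp,
      by linarith, by linarith, fun h h0 => ?_, fun h h0 => ?_⟩, fun t ht => ?_⟩
  · have s1 := hasSum_shiftedBernoulli (hτ y) (s := 0) ⟨le_rfl, zero_le_one⟩
    have s2 := hasSum_shiftedBernoulli (hτ y) (s := ε) ⟨hε.le, by linarith⟩
    have s3 := hasSum_shiftedBernoulli (hτ y) (s := c) ⟨by linarith, by linarith⟩
    have s4 := hasSum_shiftedBernoulli (hτ y) (s := c + ε) ⟨by linarith, hc1⟩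
    have s5 := (((s1.sub s2).sub s3).add s4).mul_left (-(1 / (4 * Real.pi ^ 2 * ε : ℂ)))
    have s6 := (hasSum_ite_eq (0 : ℤ) (c : ℂ)).add s5
    convert! s6 using 1
    · funext h
      by_cases h0 : h = 0
      · subst h0; simp
      · simp only [h0, if_false, zero_add, hK]
        have e1 : fourier h y = E h a * E h (τ y) := by
          conv_lhs => rw [hτe y]
          exact hEadd h a (τ y)
        have e2 : E h (-a) * E h a = 1 := by rw [← hEadd, neg_add_cancel, hE0]
        have e3 : E h (-(c + ε)) = E h (-c) * E h (-ε) := by rw [neg_add, hEadd]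
        change _ = -(1 / (4 * (Real.pi : ℂ) ^ 2 * ε)) * (1 / (h : ℂ) ^ 2 * (E h (τ y) * E h (-0)) -
          1 / (h : ℂ) ^ 2 * (E h (τ y) * E h (-ε)) - 1 / (h : ℂ) ^ 2 * (E h (τ y) * E h (-c)) +
          1 / (h : ℂ) ^ 2 * (E h (τ y) * E h (-(c + ε))))
        rw [e1, e3, neg_zero, hE0]
        have e4 : 1 / (4 * (Real.pi : ℂ) ^ 2 * ε * (h : ℂ) ^ 2) =
          1 / (4 * (Real.pi : ℂ) ^ 2 * ε) * (1 / (h : ℂ) ^ 2) := by rw [one_div_mul_one_div]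
        rw [e4]
        linear_combination (-(1 / (4 * (Real.pi : ℂ) ^ 2 * ε) * (1 / (h : ℂ) ^ 2)) *
          ((1 - E h (-ε)) * (1 - E h (-c))) * E h (τ y)) * e2
    · rw [trapezoid_eq hε hc (hτ y).1]
      push_cast
      have : (Real.pi : ℂ) ≠ 0 := by exact_mod_cast Real.pi_ne_zero
      have : (ε : ℂ) ≠ 0 := by exact_mod_cast hε.ne'
      field_simp
      ring
  · simp only [h0, if_false]
    rw [hnorm]
    have a1 := norm_one_sub_fourier_le h ε
    have a2 := norm_one_sub_fourier_le_two h ((-c : ℝ) : UnitAddCircle)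
    have hh : 0 < |(h : ℝ)| := abs_pos.2 (by exact_mod_cast h0)
    have hpi := Real.pi_gt_three
    rw [abs_of_pos hε] at a1
    calc _ ≤ 1 / (4 * Real.pi ^ 2 * ε * (h : ℝ) ^ 2) * ((2 * Real.pi * |(h : ℝ)| * ε) * 2) := by
          gcongr
      _ = 1 / |(h : ℝ)| * (1 / Real.pi) := by
          rw [← sq_abs (h : ℝ)]
          field_simp
          ring
      _ ≤ 1 / |(h : ℝ)| * 1 := by
          gcongr
          rw [div_le_one Real.pi_pos]
          linarith
      _ = _ := mul_one _
  · simp only [h0, if_false]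
    rw [hnorm]
    have a1 := norm_one_sub_fourier_le_two h ((-ε : ℝ) : UnitAddCircle)
    have a2 := norm_one_sub_fourier_le_two h ((-c : ℝ) : UnitAddCircle)
    have hh : 0 < (h : ℝ) ^ 2 := by
      have : (h : ℝ) ≠ 0 := by exact_mod_cast h0
      positivity
    have hpi := Real.pi_gt_three
    calc _ ≤ 1 / (4 * Real.pi ^ 2 * ε * (h : ℝ) ^ 2) * (2 * 2) := by
          gcongr
      _ = 1 / (ε * (h : ℝ) ^ 2) * (1 / Real.pi ^ 2) := by
          field_simp
          ring
      _ ≤ 1 / (ε * (h : ℝ) ^ 2) * 1 := by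
          gcongr
          rw [div_le_one (by positivity)]
          nlinarith
      _ = _ := mul_one _
  · simp only
    rw [hinj _ (hτ _) _ ht (hτe _).symm]

/-- The image of an interval in the circle. -/
def arc (l u : ℝ) : Set UnitAddCircle := ((↑) : ℝ → UnitAddCircle) '' Set.Icc l u

/-- The trapezoid starts at l - ε and has plateau exactly [l, u]. If its support would be longer
than the circle, then u - l + 2ε > 1 and the constant 1 is within the allowed error. -/
theorem exists_majorant {ε : ℝ} (hε : 0 < ε) {l u : ℝ} (hlu : l ≤ u) (hlu1 : u ≤ l + 1) :
    ∃ f coef c, HasTrapezoidSeries ε f c coef ∧ (∀ y ∈ arc l u, f y = 1) ∧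
      u - l ≤ c ∧ c ≤ u - l + 2 * ε := by
  by_cases h : u - l + 2 * ε ≤ 1
  · obtain ⟨f, coef, h1, h2⟩ := exists_hasTrapezoidSeries hε (c := u - l + ε) (by linarith)
      (by linarith) (l - ε)
    refine ⟨f, coef, _, h1, ?_, by linarith, by linarith⟩
    rintro _ ⟨x, hx, rfl⟩
    have := h2 (x - l + ε) ⟨by linarith [hx.1], by linarith [hx.2]⟩
    rw [show l - ε + (x - l + ε) = x by ring] at this
    rw [this, trapezoid]
    have b1 : 1 ≤ (x - l + ε) / ε := by rw [one_le_div hε]; linarith [hx.1]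
    have b2 : 1 ≤ (u - l + ε + ε - (x - l + ε)) / ε := by rw [one_le_div hε]; linarith [hx.2]
    rw [min_eq_left (le_min b1 b2), max_eq_right zero_le_one]
  · exact ⟨_, _, 1, hasTrapezoidSeries_const hε zero_le_one le_rfl, fun _ _ => rfl, by linarith,
      by linarith⟩

/-- Here the support, not the plateau, is [l, u]; when u - l < 2ε the constant 0 serves. -/
theorem exists_minorant {ε : ℝ} (hε : 0 < ε) {l u : ℝ} (hlu : l ≤ u) (hlu1 : u ≤ l + 1) :
    ∃ f coef c, HasTrapezoidSeries ε f c coef ∧ (∀ y ∉ arc l u, f y = 0) ∧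
      c ≤ u - l ∧ u - l - 2 * ε ≤ c := by
  by_cases h : 2 * ε ≤ u - l
  · obtain ⟨f, coef, h1, h2⟩ := exists_hasTrapezoidSeries hε (c := u - l - ε) (by linarith)
      (by linarith) l
    refine ⟨f, coef, _, h1, fun y hy => ?_, by linarith, by linarith⟩
    have hy' : y ∈ ((↑) : ℝ → UnitAddCircle) '' Set.Ico l (l + 1) := by
      rw [AddCircle.coe_image_Ico_eq]; trivial
    obtain ⟨x, hx, rfl⟩ := hy'
    have hxu : u < x := by
      by_contra hxu
      exact hy ⟨x, ⟨hx.1, not_lt.1 hxu⟩, rfl⟩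
    have := h2 (x - l) ⟨by linarith [hx.1], by linarith [hx.2]⟩
    rw [show l + (x - l) = x by ring] at this
    rw [this, trapezoid]
    refine max_eq_left ((min_le_right _ _).trans ((min_le_right _ _).trans ?_))
    exact div_nonpos_of_nonpos_of_nonneg (by linarith) hε.le
  · exact ⟨_, _, 0, hasTrapezoidSeries_const hε le_rfl zero_le_one, fun _ _ => rfl, by linarith,
      by linarith⟩

end CRTEquidist

/-! ### An Erdős–Turán–Koksma inequality for boxes -/

namespace CRTEquidist

open Finset

theorem sum_int_inv_sq_le {H : ℕ} (hH : H ≠ 0) {G : Finset ℤ} (hG : ∀ h ∈ G, (H : ℤ) < |h|) :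
    ∑ h ∈ G, ((h : ℝ) ^ 2)⁻¹ ≤ 2 / H := by
  have key : ∀ G' : Finset ℤ, (∀ h ∈ G', (H : ℤ) < |h|) → Set.InjOn Int.natAbs (G' : Set ℤ) →
      ∑ h ∈ G', ((h : ℝ) ^ 2)⁻¹ ≤ 1 / H := by
    intro G' hG' hinj
    have e : ∑ h ∈ G', ((h : ℝ) ^ 2)⁻¹ = ∑ m ∈ G'.image Int.natAbs, ((m : ℝ) ^ 2)⁻¹ := by
      rw [sum_image hinj]
      refine sum_congr rfl fun h _ => ?_
      rw [Nat.cast_natAbs, Int.cast_abs, sq_abs]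
    set K := (G'.image Int.natAbs).sup id + H
    have hsub : G'.image Int.natAbs ⊆ Ioc H K := by
      intro m hm
      have h1 : m ≤ (G'.image Int.natAbs).sup id := le_sup (f := id) hm
      obtain ⟨h, hh, rfl⟩ := mem_image.1 hm
      have h2 := hG' h hh
      rw [Int.abs_eq_natAbs] at h2
      exact mem_Ioc.2 ⟨by exact_mod_cast h2, h1.trans (Nat.le_add_right _ _)⟩
    rw [e]
    refine (sum_le_sum_of_subset_of_nonneg hsub fun _ _ _ => by positivity).trans ?_
    refine (sum_Ioc_inv_sq_le_sub hH (Nat.le_add_left _ _)).trans ?_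
    have : (0 : ℝ) ≤ (K : ℝ)⁻¹ := by positivity
    rw [one_div]
    linarith
  rw [← sum_filter_add_sum_filter_not G (fun h => 0 < h)]
  have h1 := key (G.filter fun h => 0 < h) (fun h hh => hG h (mem_filter.1 hh).1) ?_
  · have h2 := key (G.filter fun h => ¬ 0 < h) (fun h hh => hG h (mem_filter.1 hh).1) ?_
    · calc _ ≤ 1 / (H : ℝ) + 1 / H := add_le_add h1 h2
        _ = _ := by ring
    · intro a ha b hb hab
      simp only [coe_filter, Set.mem_ofPred_eq] at ha hb
      omega
  · intro a ha b hb hab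
    simp only [coe_filter, Set.mem_ofPred_eq] at ha hb
    omega

theorem HasTrapezoidSeries.norm_sub_sum_le {ε c : ℝ} {f : UnitAddCircle → ℝ} {coef : ℤ → ℂ}
    (hf : HasTrapezoidSeries ε f c coef) (hε : 0 < ε) {H : ℕ} (hH : H ≠ 0) (y : UnitAddCircle) :
    ‖(f y : ℂ) - ∑ h ∈ Icc (-(H : ℤ)) H, coef h * fourier h y‖ ≤ 2 / (ε * H) := by
  have ht := ((hf.hasSum y).sub_const (∑ h ∈ Icc (-(H : ℤ)) H, coef h * fourier h y)).norm
  refine le_of_tendsto ht ?_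
  filter_upwards [Filter.eventually_ge_atTop (Icc (-(H : ℤ)) H)] with F hF
  rw [← sum_sdiff hF, add_sub_cancel_right]
  refine (norm_sum_le _ _).trans ?_
  have h1 : ∀ h ∈ F \ Icc (-(H : ℤ)) H, (H : ℤ) < |h| := by
    intro h hh
    rw [mem_sdiff, mem_Icc, ← abs_le] at hh
    exact not_le.1 hh.2
  have h2 : ∀ h ∈ F \ Icc (-(H : ℤ)) H, ‖coef h * fourier h y‖ ≤ 1 / ε * ((h : ℝ) ^ 2)⁻¹ := by
    intro h hh
    have h0 : h ≠ 0 := by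
      rintro rfl
      have := h1 0 hh
      rw [abs_zero] at this
      omega
    rw [norm_mul, norm_fourier_apply, mul_one]
    refine (hf.norm_coef_le_sq h h0).trans (le_of_eq ?_)
    rw [← one_div_mul_one_div, one_div ((h : ℝ) ^ 2)]
  refine (sum_le_sum h2).trans ?_
  rw [← mul_sum]
  calc _ ≤ 1 / ε * (2 / H) := by
        gcongr
        exact sum_int_inv_sq_le hH h1
    _ = _ := by rw [div_mul_div_comm, one_mul]

/-- The factors are exchanged one at a time. The b_i are only known to have norm at most 1 + τ ≤ 2,
hence the powers of 2. -/
theorem norm_prod_sub_prod_le {ι : Type*} (s : Finset ι) (a b : ι → ℂ) {τ : ℝ} (hτ0 : 0 ≤ τ)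
    (hτ : τ ≤ 1) (ha : ∀ i ∈ s, ‖a i‖ ≤ 1) (hab : ∀ i ∈ s, ‖a i - b i‖ ≤ τ) :
    ‖∏ i ∈ s, a i - ∏ i ∈ s, b i‖ ≤ (2 ^ #s - 1) * τ := by
  classical
  induction s using Finset.induction_on with
  | empty => simp
  | insert i s hi ih =>
    have ih := ih (fun j hj => ha j (mem_insert_of_mem hj)) fun j hj => hab j (mem_insert_of_mem hj)
    rw [prod_insert hi, prod_insert hi, card_insert_of_notMem hi]
    have h1 : ‖∏ j ∈ s, a j‖ ≤ 1 := by
      rw [norm_prod]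
      exact prod_le_one (fun _ _ => norm_nonneg _) fun j hj => ha j (mem_insert_of_mem hj)
    have h2 := ha i (mem_insert_self _ _)
    have h3 := hab i (mem_insert_self _ _)
    have h4 : ‖b i‖ ≤ 2 := by
      have : b i = a i - (a i - b i) := by ring
      rw [this]
      exact (norm_sub_le _ _).trans (by linarith)
    have e : a i * ∏ j ∈ s, a j - b i * ∏ j ∈ s, b j =
        (a i - b i) * ∏ j ∈ s, a j + b i * (∏ j ∈ s, a j - ∏ j ∈ s, b j) := by ring
    rw [e]
    refine (norm_add_le _ _).trans ?_
    rw [norm_mul, norm_mul]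
    calc _ ≤ τ * 1 + 2 * ((2 ^ #s - 1) * τ) := by gcongr
      _ = _ := by ring

/-- The weight of a frequency in the Erdős–Turán inequality. -/
noncomputable def freqWeight (h : ℤ) : ℝ := if h = 0 then 1 else 1 / |(h : ℝ)|

theorem freqWeight_nonneg (h : ℤ) : 0 ≤ freqWeight h := by
  rw [freqWeight]; split_ifs <;> positivity

theorem HasTrapezoidSeries.norm_coef_le_freqWeight {ε c : ℝ} {f : UnitAddCircle → ℝ} {coef : ℤ → ℂ}
    (hf : HasTrapezoidSeries ε f c coef) (h : ℤ) : ‖coef h‖ ≤ freqWeight h := by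
  rw [freqWeight]
  split_ifs with h0
  · rw [h0, hf.coef_zero, Complex.norm_real, Real.norm_of_nonneg hf.mean_nonneg]
    exact hf.mean_le_one
  · exact hf.norm_coef_le h h0

/-- Nonzero frequency vectors with entries of size at most `H`. -/
noncomputable def freqBox (n H : ℕ) : Finset (Fin n → ℤ) :=
  (Fintype.piFinset fun _ => Icc (-(H : ℤ)) H).erase 0

/-- The exponential sum at frequency `h` of a finite family of points of the torus. -/
noncomputable def expAverage {n : ℕ} {ι : Type*} [Fintype ι] (y : ι → Fin n → UnitAddCircle)
    (h : Fin n → ℤ) : ℂ :=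
  (Fintype.card ι : ℂ)⁻¹ * ∑ a, ∏ i, fourier (h i) (y a i)

/-- The total contribution of the nonzero frequencies. -/
noncomputable def freqSum {n : ℕ} {ι : Type*} [Fintype ι] (y : ι → Fin n → UnitAddCircle)
    (H : ℕ) : ℝ :=
  ∑ h ∈ freqBox n H, (∏ i, freqWeight (h i)) * ‖expAverage y h‖

/-- Each series is truncated at H, with error 2/(εH) ≤ 2ε by the condition 1 ≤ ε²H. Expanding the
product of the truncations, the zero frequency contributes exactly the product of the means. -/
theorem norm_average_prod_sub_le {n : ℕ} {ι : Type*} [Fintype ι] [Nonempty ι]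
    (y : ι → Fin n → UnitAddCircle) {ε : ℝ} (hε : 0 < ε) (hε2 : 2 * ε ≤ 1) {H : ℕ}
    (hH : 1 ≤ ε ^ 2 * H) {f : Fin n → UnitAddCircle → ℝ} {c : Fin n → ℝ} {coef : Fin n → ℤ → ℂ}
    (hf : ∀ i, HasTrapezoidSeries ε (f i) (c i) (coef i)) :
    |(Fintype.card ι : ℝ)⁻¹ * ∑ a, ∏ i, f i (y a i) - ∏ i, c i| ≤
      (2 ^ n - 1) * (2 * ε) + freqSum y H := by
  have hN : (0 : ℝ) < Fintype.card ι := by exact_mod_cast Fintype.card_pos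
  have hN' : (Fintype.card ι : ℂ) ≠ 0 := by exact_mod_cast hN.ne'
  have hH0 : H ≠ 0 := by rintro rfl; simp at hH; linarith
  have hHpos : (0 : ℝ) < H := by positivity
  set I := Icc (-(H : ℤ)) H
  set T : ι → Fin n → ℂ := fun a i => ∑ h ∈ I, coef i h * fourier h (y a i) with hT
  have hTf : ∀ a, ‖∏ i, (f i (y a i) : ℂ) - ∏ i, T a i‖ ≤ (2 ^ n - 1) * (2 * ε) := by
    intro a
    have := norm_prod_sub_prod_le univ (fun i => (f i (y a i) : ℂ)) (T a) (τ := 2 * ε)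
      (by linarith) hε2 ?_ ?_
    · simpa using this
    · intro i _
      rw [Complex.norm_real, Real.norm_of_nonneg ((hf i).nonneg _)]
      exact (hf i).le_one _
    · intro i _
      refine ((hf i).norm_sub_sum_le hε hH0 (y a i)).trans ?_
      rw [div_le_iff₀ (by positivity)]
      nlinarith
  have hexp : (Fintype.card ι : ℂ)⁻¹ * ∑ a, ∏ i, T a i =
      ∑ h ∈ Fintype.piFinset (fun _ : Fin n => I), (∏ i, coef i (h i)) * expAverage y h := by
    simp_rw [hT, prod_univ_sum, expAverage]
    rw [sum_comm, mul_sum]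
    refine sum_congr rfl fun h _ => ?_
    simp_rw [prod_mul_distrib, ← mul_sum]
    ring
  have h0mem : (0 : Fin n → ℤ) ∈ Fintype.piFinset (fun _ : Fin n => I) := by
    simp [I]
  have hzero : (∏ i, coef i ((0 : Fin n → ℤ) i)) * expAverage y 0 = ∏ i, (c i : ℂ) := by
    simp only [expAverage, Pi.zero_apply, fourier_zero, prod_const_one, sum_const, card_univ,
      nsmul_eq_mul, mul_one, inv_mul_cancel₀ hN']
    exact prod_congr rfl fun i _ => (hf i).coef_zero
  have hsplit : (Fintype.card ι : ℂ)⁻¹ * ∑ a, ∏ i, T a i - ∏ i, (c i : ℂ) =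
      ∑ h ∈ freqBox n H, (∏ i, coef i (h i)) * expAverage y h := by
    rw [hexp, ← add_sum_erase _ _ h0mem, hzero, add_sub_cancel_left]
    rfl
  have hfreq : ‖(Fintype.card ι : ℂ)⁻¹ * ∑ a, ∏ i, T a i - ∏ i, (c i : ℂ)‖ ≤ freqSum y H := by
    rw [hsplit]
    refine (norm_sum_le _ _).trans (sum_le_sum fun h _ => ?_)
    rw [norm_mul, norm_prod]
    gcongr with i
    exact (hf i).norm_coef_le_freqWeight (h i)
  have havg : ‖(Fintype.card ι : ℂ)⁻¹ * ∑ a, ∏ i, (f i (y a i) : ℂ) -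
      (Fintype.card ι : ℂ)⁻¹ * ∑ a, ∏ i, T a i‖ ≤ (2 ^ n - 1) * (2 * ε) := by
    rw [← mul_sub, ← sum_sub_distrib, norm_mul, norm_inv, Complex.norm_natCast]
    rw [inv_mul_le_iff₀ hN]
    refine (norm_sum_le _ _).trans ((sum_le_sum fun a _ => hTf a).trans ?_)
    simp
  have hcast : (((Fintype.card ι : ℝ)⁻¹ * ∑ a, ∏ i, f i (y a i) - ∏ i, c i : ℝ) : ℂ) =
      ((Fintype.card ι : ℂ)⁻¹ * ∑ a, ∏ i, (f i (y a i) : ℂ) -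
        (Fintype.card ι : ℂ)⁻¹ * ∑ a, ∏ i, T a i) +
      ((Fintype.card ι : ℂ)⁻¹ * ∑ a, ∏ i, T a i - ∏ i, (c i : ℂ)) := by
    push_cast
    ring
  rw [← Real.norm_eq_abs, ← Complex.norm_real, hcast]
  exact (norm_add_le _ _).trans (add_le_add havg hfreq)

open Classical in
/-- A form of the Erdős–Turán–Koksma inequality, for boxes in the torus. -/
theorem abs_card_div_sub_prod_le {n : ℕ} {ι : Type*} [Fintype ι] [Nonempty ι]
    (y : ι → Fin n → UnitAddCircle) {ε : ℝ} (hε : 0 < ε) (hε2 : 2 * ε ≤ 1) {H : ℕ}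
    (hH : 1 ≤ ε ^ 2 * H) {l u : Fin n → ℝ} (hlu : ∀ i, l i ≤ u i ∧ u i ≤ l i + 1) :
    |(Fintype.card ι : ℝ)⁻¹ * #{a | ∀ i, y a i ∈ arc (l i) (u i)} - ∏ i, (u i - l i)| ≤
      2 ^ n * (4 * ε) + freqSum y H := by
  have hN : (0 : ℝ) < Fintype.card ι := by exact_mod_cast Fintype.card_pos
  have hprod : ∀ c : Fin n → ℝ, (∀ i, |u i - l i - c i| ≤ 2 * ε) →
      |∏ i, (u i - l i) - ∏ i, c i| ≤ (2 ^ n - 1) * (2 * ε) := by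
    intro c hc
    have := norm_prod_sub_prod_le univ (fun i => ((u i - l i : ℝ) : ℂ)) (fun i => (c i : ℂ))
      (τ := 2 * ε) (by linarith) hε2 ?_ ?_
    · rw [← Complex.ofReal_prod, ← Complex.ofReal_prod, ← Complex.ofReal_sub,
        Complex.norm_real] at this
      simpa using this
    · intro i _
      rw [Complex.norm_real, Real.norm_of_nonneg (by linarith [(hlu i).1])]
      linarith [(hlu i).2]
    · intro i _
      rw [← Complex.ofReal_sub, Complex.norm_real]
      exact hc i
  have hcard : (#{a | ∀ i, y a i ∈ arc (l i) (u i)} : ℝ) =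
      ∑ a, if ∀ i, y a i ∈ arc (l i) (u i) then (1 : ℝ) else 0 := by
    rw [sum_ite, sum_const_zero, add_zero, sum_const, nsmul_eq_mul, mul_one]
  choose f coef c hf hf1 hc1 hc2 using fun i => exists_majorant hε (hlu i).1 (hlu i).2
  choose f' coef' c' hf' hf1' hc1' hc2' using fun i => exists_minorant hε (hlu i).1 (hlu i).2
  have up := norm_average_prod_sub_le y hε hε2 hH hf
  have lo := norm_average_prod_sub_le y hε hε2 hH hf'
  have pup := hprod c fun i => abs_le.2 ⟨by linarith [hc2 i], by linarith [hc1 i]⟩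
  have plo := hprod c' fun i => abs_le.2 ⟨by linarith [hc1' i], by linarith [hc2' i]⟩
  have hle : (#{a | ∀ i, y a i ∈ arc (l i) (u i)} : ℝ) ≤ ∑ a, ∏ i, f i (y a i) := by
    rw [hcard]
    refine sum_le_sum fun a _ => ?_
    split_ifs with h
    · exact le_of_eq (prod_eq_one fun i _ => hf1 i _ (h i)).symm
    · exact prod_nonneg fun i _ => (hf i).nonneg _
  -- A product of one-dimensional minorants is still a minorant: it vanishes as soon as one
  -- coordinate leaves its arc, and it never exceeds 1.
  have hge : ∑ a, ∏ i, f' i (y a i) ≤ (#{a | ∀ i, y a i ∈ arc (l i) (u i)} : ℝ) := by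
    rw [hcard]
    refine sum_le_sum fun a _ => ?_
    split_ifs with h
    · exact prod_le_one (fun i _ => (hf' i).nonneg _) fun i _ => (hf' i).le_one _
    · push Not at h
      obtain ⟨i, hi⟩ := h
      exact le_of_eq (prod_eq_zero (mem_univ i) (hf1' i _ hi))
  have hle' := mul_le_mul_of_nonneg_left hle (inv_nonneg.2 hN.le)
  have hge' := mul_le_mul_of_nonneg_left hge (inv_nonneg.2 hN.le)
  rw [abs_le] at *
  constructor
  · linarith [up.1, up.2, lo.1, lo.2, pup.1, pup.2, plo.1, plo.2]
  · linarith [up.1, up.2, lo.1, lo.2, pup.1, pup.2, plo.1, plo.2]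

theorem sum_freqWeight_le {H : ℕ} :
    ∑ h ∈ Icc (-(H : ℤ)) H, freqWeight h ≤ 3 + 2 * Real.log H := by
  have h1 : ∀ K : ℕ, ∑ h ∈ Icc (-(K : ℤ)) K, freqWeight h = 1 + 2 * (harmonic K : ℝ) := by
    intro K
    induction K with
    | zero => simp [freqWeight]
    | succ K ih =>
      have : Icc (-((K + 1 : ℕ) : ℤ)) ((K + 1 : ℕ) : ℤ) =
          insert (-((K : ℤ) + 1)) (insert ((K : ℤ) + 1) (Icc (-(K : ℤ)) K)) := by
        ext h
        simp only [mem_Icc, mem_insert]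
        push_cast
        omega
      rw [this, sum_insert, sum_insert, ih, harmonic_succ]
      · have a1 : freqWeight (-((K : ℤ) + 1)) = ((K : ℝ) + 1)⁻¹ := by
          rw [freqWeight, if_neg (by omega)]
          push_cast
          rw [abs_neg, abs_of_pos (by positivity), one_div]
        have a2 : freqWeight ((K : ℤ) + 1) = ((K : ℝ) + 1)⁻¹ := by
          rw [freqWeight, if_neg (by omega)]
          push_cast
          rw [abs_of_pos (by positivity), one_div]
        rw [a1, a2]
        push_cast
        ring
      · simp
      · simp only [mem_insert, mem_Icc]
        omega
  rw [h1]
  linarith [harmonic_le_one_add_log H]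

theorem sum_prod_freqWeight_le (n H : ℕ) :
    ∑ h ∈ freqBox n H, ∏ i, freqWeight (h i) ≤ (3 + 2 * Real.log H) ^ n := by
  have h1 : ∑ h ∈ freqBox n H, ∏ i, freqWeight (h i) ≤
      ∑ h ∈ Fintype.piFinset (fun _ : Fin n => Icc (-(H : ℤ)) H), ∏ i, freqWeight (h i) :=
    sum_le_sum_of_subset_of_nonneg (erase_subset _ _) fun _ _ _ =>
      prod_nonneg fun _ _ => freqWeight_nonneg _
  refine h1.trans ?_
  rw [← prod_univ_sum (fun _ : Fin n => Icc (-(H : ℤ)) H) fun _ => freqWeight]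
  rw [prod_const, card_univ, Fintype.card_fin]
  exact pow_le_pow_left₀ (sum_nonneg fun _ _ => freqWeight_nonneg _) sum_freqWeight_le n

end CRTEquidist

/-! ### Volumes of boxes, and the discrepancy of Δ_q in terms of Weyl sums -/

namespace CRTEquidist

open Finset MeasureTheory

theorem isCompact_arc (l u : ℝ) : IsCompact (arc l u) :=
  isCompact_Icc.image (AddCircle.continuous_mk' 1)

theorem measurableSet_arc (l u : ℝ) : MeasurableSet (arc l u) :=
  (isCompact_arc l u).isClosed.measurableSet

/-- In the fundamental domain (u - 1, u] the preimage of the arc lies between (l, u] and [l, u].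
This choice of domain also covers u = l + 1, where the two endpoints coincide on the circle. -/
theorem volume_arc {l u : ℝ} (hlu1 : u ≤ l + 1) :
    volume (arc l u) = ENNReal.ofReal (u - l) := by
  have h := (UnitAddCircle.measurePreserving_mk (u - 1)).measure_preimage
    (measurableSet_arc l u).nullMeasurableSet
  rw [← h, Measure.restrict_apply (AddCircle.measurable_mk' (measurableSet_arc l u))]
  refine le_antisymm ?_ ?_
  · refine (measure_mono (?_ : _ ⊆ Set.Icc l u)).trans (le_of_eq Real.volume_Icc)
    rintro x ⟨⟨t, ht, hx⟩, hxI⟩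
    by_cases h1 : u - 1 < t
    · have := (AddCircle.coe_eq_coe_iff_of_mem_Ioc (p := (1 : ℝ)) (a := u - 1) (x := t) (y := x)
        ⟨h1, by linarith [ht.2]⟩ hxI).1 hx
      exact this ▸ ht
    · exact ⟨by linarith [ht.1, hxI.1], by linarith [hxI.2]⟩
  · refine (le_of_eq Real.volume_Ioc.symm).trans (measure_mono (?_ : Set.Ioc l u ⊆ _))
    intro x hx
    exact ⟨⟨x, ⟨hx.1.le, hx.2⟩, rfl⟩, by linarith [hx.1], by linarith [hx.2]⟩

theorem box_eq_pi {n : ℕ} (l u : Fin n → ℝ) :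
    (fun (t : Fin n → ℝ) (i : Fin n) => (t i : UnitAddCircle)) '' Set.Icc l u =
      Set.univ.pi fun i => arc (l i) (u i) := by
  ext y
  simp only [Set.mem_image, Set.mem_pi, Set.mem_univ, true_implies, arc]
  constructor
  · rintro ⟨t, ht, rfl⟩ i
    exact ⟨t i, ⟨ht.1 i, ht.2 i⟩, rfl⟩
  · intro h
    choose t ht hty using h
    exact ⟨t, ⟨fun i => (ht i).1, fun i => (ht i).2⟩, funext hty⟩

theorem volume_real_pi_arc {n : ℕ} {l u : Fin n → ℝ} (hlu : ∀ i, l i ≤ u i ∧ u i ≤ l i + 1) :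
    (volume : Measure (Fin n → UnitAddCircle)).real (Set.univ.pi fun i => arc (l i) (u i)) =
      ∏ i, (u i - l i) := by
  rw [Measure.real, volume_pi_pi, ENNReal.toReal_prod]
  refine prod_congr rfl fun i _ => ?_
  rw [volume_arc (hlu i).2, ENNReal.toReal_ofReal (by linarith [(hlu i).1])]

variable {n : ℕ} (A : (m : ℕ) → Set (Fin n → ZMod m))

/-- The exponential sum `ρ(q)⁻¹ ∑_{a ∈ A_q} e(h · a / q)`. -/
noncomputable def weylSum (q : ℕ) (h : Fin n → ℤ) : ℂ :=
  (rho A q : ℂ)⁻¹ * ∑ᶠ a ∈ crtSet A q, ∏ i, fourier (h i) (torusPoint a i)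

open Classical in
theorem Delta_real_apply {q : ℕ} [Fintype (crtSet A q)] {B : Set (Fin n → UnitAddCircle)}
    (hB : MeasurableSet B) :
    (Delta A q).real B = (Fintype.card (crtSet A q) : ℝ)⁻¹ *
      #{a : crtSet A q | torusPoint a.1 ∈ B} := by
  rw [Measure.real, Delta, Measure.smul_apply, Measure.sum_apply _ hB, tsum_fintype, smul_eq_mul,
    ENNReal.toReal_mul, rho, ← Nat.card_coe_set_eq, Nat.card_eq_fintype_card, ENNReal.toReal_inv,
    ENNReal.toReal_natCast]
  congr 1
  simp_rw [Measure.dirac_apply' _ hB, Set.indicator_apply, Pi.one_apply]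
  rw [sum_ite, sum_const_zero, add_zero, sum_const, nsmul_eq_mul, mul_one, ENNReal.toReal_natCast]

theorem expAverage_torusPoint {q : ℕ} [Fintype (crtSet A q)] (h : Fin n → ℤ) :
    expAverage (fun a : crtSet A q => torusPoint a.1) h = weylSum A q h := by
  rw [expAverage, weylSum, rho, ← Nat.card_coe_set_eq, Nat.card_eq_fintype_card,
    ← finsum_set_coe_eq_finsum_mem, finsum_eq_sum_of_fintype]

theorem finite_crtSet {q : ℕ} (hq : 1 ≤ rho A q) : (crtSet A q).Finite :=
  Set.finite_of_ncard_pos hq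

/-- The discrepancy of `Δ_q` in terms of exponential sums. -/
theorem disc_le {q : ℕ} (hq : 1 ≤ rho A q) {ε : ℝ} (hε : 0 < ε) (hε2 : 2 * ε ≤ 1) {H : ℕ}
    (hH : 1 ≤ ε ^ 2 * H) :
    disc (Delta A q) ≤ 2 ^ n * (4 * ε) +
      ∑ h ∈ freqBox n H, (∏ i, freqWeight (h i)) * ‖weylSum A q h‖ := by
  have : Fintype (crtSet A q) := (finite_crtSet A hq).fintype
  have hne : (crtSet A q).Nonempty := Set.nonempty_of_ncard_ne_zero (by rw [rho] at hq; omega)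
  have : Nonempty (crtSet A q) := hne.to_subtype
  have hnn : 0 ≤ 2 ^ n * (4 * ε) +
      ∑ h ∈ freqBox n H, (∏ i, freqWeight (h i)) * ‖weylSum A q h‖ :=
    add_nonneg (by positivity) (sum_nonneg fun h _ =>
      mul_nonneg (prod_nonneg fun i _ => freqWeight_nonneg _) (norm_nonneg _))
  refine Real.sSup_le ?_ hnn
  rintro d ⟨B, ⟨l, u, hlu, rfl⟩, rfl⟩
  have hB : MeasurableSet (Set.univ.pi fun i => arc (l i) (u i)) :=
    MeasurableSet.univ_pi fun i => measurableSet_arc _ _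
  rw [box_eq_pi, volume_real_pi_arc hlu, Delta_real_apply A hB]
  have := abs_card_div_sub_prod_le (fun a : crtSet A q => torusPoint a.1) hε hε2 hH hlu
  simp only [freqSum, expAverage_torusPoint] at this
  convert! this using 8
  simp only [Set.mem_pi, Set.mem_univ, true_implies]

end CRTEquidist

/-! ### The Chinese remainder theorem for A_q and its exponential sums -/

namespace CRTEquidist

open Finset

variable {n : ℕ} (A : (m : ℕ) → Set (Fin n → ZMod m))

/-- Needed because the exponents of p in rs and in r are equal only propositionally, so the two
memberships live in different types. -/
theorem castHom_mem_congr {p v w q : ℕ} (hvw : v = w) (hd : p ^ v ∣ q) (hd' : p ^ w ∣ q)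
    (a : Fin n → ZMod q) :
    (fun i => ZMod.castHom hd (ZMod (p ^ v)) (a i)) ∈ A (p ^ v) ↔
      (fun i => ZMod.castHom hd' (ZMod (p ^ w)) (a i)) ∈ A (p ^ w) := by
  subst hvw
  rfl

theorem castHom_castHom {a b c : ℕ} (hab : a ∣ b) (hbc : b ∣ c) (x : ZMod c) :
    ZMod.castHom hab (ZMod a) (ZMod.castHom hbc (ZMod b) x) =
      ZMod.castHom (hab.trans hbc) (ZMod a) x :=
  RingHom.congr_fun (RingHom.ext_zmod
    ((ZMod.castHom hab (ZMod a)).comp (ZMod.castHom hbc (ZMod b)))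
    (ZMod.castHom (hab.trans hbc) (ZMod a))) x

theorem factorization_mul_of_mem_primeFactors_left {r s p : ℕ} (hco : r.Coprime s)
    (hp : p ∈ r.primeFactors) : (r * s).factorization p = r.factorization p := by
  rw [Nat.factorization_mul_apply_of_coprime hco]
  have hp' := Nat.prime_of_mem_primeFactors hp
  have : ¬ p ∣ s := fun h => Nat.not_coprime_of_dvd_of_dvd hp'.one_lt
    (Nat.dvd_of_mem_primeFactors hp) h hco
  rw [Nat.factorization_eq_zero_of_not_dvd this, add_zero]

theorem mem_crtSet_mul {r s : ℕ} (hco : r.Coprime s) (a : Fin n → ZMod (r * s)) :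
    a ∈ crtSet A (r * s) ↔
      (fun i => ZMod.castHom (dvd_mul_right r s) (ZMod r) (a i)) ∈ crtSet A r ∧
      (fun i => ZMod.castHom (dvd_mul_left s r) (ZMod s) (a i)) ∈ crtSet A s := by
  have hr : ∀ p ∈ r.primeFactors,
      ((fun i => ZMod.castHom (Nat.ordProj_dvd (r * s) p) (ZMod (p ^ (r * s).factorization p)) (a i))
        ∈ A (p ^ (r * s).factorization p) ↔
      (fun i => ZMod.castHom (Nat.ordProj_dvd r p) (ZMod (p ^ r.factorization p))
        (ZMod.castHom (dvd_mul_right r s) (ZMod r) (a i))) ∈ A (p ^ r.factorization p)) := by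
    intro p hp
    simp_rw [castHom_castHom]
    exact castHom_mem_congr A (factorization_mul_of_mem_primeFactors_left hco hp) _ _ a
  have hs : ∀ p ∈ s.primeFactors,
      ((fun i => ZMod.castHom (Nat.ordProj_dvd (r * s) p) (ZMod (p ^ (r * s).factorization p)) (a i))
        ∈ A (p ^ (r * s).factorization p) ↔
      (fun i => ZMod.castHom (Nat.ordProj_dvd s p) (ZMod (p ^ s.factorization p))
        (ZMod.castHom (dvd_mul_left s r) (ZMod s) (a i))) ∈ A (p ^ s.factorization p)) := by
    intro p hp
    simp_rw [castHom_castHom]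
    refine castHom_mem_congr A ?_ _ _ a
    rw [mul_comm]
    exact factorization_mul_of_mem_primeFactors_left hco.symm hp
  simp only [crtSet, Set.mem_ofPred_eq, hco.primeFactors_mul, mem_union]
  constructor
  · intro h
    exact ⟨fun p hp => (hr p hp).1 (h p (Or.inl hp)), fun p hp => (hs p hp).1 (h p (Or.inr hp))⟩
  · rintro ⟨h1, h2⟩ p (hp | hp)
    · exact (hr p hp).2 (h1 p hp)
    · exact (hs p hp).2 (h2 p hp)

/-- The Chinese remainder theorem for vectors. -/
noncomputable def crtEquiv (n : ℕ) {r s : ℕ} (hco : r.Coprime s) :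
    (Fin n → ZMod (r * s)) ≃ (Fin n → ZMod r) × (Fin n → ZMod s) :=
  (Equiv.arrowCongr (Equiv.refl _) (ZMod.chineseRemainder hco).toEquiv).trans
    (Equiv.arrowProdEquivProdArrow _ _ _)

theorem chineseRemainder_fst {r s : ℕ} (hco : r.Coprime s) (x : ZMod (r * s)) :
    (ZMod.chineseRemainder hco x).1 = ZMod.castHom (dvd_mul_right r s) (ZMod r) x :=
  RingHom.congr_fun (RingHom.ext_zmod ((RingHom.fst _ _).comp
    (ZMod.chineseRemainder hco : ZMod (r * s) →+* ZMod r × ZMod s)) _) x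

theorem chineseRemainder_snd {r s : ℕ} (hco : r.Coprime s) (x : ZMod (r * s)) :
    (ZMod.chineseRemainder hco x).2 = ZMod.castHom (dvd_mul_left s r) (ZMod s) x :=
  RingHom.congr_fun (RingHom.ext_zmod ((RingHom.snd _ _).comp
    (ZMod.chineseRemainder hco : ZMod (r * s) →+* ZMod r × ZMod s)) _) x

theorem crtEquiv_apply {r s : ℕ} (hco : r.Coprime s) (a : Fin n → ZMod (r * s)) :
    crtEquiv n hco a = (fun i => ZMod.castHom (dvd_mul_right r s) (ZMod r) (a i),
      fun i => ZMod.castHom (dvd_mul_left s r) (ZMod s) (a i)) := by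
  refine Prod.ext (funext fun i => ?_) (funext fun i => ?_)
  · exact chineseRemainder_fst hco (a i)
  · exact chineseRemainder_snd hco (a i)

open Classical in
/-- The indicator function of `A_q`. -/
noncomputable def crtInd (q : ℕ) (a : Fin n → ZMod q) : ℂ := if a ∈ crtSet A q then 1 else 0

theorem crtInd_mul {r s : ℕ} (hco : r.Coprime s) (a : Fin n → ZMod (r * s)) :
    crtInd A (r * s) a = crtInd A r (crtEquiv n hco a).1 * crtInd A s (crtEquiv n hco a).2 := by
  have h := mem_crtSet_mul A hco a
  rw [crtEquiv_apply]
  by_cases h1 : (fun i => ZMod.castHom (dvd_mul_right r s) (ZMod r) (a i)) ∈ crtSet A r <;>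
    by_cases h2 : (fun i => ZMod.castHom (dvd_mul_left s r) (ZMod s) (a i)) ∈ crtSet A s
  · rw [crtInd, crtInd, crtInd, if_pos (h.2 ⟨h1, h2⟩), if_pos h1, if_pos h2, one_mul]
  · rw [crtInd, crtInd, crtInd, if_neg fun h' => h2 (h.1 h').2, if_neg h2, mul_zero]
  · rw [crtInd, crtInd, crtInd, if_neg fun h' => h1 (h.1 h').1, if_neg h1, zero_mul]
  · rw [crtInd, crtInd, crtInd, if_neg fun h' => h1 (h.1 h').1, if_neg h1, zero_mul]

theorem sum_crtInd (q : ℕ) [NeZero q] : ∑ a, crtInd A q a = (rho A q : ℂ) := by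
  classical
  simp only [crtInd]
  rw [sum_ite, sum_const_zero, add_zero, sum_const, nsmul_eq_mul, mul_one, rho,
    Set.ncard_eq_toFinset_card']
  congr 2
  ext a
  simp

theorem rho_mul {r s : ℕ} (hr : r ≠ 0) (hs : s ≠ 0) (hco : r.Coprime s) :
    rho A (r * s) = rho A r * rho A s := by
  have : NeZero r := ⟨hr⟩
  have : NeZero s := ⟨hs⟩
  have : NeZero (r * s) := ⟨mul_ne_zero hr hs⟩
  have h : (rho A (r * s) : ℂ) = rho A r * rho A s := by
    rw [← sum_crtInd, ← sum_crtInd, ← sum_crtInd, sum_mul_sum, ← sum_product', univ_product_univ]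
    exact Fintype.sum_equiv (crtEquiv n hco) _ _ fun a => crtInd_mul A hco a
  exact_mod_cast h

/-- The exponential sum over `A_q` with frequency vector modulo `q`. -/
noncomputable def modSum (q : ℕ) [NeZero q] (g : Fin n → ZMod q) : ℂ :=
  (rho A q : ℂ)⁻¹ * ∑ a, crtInd A q a * ZMod.stdAddChar (∑ i, g i * a i)

theorem addChar_sum {M ι : Type*} [AddCommMonoid M] (ψ : AddChar M ℂ) (s : Finset ι) (f : ι → M) :
    ψ (∑ i ∈ s, f i) = ∏ i ∈ s, ψ (f i) := by
  classical
  induction s using Finset.induction_on with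
  | empty => simp
  | insert i s hi ih => rw [sum_insert hi, prod_insert hi, AddChar.map_add_eq_mul, ih]

theorem weylSum_eq_modSum (q : ℕ) [NeZero q] (h : Fin n → ℤ) :
    weylSum A q h = modSum A q fun i => (h i : ZMod q) := by
  classical
  rw [weylSum, modSum]
  congr 1
  rw [finsum_mem_def, finsum_eq_sum_of_fintype]
  refine sum_congr rfl fun a _ => ?_
  rw [Set.indicator_apply, crtInd]
  split_ifs
  · rw [one_mul, addChar_sum]
    refine prod_congr rfl fun i _ => ?_
    have : (h i : ZMod q) * a i = ((h i * (a i).val : ℤ) : ZMod q) := by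
      push_cast
      rw [ZMod.natCast_zmod_val]
    rw [this, ZMod.stdAddChar_coe, torusPoint, fourier_coe_apply]
    congr 1
    push_cast
    ring
  · simp

theorem norm_stdAddChar {q : ℕ} [NeZero q] (x : ZMod q) : ‖(ZMod.stdAddChar x : ℂ)‖ = 1 := by
  rw [ZMod.stdAddChar_apply, Circle.norm_coe]

theorem norm_crtInd {q : ℕ} (a : Fin n → ZMod q) : ((‖crtInd A q a‖ : ℝ) : ℂ) = crtInd A q a := by
  rw [crtInd]; split_ifs <;> simp

theorem norm_modSum_le_one (q : ℕ) [NeZero q] (g : Fin n → ZMod q) : ‖modSum A q g‖ ≤ 1 := by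
  rw [modSum, norm_mul, norm_inv, Complex.norm_natCast]
  have h1 : ‖∑ a, crtInd A q a * ZMod.stdAddChar (∑ i, g i * a i)‖ ≤ (rho A q : ℝ) := by
    refine (norm_sum_le _ _).trans (le_of_eq ?_)
    simp_rw [norm_mul, norm_stdAddChar, mul_one]
    have h2 : ((∑ a, ‖crtInd A q a‖ : ℝ) : ℂ) = (rho A q : ℂ) := by
      rw [← sum_crtInd, Complex.ofReal_sum]
      exact sum_congr rfl fun a _ => norm_crtInd A a
    exact_mod_cast h2
  rcases Nat.eq_zero_or_pos (rho A q) with h0 | h0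
  · simp [h0]
  · rw [inv_mul_le_iff₀ (by exact_mod_cast h0), mul_one]
    exact h1

/-- Multiplying us + vr = 1 by x/(rs) gives x/(rs) = ux/r + vx/s. -/
theorem stdAddChar_mul {r s : ℕ} [NeZero r] [NeZero s] [NeZero (r * s)] {u v : ℤ}
    (huv : u * s + v * r = 1) (x : ZMod (r * s)) :
    (ZMod.stdAddChar x : ℂ) =
      ZMod.stdAddChar ((u : ZMod r) * ZMod.castHom (dvd_mul_right r s) (ZMod r) x) *
      ZMod.stdAddChar ((v : ZMod s) * ZMod.castHom (dvd_mul_left s r) (ZMod s) x) := by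
  obtain ⟨j, rfl⟩ := ZMod.intCast_surjective x
  rw [map_intCast (ZMod.castHom (dvd_mul_right r s) (ZMod r)),
    map_intCast (ZMod.castHom (dvd_mul_left s r) (ZMod s)), ← Int.cast_mul, ← Int.cast_mul, ZMod.stdAddChar_coe,
    ZMod.stdAddChar_coe, ZMod.stdAddChar_coe, ← Complex.exp_add]
  congr 1
  have hr : (r : ℂ) ≠ 0 := by exact_mod_cast NeZero.ne r
  have hs : (s : ℂ) ≠ 0 := by exact_mod_cast NeZero.ne s
  have h : (u : ℂ) * s + v * r = 1 := by exact_mod_cast huv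
  push_cast
  field_simp
  linear_combination (-(j : ℂ)) * h

theorem modSum_mul {r s : ℕ} [NeZero r] [NeZero s] [NeZero (r * s)] (hco : r.Coprime s) {u v : ℤ}
    (huv : u * s + v * r = 1) (g : Fin n → ZMod (r * s)) :
    modSum A (r * s) g =
      modSum A r (fun i => (u : ZMod r) * ZMod.castHom (dvd_mul_right r s) (ZMod r) (g i)) *
      modSum A s (fun i => (v : ZMod s) * ZMod.castHom (dvd_mul_left s r) (ZMod s) (g i)) := by
  have h1 : ∑ a, crtInd A (r * s) a * ZMod.stdAddChar (∑ i, g i * a i) =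
      (∑ a, crtInd A r a * ZMod.stdAddChar (∑ i,
        (u : ZMod r) * ZMod.castHom (dvd_mul_right r s) (ZMod r) (g i) * a i)) *
      ∑ a, crtInd A s a * ZMod.stdAddChar (∑ i,
        (v : ZMod s) * ZMod.castHom (dvd_mul_left s r) (ZMod s) (g i) * a i) := by
    rw [sum_mul_sum, ← sum_product', univ_product_univ]
    refine Fintype.sum_equiv (crtEquiv n hco) _ _ fun a => ?_
    rw [crtInd_mul A hco, stdAddChar_mul huv, crtEquiv_apply]
    simp only [map_sum, map_mul, mul_sum, mul_assoc]
    ring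
  rw [modSum, modSum, modSum, h1, rho_mul A (NeZero.ne r) (NeZero.ne s) hco]
  push_cast
  rw [mul_inv]
  ring

theorem exists_bezout {r s : ℕ} (hco : r.Coprime s) : ∃ u v : ℤ, u * s + v * r = 1 := by
  obtain ⟨a, b, hab⟩ := (Nat.isCoprime_iff_coprime.2 hco)
  exact ⟨b, a, by rw [add_comm]; exact hab⟩

/-- The mean of the absolute values of the exponential sums with frequencies `b h`, where `b` runs
over the units modulo `r`. -/
noncomputable def unitMean (r : ℕ) [NeZero r] (h : Fin n → ℤ) : ℝ :=
  (r.totient : ℝ)⁻¹ * ∑ b : (ZMod r)ˣ, ‖modSum A r fun i => (b : ZMod r) * (h i : ZMod r)‖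

theorem unitMean_nonneg (r : ℕ) [NeZero r] (h : Fin n → ℤ) : 0 ≤ unitMean A r h :=
  mul_nonneg (by positivity) (sum_nonneg fun _ _ => norm_nonneg _)

theorem unitMean_le_one (r : ℕ) [NeZero r] (h : Fin n → ℤ) : unitMean A r h ≤ 1 := by
  have h1 : 0 < (r.totient : ℝ) := by
    exact_mod_cast Nat.totient_pos.2 (Nat.pos_of_ne_zero (NeZero.ne r))
  rw [unitMean, inv_mul_le_iff₀ h1, mul_one]
  refine (sum_le_sum fun b _ => norm_modSum_le_one A r _).trans ?_
  rw [sum_const, card_univ, ZMod.card_units_eq_totient, nsmul_eq_mul, mul_one]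

theorem sum_units_smul_eq {r : ℕ} [NeZero r] (h : Fin n → ℤ) (c : (ZMod r)ˣ) :
    ∑ b : (ZMod r)ˣ, ‖modSum A r fun i => (c : ZMod r) * ((b : ZMod r) * (h i : ZMod r))‖ =
      r.totient * unitMean A r h := by
  have h1 : (r.totient : ℝ) ≠ 0 := by
    exact_mod_cast (Nat.totient_pos.2 (Nat.pos_of_ne_zero (NeZero.ne r))).ne'
  rw [unitMean, mul_inv_cancel_left₀ h1]
  refine Fintype.sum_equiv (Equiv.mulLeft c) _ _ fun b => ?_
  simp [mul_assoc]

theorem isUnit_of_bezout {r s : ℕ} {u v : ℤ} (huv : u * s + v * r = 1) :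
    IsUnit (u : ZMod r) := by
  refine IsUnit.of_mul_eq_one (s : ZMod r) ?_
  have := congrArg (fun x : ℤ => (x : ZMod r)) huv
  simpa using this

/-- The twists u and v in `modSum_mul` are units, so averaging over all units absorbs them; the
units modulo rs are the pairs of units modulo r and s. Without the average, the absolute values are
multiplicative only up to these twists. -/
theorem unitMean_mul {r s : ℕ} [NeZero r] [NeZero s] [NeZero (r * s)] (hco : r.Coprime s)
    (h : Fin n → ℤ) : unitMean A (r * s) h = unitMean A r h * unitMean A s h := by
  obtain ⟨u, v, huv⟩ := exists_bezout hco
  obtain ⟨u', hu'⟩ := isUnit_of_bezout huv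
  obtain ⟨v', hv'⟩ := isUnit_of_bezout (r := s) (s := r) (u := v) (v := u) (by linarith)
  have h1 : ∑ b : (ZMod (r * s))ˣ, ‖modSum A (r * s) fun i =>
      (b : ZMod (r * s)) * (h i : ZMod (r * s))‖ =
      (r.totient * unitMean A r h) * (s.totient * unitMean A s h) := by
    rw [← sum_units_smul_eq A h u', ← sum_units_smul_eq A h v', sum_mul_sum, ← sum_product',
      univ_product_univ]
    refine Fintype.sum_equiv ((Units.mapEquiv (ZMod.chineseRemainder hco).toMulEquiv).trans
      MulEquiv.prodUnits).toEquiv _ _ fun b => ?_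
    rw [modSum_mul A hco huv, norm_mul, hu', hv']
    congr 4
    · funext i
      rw [map_mul, map_intCast, ← chineseRemainder_fst hco]
      rfl
    · funext i
      rw [map_mul, map_intCast, ← chineseRemainder_snd hco]
      rfl
  rw [unitMean, h1, Nat.totient_mul hco]
  have h1 : (r.totient : ℝ) ≠ 0 := by
    exact_mod_cast (Nat.totient_pos.2 (Nat.pos_of_ne_zero (NeZero.ne r))).ne'
  have h2 : (s.totient : ℝ) ≠ 0 := by
    exact_mod_cast (Nat.totient_pos.2 (Nat.pos_of_ne_zero (NeZero.ne s))).ne'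
  push_cast
  field_simp

end CRTEquidist

/-! ### The saving at a prime, from Parseval and Cauchy–Schwarz -/

namespace CRTEquidist

open Finset ComplexConjugate

variable {n : ℕ} (A : (m : ℕ) → Set (Fin n → ZMod m))

theorem bddAbove_hyperplane (q : ℕ) [NeZero q] :
    BddAbove {m : ℕ | ∃ H : Set (Fin n → ZMod q), IsAffineHyperplane H ∧
      m = (H ∩ crtSet A q).ncard} := by
  refine ⟨rho A q, ?_⟩
  rintro m ⟨H, -, rfl⟩
  exact Set.ncard_le_ncard Set.inter_subset_right (Set.toFinite _)

theorem ncard_hyperplane_le_lam {q : ℕ} [NeZero q] {H : Set (Fin n → ZMod q)}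
    (hH : IsAffineHyperplane H) : (H ∩ crtSet A q).ncard ≤ lam A q :=
  le_csSup (bddAbove_hyperplane A q) ⟨H, hH, rfl⟩

theorem lam_le_rho (q : ℕ) [NeZero q] : lam A q ≤ rho A q := by
  refine csSup_le' ?_
  rintro m ⟨H, -, rfl⟩
  exact Set.ncard_le_ncard Set.inter_subset_right (Set.toFinite _)

/-- Orthogonality in b leaves p times the number of pairs (a, a') in A_p with g · a = g · a'. For
fixed a, the points a' lie on one affine hyperplane, so there are at most λ(p) of them. -/
theorem sum_norm_sq_modSum_le {p : ℕ} [Fact p.Prime] {g : Fin n → ZMod p} (hg : g ≠ 0) :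
    ∑ b : ZMod p, ‖∑ a, crtInd A p a * ZMod.stdAddChar (∑ i, b * g i * a i)‖ ^ 2 ≤
      (p : ℝ) * (rho A p * lam A p) := by
  classical
  set D : (Fin n → ZMod p) → ZMod p := fun a => ∑ i, g i * a i with hD
  have h1 : ∀ (b : ZMod p) (a : Fin n → ZMod p), ∑ i, b * g i * a i = b * D a := by
    intro b a
    simp only [hD, mul_sum, mul_assoc]
  have hconj : ∀ a : Fin n → ZMod p, conj (crtInd A p a) = crtInd A p a := by
    intro a; rw [crtInd]; split_ifs <;> simp
  have h2 : ∀ b : ZMod p,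
      ((‖∑ a, crtInd A p a * ZMod.stdAddChar (∑ i, b * g i * a i)‖ ^ 2 : ℝ) : ℂ) =
      ∑ a, ∑ a', crtInd A p a * crtInd A p a' * ZMod.stdAddChar (b * (D a - D a')) := by
    intro b
    simp_rw [h1]
    push_cast
    rw [← Complex.mul_conj', map_sum, sum_mul_sum]
    refine sum_congr rfl fun a _ => sum_congr rfl fun a' _ => ?_
    rw [map_mul (starRingEnd ℂ), hconj, ← AddChar.map_neg_eq_conj, mul_sub, sub_eq_add_neg,
      AddChar.map_add_eq_mul]
    ring
  have h3 : ((∑ b : ZMod p, ‖∑ a, crtInd A p a * ZMod.stdAddChar (∑ i, b * g i * a i)‖ ^ 2 : ℝ) : ℂ)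
      = ∑ a, crtInd A p a * (p * ∑ a', if D a' = D a then crtInd A p a' else 0) := by
    rw [Complex.ofReal_sum]
    simp_rw [h2]
    rw [sum_comm]
    refine sum_congr rfl fun a _ => ?_
    rw [sum_comm, mul_sum, mul_sum]
    refine sum_congr rfl fun a' _ => ?_
    rw [← mul_sum, AddChar.sum_mulShift _ (ZMod.isPrimitive_stdAddChar p), ZMod.card]
    by_cases h : D a' = D a
    · rw [if_pos h, if_pos (by rw [h, sub_self])]; ring
    · rw [if_neg h, if_neg fun h' => h (sub_eq_zero.1 h').symm]; simp
  have h4 : ∀ a : Fin n → ZMod p, (∑ a', if D a' = D a then crtInd A p a' else 0) =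
      ((({x | ∑ i, g i * x i = D a} ∩ crtSet A p).ncard : ℕ) : ℂ) := by
    intro a
    have : ({x | ∑ i, g i * x i = D a} ∩ crtSet A p) =
        ((univ.filter fun x => D x = D a ∧ x ∈ crtSet A p : Finset (Fin n → ZMod p)) : Set _) := by
      ext x; simp [hD]
    rw [this, Set.ncard_coe_finset, card_eq_sum_ones, sum_filter]
    push_cast
    refine sum_congr rfl fun x _ => ?_
    rw [crtInd, ite_and]
  simp_rw [h4] at h3
  have h5 : ∑ b : ZMod p, ‖∑ a, crtInd A p a * ZMod.stdAddChar (∑ i, b * g i * a i)‖ ^ 2 =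
      ∑ a, ‖crtInd A p a‖ * (p * (({x | ∑ i, g i * x i = D a} ∩ crtSet A p).ncard : ℝ)) := by
    have : ((∑ a, ‖crtInd A p a‖ * (p * (({x | ∑ i, g i * x i = D a} ∩ crtSet A p).ncard : ℝ)) : ℝ)
        : ℂ) = ∑ a, crtInd A p a * (p * (({x | ∑ i, g i * x i = D a} ∩ crtSet A p).ncard : ℂ)) := by
      push_cast
      exact sum_congr rfl fun a _ => by rw [norm_crtInd]
    rw [← this] at h3
    exact_mod_cast h3
  have h6 : ∑ a, ‖crtInd A p a‖ = (rho A p : ℝ) := by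
    have : ((∑ a, ‖crtInd A p a‖ : ℝ) : ℂ) = (rho A p : ℂ) := by
      rw [← sum_crtInd, Complex.ofReal_sum]
      exact sum_congr rfl fun a _ => norm_crtInd A a
    exact_mod_cast this
  rw [h5]
  calc _ ≤ ∑ a, ‖crtInd A p a‖ * (p * (lam A p : ℝ)) := by
        gcongr with a
        exact ncard_hyperplane_le_lam A ⟨g, hg, D a, rfl⟩
    _ = _ := by rw [← sum_mul, h6]; ring

theorem sum_units_add_zero {p : ℕ} [Fact p.Prime] (F : ZMod p → ℝ) :
    ∑ b : (ZMod p)ˣ, F b + F 0 = ∑ b : ZMod p, F b := by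
  classical
  rw [← sum_erase_add _ _ (mem_univ (0 : ZMod p))]
  congr 1
  refine sum_bij (fun b _ => (b : ZMod p)) (fun b _ => by simp) (fun a _ b _ h => Units.ext h)
    (fun b hb => ⟨Units.mk0 b (ne_of_mem_erase hb), mem_univ _, rfl⟩) fun b _ => rfl

/-- The saving at a prime not dividing the frequency vector. -/
theorem unitMean_prime_le {p : ℕ} [Fact p.Prime] {h : Fin n → ℤ}
    (hh : (fun i => (h i : ZMod p)) ≠ 0) :
    unitMean A p h ≤ 1 - (1 - (lam A p : ℝ) / rho A p) / 2 := by
  have hp := Fact.out (p := p.Prime)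
  rcases Nat.eq_zero_or_pos (rho A p) with h0 | h0
  · have : unitMean A p h = 0 := by simp [unitMean, modSum, h0]
    rw [this, h0]
    norm_num
  have hρ : (0 : ℝ) < rho A p := by exact_mod_cast h0
  set κ : ℝ := (lam A p : ℝ) / rho A p with hκ
  have hκ0 : 0 ≤ κ := by positivity
  have hκ1 : κ ≤ 1 := by
    rw [hκ, div_le_one hρ]
    exact_mod_cast lam_le_rho A p
  set F : ZMod p → ℝ := fun b => ‖modSum A p fun i => b * (h i : ZMod p)‖ with hF
  have hp1 : (1 : ℝ) < p := by exact_mod_cast hp.one_lt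
  have hall : ∑ b : ZMod p, F b ^ 2 ≤ p * κ := by
    have h1 := sum_norm_sq_modSum_le A hh
    have h2 : ∀ b : ZMod p, F b ^ 2 = ((rho A p : ℝ) ^ 2)⁻¹ *
        ‖∑ a, crtInd A p a * ZMod.stdAddChar (∑ i, b * (h i : ZMod p) * a i)‖ ^ 2 := by
      intro b
      simp only [hF, modSum]
      rw [norm_mul, norm_inv, Complex.norm_natCast, mul_pow, inv_pow]
    simp_rw [h2]
    rw [← mul_sum, inv_mul_le_iff₀ (by positivity), hκ]
    refine h1.trans (le_of_eq ?_)
    field_simp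
  have hzero : F 0 = 1 := by
    simp only [hF, modSum, zero_mul, sum_const_zero, AddChar.map_zero_eq_one, mul_one, sum_crtInd]
    rw [inv_mul_cancel₀ (by exact_mod_cast hρ.ne')]
    simp
  -- The term b = 0 contributes exactly 1, and pκ - 1 ≤ (p - 1)κ since κ ≤ 1.
  have hunits : ∑ b : (ZMod p)ˣ, F b ^ 2 ≤ (p - 1) * κ := by
    have h1 := sum_units_add_zero fun b => F b ^ 2
    rw [hzero] at h1
    nlinarith
  have hcard : ((univ : Finset (ZMod p)ˣ).card : ℝ) = p - 1 := by
    rw [card_univ, ZMod.card_units_eq_totient, Nat.totient_prime hp, Nat.cast_sub hp.one_le]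
    simp
  have hcs := sq_sum_le_card_mul_sum_sq (s := (univ : Finset (ZMod p)ˣ)) (f := fun b => F b)
  rw [hcard] at hcs
  -- Cauchy–Schwarz bounds the mean by √κ, and √κ ≤ (1 + κ)/2 = 1 - (1 - κ)/2.
  have hsq : (∑ b : (ZMod p)ˣ, F b) ^ 2 ≤ ((p - 1) * (1 - (1 - κ) / 2)) ^ 2 := by
    refine hcs.trans ((mul_le_mul_of_nonneg_left hunits (by linarith)).trans ?_)
    rw [mul_pow, ← mul_assoc, ← sq]
    refine mul_le_mul_of_nonneg_left ?_ (by positivity)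
    nlinarith [sq_nonneg (1 - κ)]
  have hle := abs_le_of_sq_le_sq' hsq (mul_nonneg (by linarith) (by linarith))
  rw [unitMean, Nat.totient_prime hp, Nat.cast_sub hp.one_le, Nat.cast_one,
    inv_mul_le_iff₀ (by linarith)]
  exact hle.2

open Classical in
/-- The bound for the factor at `p^v` of a mean of exponential sums. -/
noncomputable def saving (h : Fin n → ℤ) (p v : ℕ) : ℝ :=
  if v = 1 ∧ ∃ i, ¬ (p : ℤ) ∣ h i then 1 - (1 - (lam A p : ℝ) / rho A p) / 2 else 1

theorem saving_nonneg (h : Fin n → ℤ) (p v : ℕ) : 0 ≤ saving A h p v := by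
  rw [saving]
  split_ifs
  · have : 0 ≤ (lam A p : ℝ) / rho A p := by positivity
    linarith
  · exact zero_le_one

theorem unitMean_prime_pow_le {p v : ℕ} (hp : p.Prime) [NeZero (p ^ v)] (h : Fin n → ℤ) :
    unitMean A (p ^ v) h ≤ saving A h p v := by
  rw [saving]
  split_ifs with hv
  · obtain ⟨rfl, i, hi⟩ := hv
    have : Fact p.Prime := ⟨hp⟩
    -- The modulus is a variable q because p ^ 1 and p index different types.
    have key : ∀ q (_ : NeZero q), q = p → unitMean A q h ≤ 1 - (1 - (lam A p : ℝ) / rho A p) / 2 := by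
      rintro q hq rfl
      refine unitMean_prime_le A fun h0 => hi ?_
      exact (ZMod.intCast_zmod_eq_zero_iff_dvd _ _).1 (congrFun h0 i)
    exact key _ _ (pow_one p)
  · exact unitMean_le_one A _ _

theorem unitMean_le_prod (r : ℕ) [NeZero r] (h : Fin n → ℤ) :
    unitMean A r h ≤ ∏ p ∈ r.primeFactors, saving A h p (r.factorization p) := by
  have key : ∀ r : ℕ, ∀ hr : NeZero r,
      unitMean A r h ≤ ∏ p ∈ r.primeFactors, saving A h p (r.factorization p) := by
    intro r
    induction r using Nat.recOnPosPrimePosCoprime with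
    | prime_pow p v hp hv =>
      intro hr
      rw [Nat.primeFactors_prime_pow hv.ne' hp, prod_singleton]
      refine (unitMean_prime_pow_le A hp h).trans (le_of_eq ?_)
      rw [hp.factorization_pow]
      simp
    | zero => intro hr; exact absurd rfl hr.ne
    | one => intro hr; simpa using unitMean_le_one A 1 h
    | coprime a b ha hb hab iha ihb =>
      intro hr
      have : NeZero a := ⟨by omega⟩
      have : NeZero b := ⟨by omega⟩
      rw [unitMean_mul A hab, hab.primeFactors_mul, prod_union hab.disjoint_primeFactors]
      have e1 : ∀ p ∈ a.primeFactors, saving A h p ((a * b).factorization p) =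
          saving A h p (a.factorization p) := fun p hp => by
        rw [factorization_mul_of_mem_primeFactors_left hab hp]
      have e2 : ∀ p ∈ b.primeFactors, saving A h p ((a * b).factorization p) =
          saving A h p (b.factorization p) := fun p hp => by
        rw [mul_comm a b, factorization_mul_of_mem_primeFactors_left hab.symm hp]
      rw [prod_congr rfl e1, prod_congr rfl e2]
      exact mul_le_mul (iha _) (ihb _) (unitMean_nonneg A _ _)
        (prod_nonneg fun _ _ => saving_nonneg A _ _ _)
  exact key r _

end CRTEquidist

/-! ### Integers with prescribed factorization; smooth and rough parts -/

namespace CRTEquidist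

open Finset

section Integers

/-- The integers with exactly `j` prime factors, all in `S`, and with the exponent of `p`
in `V p`. -/
noncomputable def integersWith (S : Finset ℕ) (V : ℕ → Finset ℕ) (j : ℕ) : Finset ℕ :=
  ((S.powersetCard j).sigma fun T => T.pi V).image fun x =>
    (Finsupp.indicator x.1 x.2).prod (· ^ ·)

variable {S : Finset ℕ} {V : ℕ → Finset ℕ}

theorem factorization_indicator_prod {T : Finset ℕ} (hT : ∀ p ∈ T, p.Prime) (φ : ∀ p ∈ T, ℕ) :
    ((Finsupp.indicator T φ).prod (· ^ ·)).factorization = Finsupp.indicator T φ :=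
  Nat.prod_pow_factorization_eq_self fun p hp =>
    hT p (Finsupp.support_indicator_subset _ _ hp)

theorem primeFactors_indicator_prod {T : Finset ℕ} (hT : ∀ p ∈ T, p.Prime) (φ : ∀ p ∈ T, ℕ)
    (hφ : ∀ p (hp : p ∈ T), φ p hp ≠ 0) :
    ((Finsupp.indicator T φ).prod (· ^ ·)).primeFactors = T := by
  rw [← Nat.support_factorization, factorization_indicator_prod hT]
  refine Subset.antisymm (Finsupp.support_indicator_subset _ _) fun p hp => ?_
  rw [Finsupp.mem_support_iff, Finsupp.indicator_of_mem hp]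
  exact hφ p hp

theorem indicator_prod_ne_zero {T : Finset ℕ} (hT : ∀ p ∈ T, p.Prime) (φ : ∀ p ∈ T, ℕ) :
    (Finsupp.indicator T φ).prod (· ^ ·) ≠ 0 :=
  prod_ne_zero_iff.2 fun p hp =>
    pow_ne_zero _ (hT p (Finsupp.support_indicator_subset _ _ hp)).ne_zero

theorem indicator_factorization (m : ℕ) (hm : m ≠ 0) :
    (Finsupp.indicator m.primeFactors fun p _ => m.factorization p).prod (· ^ ·) = m := by
  have : (Finsupp.indicator m.primeFactors fun p _ => m.factorization p) = m.factorization := by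
    ext p
    by_cases hp : p ∈ m.primeFactors
    · rw [Finsupp.indicator_of_mem hp]
    · rw [Finsupp.indicator_of_notMem hp, ← Nat.support_factorization, Finsupp.notMem_support_iff]
        at *
      exact hp.symm
  rw [this]
  exact Nat.prod_factorization_pow_eq_self hm

theorem mem_integersWith (hS : ∀ p ∈ S, p.Prime) (hV : ∀ p ∈ S, ∀ v ∈ V p, v ≠ 0) {j m : ℕ} :
    m ∈ integersWith S V j ↔ m ≠ 0 ∧ m.primeFactors ⊆ S ∧ #m.primeFactors = j ∧
      ∀ p ∈ m.primeFactors, m.factorization p ∈ V p := by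
  simp only [integersWith, mem_image, mem_sigma, mem_powersetCard, mem_pi, Sigma.exists]
  constructor
  · rintro ⟨T, φ, ⟨⟨hTS, hTj⟩, hφ⟩, rfl⟩
    have hT : ∀ p ∈ T, p.Prime := fun p hp => hS p (hTS hp)
    have hpf := primeFactors_indicator_prod hT φ fun p hp => hV p (hTS hp) _ (hφ p hp)
    refine ⟨indicator_prod_ne_zero hT φ, ?_, ?_, ?_⟩
    · rw [hpf]; exact hTS
    · rw [hpf]; exact hTj
    · intro p hp
      rw [hpf] at hp
      rw [factorization_indicator_prod hT, Finsupp.indicator_of_mem hp]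
      exact hφ p hp
  · rintro ⟨h0, h1, h2, h3⟩
    exact ⟨m.primeFactors, fun p _ => m.factorization p, ⟨⟨h1, h2⟩, fun p hp => h3 p hp⟩,
      indicator_factorization m h0⟩

/-- By unique factorization an integer here is the same as a j-set T of primes with an exponent
chosen for each; distributing the product over T of the sums over exponents gives the identity. It
turns sums over moduli into elementary symmetric sums. -/
theorem sum_integersWith (hS : ∀ p ∈ S, p.Prime) (hV : ∀ p ∈ S, ∀ v ∈ V p, v ≠ 0)
    (F : ℕ → ℕ → ℝ) (j : ℕ) :
    ∑ m ∈ integersWith S V j, ∏ p ∈ m.primeFactors, F p (m.factorization p) =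
      elemSymm S (fun p => ∑ v ∈ V p, F p v) j := by
  have hmem : ∀ x ∈ (S.powersetCard j).sigma fun T => T.pi V,
      (x.1 ⊆ S ∧ #x.1 = j) ∧ ∀ p (hp : p ∈ x.1), x.2 p hp ∈ V p := by
    intro x hx
    simpa only [mem_sigma, mem_powersetCard, mem_pi] using hx
  have hpf : ∀ x ∈ (S.powersetCard j).sigma fun T => T.pi V,
      ((Finsupp.indicator x.1 x.2).prod (· ^ ·)).primeFactors = x.1 := fun x hx =>
    primeFactors_indicator_prod (fun p hp => hS p ((hmem x hx).1.1 hp)) x.2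
      fun p hp => hV p ((hmem x hx).1.1 hp) _ ((hmem x hx).2 p hp)
  have hfac : ∀ x ∈ (S.powersetCard j).sigma fun T => T.pi V,
      ((Finsupp.indicator x.1 x.2).prod (· ^ ·)).factorization = Finsupp.indicator x.1 x.2 :=
    fun x hx => factorization_indicator_prod (fun p hp => hS p ((hmem x hx).1.1 hp)) x.2
  rw [integersWith, sum_image]
  · simp_rw [elemSymm, prod_sum]
    rw [sum_sigma']
    refine sum_congr rfl fun x hx => ?_
    rw [hpf x hx, hfac x hx, ← prod_attach x.1]
    exact prod_congr rfl fun p _ => by rw [Finsupp.indicator_of_mem p.2]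
  · intro x hx y hy hxy
    have h1 : x.1 = y.1 := by
      rw [← hpf x hx, ← hpf y hy]
      exact congrArg Nat.primeFactors hxy
    have h2 := congrArg Nat.factorization hxy
    simp only at h2
    rw [hfac x hx, hfac y hy] at h2
    obtain ⟨T, φ⟩ := x
    obtain ⟨T', φ'⟩ := y
    simp only at h1 h2
    subst h1
    congr 1
    funext p hp
    have := DFunLike.congr_fun h2 p
    rwa [Finsupp.indicator_of_mem hp, Finsupp.indicator_of_mem hp] at this

end Integers

section SmoothPart

open Classical in
/-- The part of `m` composed of primes up to `w`. -/
noncomputable def smoothPart (w : ℝ) (m : ℕ) : ℕ :=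
  ∏ p ∈ m.primeFactors.filter fun p : ℕ => (p : ℝ) ≤ w, p ^ m.factorization p

open Classical in
/-- The part of `m` composed of primes exceeding `w`. -/
noncomputable def roughPart (w : ℝ) (m : ℕ) : ℕ :=
  ∏ p ∈ m.primeFactors.filter fun p : ℕ => ¬ (p : ℝ) ≤ w, p ^ m.factorization p

theorem smoothPart_ne_zero (w : ℝ) (m : ℕ) : smoothPart w m ≠ 0 :=
  prod_ne_zero_iff.2 fun _ hp =>
    pow_ne_zero _ (Nat.prime_of_mem_primeFactors (mem_filter.1 hp).1).ne_zero

instance (w : ℝ) (m : ℕ) : NeZero (smoothPart w m) := ⟨smoothPart_ne_zero w m⟩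

theorem smoothPart_mul_roughPart (w : ℝ) {m : ℕ} (hm : m ≠ 0) :
    smoothPart w m * roughPart w m = m := by
  rw [smoothPart, roughPart, prod_filter_mul_prod_filter_not]
  exact Nat.prod_factorization_pow_eq_self hm

theorem coprime_smoothPart_roughPart (w : ℝ) (m : ℕ) :
    (smoothPart w m).Coprime (roughPart w m) := by
  refine Nat.Coprime.prod_left fun p hp => Nat.Coprime.prod_right fun q hq => ?_
  rw [mem_filter] at hp hq
  refine Nat.coprime_pow_primes _ _ (Nat.prime_of_mem_primeFactors hp.1)
    (Nat.prime_of_mem_primeFactors hq.1) ?_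
  rintro rfl
  exact hq.2 hp.2

open Classical in
theorem primeFactors_smoothPart (w : ℝ) (m : ℕ) :
    (smoothPart w m).primeFactors = m.primeFactors.filter fun p : ℕ => (p : ℝ) ≤ w := by
  ext p
  rw [Nat.mem_primeFactors_of_ne_zero (smoothPart_ne_zero w m)]
  constructor
  · rintro ⟨hp, hdvd⟩
    rw [smoothPart, hp.prime.dvd_finsetProd_iff] at hdvd
    obtain ⟨q, hq, hpq⟩ := hdvd
    have hq' := Nat.prime_of_mem_primeFactors (mem_filter.1 hq).1
    rwa [(Nat.prime_dvd_prime_iff_eq hp hq').1 (hp.dvd_of_dvd_pow hpq)]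
  · intro hp
    have hp' := (mem_filter.1 hp).1
    refine ⟨Nat.prime_of_mem_primeFactors hp', ?_⟩
    refine (dvd_pow_self p ?_).trans (dvd_prod_of_mem _ hp)
    rwa [← Nat.support_factorization, Finsupp.mem_support_iff] at hp'

theorem factorization_smoothPart (w : ℝ) {m p : ℕ} (hm : m ≠ 0)
    (hp : p ∈ (smoothPart w m).primeFactors) :
    (smoothPart w m).factorization p = m.factorization p := by
  conv_rhs => rw [← smoothPart_mul_roughPart w hm]
  exact (factorization_mul_of_mem_primeFactors_left (coprime_smoothPart_roughPart w m) hp).symm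

/-- Each prime power in the smooth part is at most w: for exponent 1 because p ≤ w, otherwise by
assumption. There are at most k of them. -/
theorem smoothPart_le (w : ℝ) {m k : ℕ} (hw : 1 ≤ w) (hk : #m.primeFactors ≤ k)
    (hm : ∀ p ∈ m.primeFactors, m.factorization p = 1 ∨ (p : ℝ) ^ m.factorization p ≤ w) :
    (smoothPart w m : ℝ) ≤ w ^ k := by
  classical
  rw [smoothPart]
  push_cast
  refine (prod_le_prod (g := fun _ => w) (fun _ _ => by positivity) fun p hp => ?_).trans
    ((prod_const w).trans_le (pow_le_pow_right₀ hw ((card_le_card (filter_subset _ _)).trans hk)))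
  rw [mem_filter] at hp
  rcases hm p hp.1 with h | h
  · rw [h, pow_one]; exact hp.2
  · exact h

end SmoothPart

section Rho

variable {n : ℕ} (A : (m : ℕ) → Set (Fin n → ZMod m))

theorem rho_one : rho A 1 = 1 := by
  have : crtSet A 1 = Set.univ := by
    ext a; simp [crtSet]
  rw [rho, this, Set.ncard_univ, Nat.card_eq_fintype_card, Fintype.card_unique]

theorem rho_eq_prod {m : ℕ} (hm : m ≠ 0) :
    rho A m = ∏ p ∈ m.primeFactors, rho A (p ^ m.factorization p) := by
  refine Nat.multiplicative_factorization (rho A) (fun a b hab => ?_) (rho_one A) hm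
  rcases Nat.eq_zero_or_pos a with ha | ha
  · subst ha
    rw [Nat.coprime_zero_left] at hab
    simp [hab, rho_one]
  rcases Nat.eq_zero_or_pos b with hb | hb
  · subst hb
    rw [Nat.coprime_zero_right] at hab
    simp [hab, rho_one]
  exact rho_mul A ha.ne' hb.ne' hab

theorem one_le_rho_iff {m : ℕ} (hm : m ≠ 0) :
    1 ≤ rho A m ↔ ∀ p ∈ m.primeFactors, 1 ≤ rho A (p ^ m.factorization p) := by
  rw [rho_eq_prod A hm]
  simp only [Nat.one_le_iff_ne_zero, prod_ne_zero_iff]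

end Rho

end CRTEquidist

/-! ### Upper bound for sums of Weyl sums and lower bound for |𝒬_k(x)| -/

namespace CRTEquidist

open Finset

variable {n : ℕ} (A : (m : ℕ) → Set (Fin n → ZMod m))

/-- The primes up to `y`. -/
noncomputable def primesUpTo (y : ℝ) : Finset ℕ := (Icc 1 ⌊y⌋₊).filter Nat.Prime

theorem mem_primesUpTo {y : ℝ} (hy : 0 ≤ y) {p : ℕ} :
    p ∈ primesUpTo y ↔ p.Prime ∧ (p : ℝ) ≤ y := by
  rw [primesUpTo, mem_filter, mem_Icc, Nat.le_floor_iff hy]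
  exact ⟨fun h => ⟨h.2, h.1.2⟩, fun h => ⟨⟨h.1.one_le, h.2⟩, h.1⟩⟩

theorem prime_of_mem_primesUpTo {y : ℝ} {p : ℕ} (hp : p ∈ primesUpTo y) : p.Prime :=
  (mem_filter.1 hp).2

open Classical in
/-- The admissible exponents of `p`: those with `ρ(p^v) ≥ 1`, and with `p^v ≤ w` if `v ≥ 2`. -/
noncomputable def exponents (w x : ℝ) (p : ℕ) : Finset ℕ :=
  (Icc 1 ⌊x⌋₊).filter fun v => 1 ≤ rho A (p ^ v) ∧ (v = 1 ∨ (p : ℝ) ^ v ≤ w)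

theorem mem_exponents {w x : ℝ} {p v : ℕ} : v ∈ exponents A w x p ↔
    (1 ≤ v ∧ v ≤ ⌊x⌋₊) ∧ 1 ≤ rho A (p ^ v) ∧ (v = 1 ∨ (p : ℝ) ^ v ≤ w) := by
  simp [exponents]

open Classical in
/-- The numbers `q ∈ 𝒬_k(x)` without large proper prime powers and with a large simple
prime factor. -/
noncomputable def goodQk (k : ℕ) (w y₀ x : ℝ) : Finset ℕ :=
  (Qk A k x).filter fun q =>
    (∀ p ∈ q.primeFactors, q.factorization p = 1 ∨ (p : ℝ) ^ q.factorization p ≤ w) ∧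
    ∃ P ∈ q.primeFactors, q.factorization P = 1 ∧ y₀ ≤ P

theorem mem_Qk {k : ℕ} {x : ℝ} {q : ℕ} : q ∈ Qk A k x ↔
    (1 ≤ q ∧ q ≤ ⌊x⌋₊) ∧ 1 ≤ rho A q ∧ #q.primeFactors = k := by
  simp [Qk]

/-- Sum over primes of the exponential sums modulo `r`, given an upper bound for primes in
progressions modulo `r`. -/
theorem sum_primes_modSum_le {r t : ℕ} [NeZero r] (hrt : r.Coprime t) (h : Fin n → ℤ) {K : ℝ}
    {Ps : Finset ℕ} (hco : ∀ P ∈ Ps, r.Coprime P)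
    (hK : ∀ c : ℕ, (#{P ∈ Ps | P ≡ c [MOD r]} : ℝ) ≤ K / r.totient) :
    ∑ P ∈ Ps, ‖modSum A r fun i => (((t * P : ℕ) : ZMod r))⁻¹ * (h i : ZMod r)‖ ≤
      K * unitMean A r h := by
  classical
  set T : ZMod r → ℝ := fun b => ‖modSum A r fun i => b * (h i : ZMod r)‖ with hT
  have hunit : ∀ P ∈ Ps, IsUnit ((t * P : ℕ) : ZMod r) := fun P hP =>
    (ZMod.isUnit_iff_coprime _ _).2 ((hrt.mul_right (hco P hP)).symm)
  have h1 : ∑ P ∈ Ps, T (((t * P : ℕ) : ZMod r))⁻¹ ≤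
      ∑ b : (ZMod r)ˣ, ∑ P ∈ Ps with (((t * P : ℕ) : ZMod r))⁻¹ = b, T b := by
    have : ∀ P ∈ Ps, T (((t * P : ℕ) : ZMod r))⁻¹ ≤
        ∑ b : (ZMod r)ˣ, if (((t * P : ℕ) : ZMod r))⁻¹ = b then T b else 0 := by
      intro P hP
      obtain ⟨c, hc⟩ := hunit P hP
      have hc' : (((t * P : ℕ) : ZMod r))⁻¹ = ((c⁻¹ : (ZMod r)ˣ) : ZMod r) := by
        rw [← hc, ZMod.inv_coe_unit]
      rw [hc']
      refine le_trans (le_of_eq ?_) (single_le_sum (f := fun b : (ZMod r)ˣ =>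
        if ((c⁻¹ : (ZMod r)ˣ) : ZMod r) = b then T b else 0) (fun b _ => ?_) (mem_univ c⁻¹))
      · simp only [if_true]
      · split_ifs
        · exact norm_nonneg _
        · exact le_rfl
    refine (sum_le_sum this).trans (le_of_eq ?_)
    rw [sum_comm]
    exact sum_congr rfl fun b _ => (sum_filter _ _).symm
  refine h1.trans ?_
  rw [unitMean, ← mul_assoc, mul_sum, ← div_eq_mul_inv]
  refine sum_le_sum fun b _ => ?_
  rw [sum_const, nsmul_eq_mul]
  refine mul_le_mul_of_nonneg_right ?_ (norm_nonneg _)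
  obtain ⟨t', ht'⟩ : IsUnit (t : ZMod r) := (ZMod.isUnit_iff_coprime _ _).2 hrt.symm
  -- The condition (tP)⁻¹ = b confines P to the single class t⁻¹b⁻¹ modulo r.
  refine le_trans ?_ (hK (((t'⁻¹ * b⁻¹ : (ZMod r)ˣ) : ZMod r)).val)
  refine Nat.cast_le.2 (card_le_card fun P hP => ?_)
  rw [mem_filter] at hP ⊢
  refine ⟨hP.1, ?_⟩
  rw [← ZMod.natCast_eq_natCast_iff, ZMod.natCast_zmod_val]
  obtain ⟨c, hc⟩ := hunit P hP.1
  have h2 := hP.2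
  rw [← hc, ZMod.inv_coe_unit] at h2
  have h3 : c⁻¹ = b := Units.ext h2
  have h4 : (t' : ZMod r) * P = c := by rw [ht', hc]; push_cast; rfl
  rw [← h3, inv_inv]
  push_cast
  rw [← h4, Units.inv_mul_cancel_left]

/-- The factor modulo s is bounded trivially by 1. What remains is the factor modulo r, whose Bézout
twist is s⁻¹; this dependence on s is what is averaged later. -/
theorem norm_weylSum_mul_le {r s : ℕ} [NeZero r] (hs : s ≠ 0) (hco : r.Coprime s)
    (h : Fin n → ℤ) :
    ‖weylSum A (r * s) h‖ ≤ ‖modSum A r fun i => ((s : ZMod r))⁻¹ * (h i : ZMod r)‖ := by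
  have : NeZero s := ⟨hs⟩
  obtain ⟨u, v, huv⟩ := exists_bezout hco
  have hu : ((s : ZMod r))⁻¹ = (u : ZMod r) := by
    have h1 : (s : ZMod r) * (u : ZMod r) = 1 := by
      have := congrArg (fun x : ℤ => (x : ZMod r)) huv
      simp only [Int.cast_add, Int.cast_mul, Int.cast_natCast, CharP.cast_eq_zero, mul_zero,
        add_zero, Int.cast_one] at this
      rw [mul_comm]; exact this
    exact ZMod.inv_eq_of_mul_eq_one r _ _ h1
  rw [weylSum_eq_modSum, modSum_mul A hco huv, norm_mul, hu]
  refine (mul_le_of_le_one_right (norm_nonneg _) (norm_modSum_le_one A s _)).trans (le_of_eq ?_)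
  simp only [map_intCast]

theorem norm_weylSum_le_one {q : ℕ} (hq : q ≠ 0) (h : Fin n → ℤ) : ‖weylSum A q h‖ ≤ 1 := by
  have : NeZero q := ⟨hq⟩
  rw [weylSum_eq_modSum]
  exact norm_modSum_le_one A q _

open Classical in
/-- The bound for the local factor at `p^v`, with savings only from primes up to `w`. -/
noncomputable def localBound (w : ℝ) (h : Fin n → ℤ) (p v : ℕ) : ℝ :=
  if (p : ℝ) ≤ w then saving A h p v else 1

theorem localBound_nonneg (w : ℝ) (h : Fin n → ℤ) (p v : ℕ) : 0 ≤ localBound A w h p v := by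
  rw [localBound]
  split_ifs
  · exact saving_nonneg A h p v
  · exact zero_le_one

theorem unitMean_smoothPart_le (w : ℝ) {m : ℕ} (hm : m ≠ 0) (h : Fin n → ℤ) :
    unitMean A (smoothPart w m) h ≤
      ∏ p ∈ m.primeFactors, localBound A w h p (m.factorization p) := by
  classical
  refine (unitMean_le_prod A _ h).trans (le_of_eq ?_)
  rw [prod_congr rfl fun p hp => by rw [factorization_smoothPart w hm hp],
    primeFactors_smoothPart, prod_filter]
  rfl

/-- Upper bound for the sum of the exponential sums over good moduli. -/
theorem sum_goodQk_le {k : ℕ} {w y₀ x : ℝ} (hk : 1 ≤ k) (hw : 1 ≤ w) (hx : 0 ≤ x)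
    {B : ℝ} (hB : ∀ r : ℕ, r ≠ 0 → (r : ℝ) ≤ w ^ (k - 1) → ∀ c N : ℕ,
      (#((Icc 1 N).filter fun P : ℕ => (P.Prime ∧ y₀ ≤ (P : ℝ)) ∧ P ≡ c [MOD r]) : ℝ) ≤ B * N / r.totient)
    (h : Fin n → ℤ) :
    ∑ q ∈ goodQk A k w y₀ x, ‖weylSum A q h‖ ≤ B * x * elemSymm (primesUpTo x)
      (fun p => ∑ v ∈ exponents A w x p, localBound A w h p v / (p : ℝ) ^ v) (k - 1) := by
  classical
  have hB0 : 0 ≤ B := by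
    have := (Nat.cast_nonneg _).trans (hB 1 one_ne_zero (by simpa using one_le_pow₀ hw) 0 1)
    simpa using this
  set M := integersWith (primesUpTo x) (exponents A w x) (k - 1) with hM
  have hV : ∀ p ∈ primesUpTo x, ∀ v ∈ exponents A w x p, v ≠ 0 := fun p _ v hv => by
    have := ((mem_exponents A).1 hv).1.1; omega
  have hmemM : ∀ {m}, m ∈ M ↔ _ :=
    mem_integersWith (fun p hp => prime_of_mem_primesUpTo hp) hV
  set Ps : ℕ → Finset ℕ := fun m =>
    (Icc 1 ⌊x / m⌋₊).filter fun P : ℕ => (P.Prime ∧ y₀ ≤ (P : ℝ)) ∧ ¬ P ∣ m with hPs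
  -- Split off a large simple prime P. The cofactor m keeps the admissible exponents and has k - 1
  -- prime factors. Any choice of P will do, since q = mP is recovered from the pair.
  have hpick : ∀ q ∈ goodQk A k w y₀ x, ∃ P m, q = m * P ∧ m ∈ M ∧ P ∈ Ps m := by
    intro q hq
    rw [goodQk, mem_filter, mem_Qk] at hq
    obtain ⟨⟨⟨hq1, hqx⟩, hρ, hcard⟩, hpow, P, hP, hP1, hPy⟩ := hq
    have hPp := Nat.prime_of_mem_primeFactors hP
    obtain ⟨m, rfl⟩ := Nat.dvd_of_mem_primeFactors hP
    have hm0 : m ≠ 0 := by rintro rfl; simp at hq1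
    have hmP : ¬ P ∣ m := by
      intro hd
      rw [Nat.factorization_mul hPp.ne_zero hm0, Finsupp.add_apply, hPp.factorization_self] at hP1
      have := (hPp.dvd_iff_one_le_factorization hm0).1 hd
      omega
    have hco : P.Coprime m := (Nat.Prime.coprime_iff_not_dvd hPp).2 hmP
    have hpf : (P * m).primeFactors = insert P m.primeFactors := by
      rw [hco.primeFactors_mul, hPp.primeFactors, insert_eq]
    have hPm : P ∉ m.primeFactors := fun h => hmP (Nat.dvd_of_mem_primeFactors h)
    have hfac : ∀ p ∈ m.primeFactors, (P * m).factorization p = m.factorization p := by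
      intro p hp
      rw [mul_comm]
      exact factorization_mul_of_mem_primeFactors_left hco.symm hp
    refine ⟨P, m, mul_comm _ _, hmemM.2 ⟨hm0, fun p hp => ?_, ?_, fun p hp => ?_⟩, ?_⟩
    · have hp' := Nat.prime_of_mem_primeFactors hp
      refine (mem_primesUpTo hx).2 ⟨hp', (Nat.le_floor_iff hx).1 (le_trans ?_ hqx)⟩
      exact Nat.le_of_dvd hq1 (Nat.dvd_mul_left_of_dvd (Nat.dvd_of_mem_primeFactors hp) P)
    · rw [hpf, card_insert_of_notMem hPm] at hcard
      omega
    · have hp2 : p ∈ (P * m).primeFactors := by rw [hpf]; exact mem_insert_of_mem hp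
      have h1 := hpow p hp2
      have h2 := (one_le_rho_iff A (by omega : P * m ≠ 0)).1 hρ p hp2
      rw [hfac p hp] at h1 h2
      have hp' := Nat.prime_of_mem_primeFactors hp
      refine (mem_exponents A).2 ⟨⟨?_, ?_⟩, h2, h1⟩
      · exact (hp'.dvd_iff_one_le_factorization hm0).1 (Nat.dvd_of_mem_primeFactors hp)
      · refine (Nat.factorization_lt p hm0).le.trans (le_trans ?_ hqx)
        exact Nat.le_mul_of_pos_left m hPp.pos
    · refine mem_filter.2 ⟨mem_Icc.2 ⟨hPp.one_le, ?_⟩, ⟨hPp, hPy⟩, hmP⟩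
      have hmpos : (0 : ℝ) < m := by exact_mod_cast Nat.pos_of_ne_zero hm0
      refine Nat.le_floor ?_
      rw [le_div_iff₀ hmpos]
      have := (Nat.le_floor_iff hx).1 hqx
      exact_mod_cast this
  choose! P m hqmP hmM hPPs using hpick
  have hsum : ∑ q ∈ goodQk A k w y₀ x, ‖weylSum A q h‖ ≤
      ∑ m ∈ M, ∑ P ∈ Ps m, ‖weylSum A (m * P) h‖ := by
    rw [sum_sigma']
    have hinj : Set.InjOn (fun q => (⟨m q, P q⟩ : (_ : ℕ) × ℕ)) (goodQk A k w y₀ x : Set ℕ) := by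
      intro a ha b hb hab
      simp only [Sigma.mk.injEq, heq_eq_eq] at hab
      rw [hqmP a ha, hqmP b hb, hab.1, hab.2]
    have hcongr : ∀ q ∈ goodQk A k w y₀ x, ‖weylSum A q h‖ = ‖weylSum A (m q * P q) h‖ :=
      fun q hq => by rw [← hqmP q hq]
    rw [sum_congr rfl hcongr, ← sum_image (f := fun y : (_ : ℕ) × ℕ => ‖weylSum A (y.1 * y.2) h‖) hinj]
    refine sum_le_sum_of_subset_of_nonneg (image_subset_iff.2 fun q hq => ?_)
      fun _ _ _ => norm_nonneg _
    exact mem_sigma.2 ⟨hmM q hq, hPPs q hq⟩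
  refine hsum.trans ?_
  -- For fixed m only (tP)⁻¹ modulo the smooth part r varies with P. Since r ≤ w^(k-1), the assumed
  -- bound for primes in progressions applies.
  have hinner : ∀ m ∈ M, ∑ P ∈ Ps m, ‖weylSum A (m * P) h‖ ≤
      B * x * ∏ p ∈ m.primeFactors,
        (localBound A w h p (m.factorization p) / (p : ℝ) ^ m.factorization p) := by
    intro m hm
    obtain ⟨hm0, hmS, hmk, hmV⟩ := hmemM.1 hm
    set r := smoothPart w m
    set t := roughPart w m
    have hrt : r.Coprime t := coprime_smoothPart_roughPart w m
    have hmrt : r * t = m := smoothPart_mul_roughPart w hm0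
    have ht0 : t ≠ 0 := by rintro h0; rw [h0, mul_zero] at hmrt; exact hm0 hmrt.symm
    have hrw : (r : ℝ) ≤ w ^ (k - 1) := smoothPart_le w hw hmk.le
      fun p hp => ((mem_exponents A).1 (hmV p hp)).2.2
    have hcoP : ∀ P ∈ Ps m, r.Coprime P := by
      intro P hP
      obtain ⟨-, ⟨hPp, -⟩, hPm⟩ := mem_filter.1 hP
      exact ((Nat.Prime.coprime_iff_not_dvd hPp).2 fun hd =>
        hPm (hd.trans ⟨t, hmrt.symm⟩)).symm
    have h1 : ∑ P ∈ Ps m, ‖weylSum A (m * P) h‖ ≤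
        ∑ P ∈ Ps m, ‖modSum A r fun i => (((t * P : ℕ) : ZMod r))⁻¹ * (h i : ZMod r)‖ := by
      refine sum_le_sum fun P hP => ?_
      have hP0 : P ≠ 0 := (mem_filter.1 hP).2.1.1.ne_zero
      have := norm_weylSum_mul_le A (mul_ne_zero ht0 hP0) (hrt.mul_right (hcoP P hP)) h
      rwa [← mul_assoc, hmrt] at this
    have h2 := sum_primes_modSum_le A hrt h (K := B * ⌊x / m⌋₊) hcoP fun c => by
      refine le_trans (Nat.cast_le.2 (card_le_card fun P hP => ?_))
        (hB r (smoothPart_ne_zero w m) hrw c ⌊x / m⌋₊)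
      simp only [hPs, mem_filter] at hP ⊢
      exact ⟨hP.1.1, hP.1.2.1, hP.2⟩
    refine h1.trans (h2.trans ?_)
    have hmpos : (0 : ℝ) < m := by exact_mod_cast Nat.pos_of_ne_zero hm0
    have h3 : (⌊x / m⌋₊ : ℝ) ≤ x / m := Nat.floor_le (by positivity)
    have hmprod : (m : ℝ) = ∏ p ∈ m.primeFactors, (p : ℝ) ^ m.factorization p := by
      conv_lhs => rw [← Nat.prod_factorization_pow_eq_self hm0]
      rw [Finsupp.prod, Nat.support_factorization]
      push_cast
      rfl
    rw [prod_div_distrib, ← hmprod]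
    have h4 := unitMean_smoothPart_le A w hm0 h
    calc B * ⌊x / m⌋₊ * unitMean A r h
        ≤ B * (x / m) * ∏ p ∈ m.primeFactors, localBound A w h p (m.factorization p) := by
          refine mul_le_mul ?_ h4 (unitMean_nonneg A r h) (by positivity)
          exact mul_le_mul_of_nonneg_left h3 hB0
      _ = _ := by ring
  refine (sum_le_sum hinner).trans (le_of_eq ?_)
  rw [← mul_sum, sum_integersWith (fun p hp => prime_of_mem_primesUpTo hp) hV
    fun p v => localBound A w h p v / (p : ℝ) ^ v]

/-- Lower bound for the size of `𝒬_k(x)`. -/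
theorem le_card_Qk {k : ℕ} {w x : ℝ} (hk : 1 ≤ k) (hw : 1 ≤ w) (hx : 0 ≤ x) {B : ℝ}
    (hB : ∀ m : ℕ, m ≠ 0 → (m : ℝ) ≤ w ^ (k - 1) →
      B * (x / m) ≤ #((primesQ A (x / m)).filter fun P : ℕ => w < (P : ℝ))) :
    B * x * elemSymm (primesUpTo w) (fun p => ∑ v ∈ exponents A w x p, 1 / (p : ℝ) ^ v) (k - 1) ≤
      #(Qk A k x) := by
  classical
  set M := integersWith (primesUpTo w) (exponents A w x) (k - 1) with hM
  have hw0 : 0 ≤ w := by linarith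
  have hV : ∀ p ∈ primesUpTo w, ∀ v ∈ exponents A w x p, v ≠ 0 := fun p _ v hv => by
    have := ((mem_exponents A).1 hv).1.1; omega
  have hmemM : ∀ {m}, m ∈ M ↔ _ :=
    mem_integersWith (fun p hp => prime_of_mem_primesUpTo hp) hV
  set Ps : ℕ → Finset ℕ := fun m => (primesQ A (x / m)).filter fun P : ℕ => w < (P : ℝ) with hPs
  have hPs' : ∀ m P, P ∈ Ps m → P.Prime ∧ 1 ≤ rho A P ∧ w < P ∧ P ≤ ⌊x / m⌋₊ := by
    intro m P hP
    simp only [hPs, primesQ, mem_filter, mem_Icc] at hP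
    exact ⟨hP.1.2.1, hP.1.2.2, hP.2, hP.1.1.2⟩
  have hcop : ∀ m ∈ M, ∀ m' P, P ∈ Ps m' → P.Coprime m := by
    intro m hm m' P hP
    obtain ⟨hPp, -, hPw, -⟩ := hPs' m' P hP
    refine (Nat.Prime.coprime_iff_not_dvd hPp).2 fun hd => ?_
    obtain ⟨hm0, hmS, -, -⟩ := hmemM.1 hm
    have := ((mem_primesUpTo hw0).1 (hmS (Nat.mem_primeFactors.2 ⟨hPp, hd, hm0⟩))).2
    linarith
  -- The map (m, P) ↦ mP is injective because every prime factor of m is at most w and P exceeds w.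
  have hcard : #(M.sigma Ps) ≤ #(Qk A k x) := by
    refine card_le_card_of_injOn (fun y => y.1 * y.2) ?_ ?_
    · rintro ⟨m, P⟩ hy
      obtain ⟨hm, hP⟩ := mem_sigma.1 (mem_coe.1 hy)
      have hco := hcop m hm m P hP
      obtain ⟨hPp, hPρ, -, hPx⟩ := hPs' m P hP
      obtain ⟨hm0, hmS, hmk, hmV⟩ := hmemM.1 hm
      have hmpos : (0 : ℝ) < m := by exact_mod_cast Nat.pos_of_ne_zero hm0
      refine mem_coe.2 ((mem_Qk A).2 ⟨⟨Nat.mul_pos (Nat.pos_of_ne_zero hm0) hPp.pos, ?_⟩, ?_, ?_⟩)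
      · refine Nat.le_floor ?_
        have := (Nat.le_floor_iff (by positivity)).1 hPx
        rw [le_div_iff₀ hmpos] at this
        push_cast
        linarith
      · rw [rho_mul A hm0 hPp.ne_zero hco.symm]
        refine Nat.one_le_iff_ne_zero.2 (mul_ne_zero ?_ (by omega))
        have := (one_le_rho_iff A hm0).2 fun p hp => ((mem_exponents A).1 (hmV p hp)).2.1
        omega
      · rw [hco.symm.primeFactors_mul, card_union_of_disjoint hco.symm.disjoint_primeFactors,
          hPp.primeFactors, card_singleton, hmk]
        omega
    · rintro ⟨m, P⟩ hy ⟨m', P'⟩ hy' heq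
      obtain ⟨hm, hP⟩ := mem_sigma.1 (mem_coe.1 hy)
      obtain ⟨hm', hP'⟩ := mem_sigma.1 (mem_coe.1 hy')
      simp only at heq hm hP hm' hP'
      have hPp := (hPs' m P hP).1
      have hPp' := (hPs' m' P' hP').1
      have hd : P ∣ P' := (hcop m' hm' m P hP).dvd_of_dvd_mul_left (heq ▸ dvd_mul_left P m)
      have hPP : P = P' := (Nat.prime_dvd_prime_iff_eq hPp hPp').1 hd
      subst hPP
      have : m = m' := Nat.eq_of_mul_eq_mul_right hPp.pos heq
      subst this
      rfl
  rw [card_sigma] at hcard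
  refine le_trans ?_ (Nat.cast_le.2 hcard)
  rw [← sum_integersWith (fun p hp => prime_of_mem_primesUpTo hp) hV fun p v => 1 / (p : ℝ) ^ v,
    mul_sum, Nat.cast_sum]
  refine sum_le_sum fun m hm => ?_
  obtain ⟨hm0, hmS, hmk, hmV⟩ := hmemM.1 hm
  have hmprod : (m : ℝ) = ∏ p ∈ m.primeFactors, (p : ℝ) ^ m.factorization p := by
    conv_lhs => rw [← Nat.prod_factorization_pow_eq_self hm0]
    rw [Finsupp.prod, Nat.support_factorization]
    push_cast
    rfl
  have hmw : (m : ℝ) ≤ w ^ (k - 1) := by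
    rw [hmprod, ← hmk]
    refine (prod_le_prod (g := fun _ => w) (fun _ _ => by positivity) fun p hp => ?_).trans
      (prod_const w).le
    rcases ((mem_exponents A).1 (hmV p hp)).2.2 with h1 | h1
    · rw [h1, pow_one]; exact ((mem_primesUpTo hw0).1 (hmS hp)).2
    · exact h1
  rw [prod_div_distrib, prod_const_one, ← hmprod]
  refine le_trans (le_of_eq ?_) (hB m hm0 hmw)
  ring

end CRTEquidist

/-! ### Moduli without a large simple prime or with a large proper prime power -/

namespace CRTEquidist

open Finset

variable {n : ℕ} (A : (m : ℕ) → Set (Fin n → ZMod m))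

open Classical in
/-- Few integers up to `x` are divisible by the square of an integer exceeding `z`. -/
theorem card_sq_dvd_le {x z : ℝ} (hx : 0 ≤ x) (hz : 1 ≤ z) :
    (#((Icc 1 ⌊x⌋₊).filter fun q : ℕ => ∃ d : ℕ, z < (d : ℝ) ∧ d ^ 2 ∣ q) : ℝ) ≤ 2 * x / z := by
  set N := ⌊x⌋₊
  have hz1 : 1 ≤ ⌊z⌋₊ := Nat.le_floor (by simpa using hz)
  have hsub : ((Icc 1 N).filter fun q : ℕ => ∃ d : ℕ, z < (d : ℝ) ∧ d ^ 2 ∣ q) ⊆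
      (Ioc ⌊z⌋₊ (max ⌊z⌋₊ N)).biUnion fun d => (Ioc 0 N).filter (d ^ 2 ∣ ·) := by
    intro q hq
    obtain ⟨hq1, d, hd, hdq⟩ := mem_filter.1 hq
    rw [mem_Icc] at hq1
    refine mem_biUnion.2 ⟨d, mem_Ioc.2 ⟨?_, le_max_of_le_right ?_⟩,
      mem_filter.2 ⟨mem_Ioc.2 hq1, hdq⟩⟩
    · exact (Nat.floor_lt (by linarith)).2 hd
    · refine le_trans ?_ ((Nat.le_of_dvd hq1.1 hdq).trans hq1.2)
      exact Nat.le_self_pow two_ne_zero d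
  have h1 : (#((Icc 1 N).filter fun q : ℕ => ∃ d : ℕ, z < (d : ℝ) ∧ d ^ 2 ∣ q) : ℝ) ≤
      ∑ d ∈ Ioc ⌊z⌋₊ (max ⌊z⌋₊ N), x * ((d : ℝ) ^ 2)⁻¹ := by
    refine (Nat.cast_le.2 ((card_le_card hsub).trans card_biUnion_le)).trans ?_
    rw [Nat.cast_sum]
    refine sum_le_sum fun d hd => ?_
    rw [Nat.Ioc_filter_dvd_card_eq_div]
    refine Nat.cast_div_le.trans ?_
    push_cast
    rw [← div_eq_mul_inv]
    gcongr
    exact Nat.floor_le hx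
  refine h1.trans ?_
  rw [← mul_sum]
  have h2 := sum_Ioc_inv_sq_le_sub (α := ℝ) (k := ⌊z⌋₊) (by omega) (le_max_left ⌊z⌋₊ N)
  have h3 : (0 : ℝ) ≤ ((max ⌊z⌋₊ N : ℕ) : ℝ)⁻¹ := by positivity
  have h4 : ((⌊z⌋₊ : ℕ) : ℝ)⁻¹ ≤ 2 / z := by
    have h5 := Nat.lt_floor_add_one z
    have h6 : (1 : ℝ) ≤ (⌊z⌋₊ : ℝ) := by exact_mod_cast hz1
    rw [inv_eq_one_div, div_le_div_iff₀ (by linarith) (by linarith)]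
    linarith
  calc x * _ ≤ x * (2 / z) := by
        refine mul_le_mul_of_nonneg_left ?_ hx
        linarith
    _ = _ := by ring

open Classical in
/-- Few elements of `𝒬_k(x)` are not good. -/
theorem card_bad_le {k : ℕ} {z y₀ x : ℝ} (hx : 0 ≤ x) (hz : 1 ≤ z) (hzy : z ^ 3 ≤ y₀) :
    (#(Qk A k x \ goodQk A k (z ^ 3) y₀ x) : ℝ) ≤ 2 * x / z + y₀ ^ k := by
  have hy1 : 1 ≤ y₀ := (one_le_pow₀ hz).trans hzy
  have hsub : Qk A k x \ goodQk A k (z ^ 3) y₀ x ⊆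
      ((Icc 1 ⌊x⌋₊).filter fun q : ℕ => ∃ d : ℕ, z < (d : ℝ) ∧ d ^ 2 ∣ q) ∪ Icc 1 ⌊y₀ ^ k⌋₊ := by
    intro q hq
    rw [mem_sdiff, goodQk, mem_filter] at hq
    obtain ⟨hqQ, hbad⟩ := hq
    have hq' := (mem_Qk A).1 hqQ
    have hq0 : q ≠ 0 := by omega
    -- If no proper prime power exceeds z³, then for a bad q every prime power is at most y₀ and q ≤
    -- y₀^k. Otherwise some p^v > z³ with v ≥ 2, and d = p^⌊v/2⌋ exceeds z because v ≤ 3⌊v/2⌋.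
    by_cases hpow : ∀ p ∈ q.primeFactors,
        q.factorization p = 1 ∨ (p : ℝ) ^ q.factorization p ≤ z ^ 3
    · refine mem_union_right _ (mem_Icc.2 ⟨hq'.1.1, Nat.le_floor ?_⟩)
      have hqprod : (q : ℝ) = ∏ p ∈ q.primeFactors, (p : ℝ) ^ q.factorization p := by
        conv_lhs => rw [← Nat.prod_factorization_pow_eq_self hq0]
        rw [Finsupp.prod, Nat.support_factorization]
        push_cast
        rfl
      rw [hqprod, ← hq'.2.2]
      refine (prod_le_prod (g := fun _ => y₀) (fun _ _ => by positivity) fun p hp => ?_).trans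
        (prod_const y₀).le
      rcases hpow p hp with h | h
      · rw [h, pow_one]
        by_contra hlt
        exact hbad ⟨hqQ, hpow, p, hp, h, (not_le.1 hlt).le⟩
      · exact h.trans hzy
    · push Not at hpow
      obtain ⟨p, hp, hp1, hpz⟩ := hpow
      refine mem_union_left _ (mem_filter.2 ⟨mem_Icc.2 hq'.1, p ^ (q.factorization p / 2), ?_, ?_⟩)
      · have hpp := Nat.prime_of_mem_primeFactors hp
        have hv : 1 ≤ q.factorization p :=
          (hpp.dvd_iff_one_le_factorization hq0).1 (Nat.dvd_of_mem_primeFactors hp)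
        have h3 : (p : ℝ) ^ q.factorization p ≤ ((p ^ (q.factorization p / 2) : ℕ) : ℝ) ^ 3 := by
          push_cast
          rw [← pow_mul]
          exact pow_le_pow_right₀ (by exact_mod_cast hpp.one_le) (by omega)
        exact lt_of_pow_lt_pow_left₀ 3 (by positivity) (hpz.trans_le h3)
      · rw [← pow_mul]
        exact (pow_dvd_pow p (by omega)).trans (Nat.ordProj_dvd q p)
  refine (Nat.cast_le.2 ((card_le_card hsub).trans (card_union_le _ _))).trans ?_
  push_cast
  refine add_le_add (card_sq_dvd_le hx hz) ?_
  rw [Nat.card_Icc, Nat.add_sub_cancel]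
  exact Nat.floor_le (by positivity)

end CRTEquidist

/-! ### Comparison of the elementary symmetric sums with and without savings -/

namespace CRTEquidist

open Finset

variable {n : ℕ} (A : (m : ℕ) → Set (Fin n → ZMod m))

theorem sum_exponents_le (w x : ℝ) {p : ℕ} (hp : p.Prime) :
    ∑ v ∈ exponents A w x p, 1 / (p : ℝ) ^ v ≤ 1 / ((p : ℝ) - 1) := by
  have hp1 : (1 : ℝ) < p := by exact_mod_cast hp.one_lt
  have h1 : ∀ N : ℕ, ∑ v ∈ Icc 1 N, 1 / (p : ℝ) ^ v ≤ 1 / ((p : ℝ) - 1) * (1 - 1 / (p : ℝ) ^ N) := by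
    intro N
    induction N with
    | zero => simp
    | succ N ih =>
      rw [sum_Icc_succ_top (by omega)]
      have : 1 / ((p : ℝ) - 1) * (1 - 1 / (p : ℝ) ^ (N + 1)) =
          1 / ((p : ℝ) - 1) * (1 - 1 / (p : ℝ) ^ N) + 1 / (p : ℝ) ^ (N + 1) := by
        have h2 : (p : ℝ) - 1 ≠ 0 := by linarith
        have h3 : (p : ℝ) ≠ 0 := by linarith
        rw [pow_succ]
        field_simp
        ring
      linarith
  have h2 : ∑ v ∈ exponents A w x p, 1 / (p : ℝ) ^ v ≤ ∑ v ∈ Icc 1 ⌊x⌋₊, 1 / (p : ℝ) ^ v :=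
    sum_le_sum_of_subset_of_nonneg (filter_subset _ _) fun _ _ _ => by positivity
  refine h2.trans ((h1 _).trans (mul_le_of_le_one_right ?_ ?_))
  · exact (one_div_pos.2 (by linarith)).le
  · have : 0 ≤ 1 / (p : ℝ) ^ ⌊x⌋₊ := by positivity
    linarith

theorem deficit_nonneg (p : ℕ) : 0 ≤ 1 - (lam A p : ℝ) / rho A p := by
  rcases Nat.eq_zero_or_pos p with h0 | h0
  · subst h0
    rcases Nat.eq_zero_or_pos (rho A 0) with h1 | h1
    · simp [h1]
    · rw [sub_nonneg, div_le_one (by exact_mod_cast h1), Nat.cast_le]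
      refine csSup_le' ?_
      rintro m ⟨H, -, rfl⟩
      exact Set.ncard_le_ncard Set.inter_subset_right (finite_crtSet A h1)
  · have : NeZero p := ⟨h0.ne'⟩
    rw [sub_nonneg]
    exact div_le_one_of_le₀ (by exact_mod_cast lam_le_rho A p) (by positivity)

theorem deficit_le_one (p : ℕ) : 1 - (lam A p : ℝ) / rho A p ≤ 1 := by
  have : 0 ≤ (lam A p : ℝ) / rho A p := by positivity
  linarith

theorem saving_le_one (h : Fin n → ℤ) (p v : ℕ) : saving A h p v ≤ 1 := by
  rw [saving]
  split_ifs
  · linarith [deficit_nonneg A p]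
  · exact le_rfl

theorem mem_primesQ {y : ℝ} (hy : 0 ≤ y) {p : ℕ} :
    p ∈ primesQ A y ↔ p.Prime ∧ 1 ≤ rho A p ∧ (p : ℝ) ≤ y := by
  rw [primesQ, mem_filter, mem_Icc, Nat.le_floor_iff hy]
  exact ⟨fun h => ⟨h.2.1, h.2.2, h.1.2⟩, fun h => ⟨⟨h.1.one_le, h.2.2⟩, h.1, h.2.1⟩⟩

theorem one_mem_exponents {w x : ℝ} (hx : 1 ≤ x) {p : ℕ} (hp : 1 ≤ rho A p) :
    1 ∈ exponents A w x p :=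
  (mem_exponents A).2 ⟨⟨le_rfl, Nat.le_floor (by simpa using hx)⟩, by rwa [pow_one], Or.inl rfl⟩

open Classical in
/-- The total saving from the primes up to `w` in the upper bound. -/
theorem sum_localBound_le {w x : ℝ} (hw : 1 ≤ w) (hwx : w ≤ x) (h : Fin n → ℤ) :
    ∑ p ∈ primesUpTo x, ∑ v ∈ exponents A w x p, localBound A w h p v / (p : ℝ) ^ v ≤
      ∑ p ∈ primesUpTo w, ∑ v ∈ exponents A w x p, 1 / (p : ℝ) ^ v -
      1 / 2 * ∑ p ∈ (primesQ A w).filter fun p : ℕ => ∃ i, ¬ (p : ℤ) ∣ h i,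
        (1 - (lam A p : ℝ) / rho A p) * (1 / (p : ℝ)) +
      ∑ p ∈ (primesUpTo x).filter fun p : ℕ => ¬ (p : ℝ) ≤ w, 1 / (p : ℝ) := by
  have hx0 : 0 ≤ x := by linarith
  have hw0 : 0 ≤ w := by linarith
  rw [← sum_filter_add_sum_filter_not (primesUpTo x) fun p : ℕ => (p : ℝ) ≤ w]
  refine add_le_add ?_ (sum_le_sum fun p hp => ?_)
  · have e1 : (primesUpTo x).filter (fun p : ℕ => (p : ℝ) ≤ w) = primesUpTo w := by
      ext p
      rw [mem_filter, mem_primesUpTo hx0, mem_primesUpTo hw0]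
      exact ⟨fun h => ⟨h.1.1, h.2⟩, fun h => ⟨⟨h.1, h.2.trans hwx⟩, h.2⟩⟩
    have e2 : (primesQ A w).filter (fun p : ℕ => ∃ i, ¬ (p : ℤ) ∣ h i) =
        (primesUpTo w).filter fun p : ℕ => 1 ≤ rho A p ∧ ∃ i, ¬ (p : ℤ) ∣ h i := by
      ext p
      rw [mem_filter, mem_filter, mem_primesQ A hw0, mem_primesUpTo hw0]
      tauto
    rw [e1, e2, sum_filter, mul_sum, ← sum_sub_distrib]
    refine sum_le_sum fun p hp => ?_
    have hpw := ((mem_primesUpTo hw0).1 hp).2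
    simp only [localBound, if_pos hpw]
    rw [le_sub_iff_add_le, ← le_sub_iff_add_le', ← sum_sub_distrib]
    have hnn : ∀ v ∈ exponents A w x p, 0 ≤ 1 / (p : ℝ) ^ v - saving A h p v / (p : ℝ) ^ v := by
      intro v _
      rw [← sub_div]
      exact div_nonneg (sub_nonneg.2 (saving_le_one A h p v)) (by positivity)
    split_ifs with hc
    · refine le_trans (le_of_eq ?_) (single_le_sum hnn (one_mem_exponents A (hw.trans hwx) hc.1))
      rw [saving, if_pos ⟨rfl, hc.2⟩]
      ring
    · rw [mul_zero]
      exact sum_nonneg hnn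
  · obtain ⟨hpx, hpw⟩ := mem_filter.1 hp
    have hpp := prime_of_mem_primesUpTo hpx
    have hp1 : (1 : ℝ) ≤ p := by exact_mod_cast hpp.one_le
    -- For p > w only the exponent 1 is admissible, since p^v ≥ p > w.
    have hsub : exponents A w x p ⊆ {1} := by
      intro v hv
      obtain ⟨hv1, -, h1 | h1⟩ := (mem_exponents A).1 hv
      · exact mem_singleton.2 h1
      · refine absurd (le_trans ?_ h1) hpw
        exact le_self_pow₀ hp1 (by omega)
    refine (sum_le_sum_of_subset_of_nonneg hsub fun v _ _ => ?_).trans ?_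
    · exact div_nonneg (localBound_nonneg A w h p v) (by positivity)
    · rw [sum_singleton, localBound, if_neg hpw, pow_one]

/-- Comparison of elementary symmetric sums. -/
theorem pow_div_le_exp_mul {a b t U : ℝ} {j : ℕ} (ha : 0 ≤ a) (hb : 0 < b) (hbU : b ≤ U)
    (ht : 0 ≤ t) (hab : a ≤ b - t) :
    a ^ j ≤ b ^ j * Real.exp (-(j * (t / U))) := by
  have h1 : a ≤ b * Real.exp (-(t / U)) := by
    have h2 : 1 - t / U ≤ Real.exp (-(t / U)) := by
      have := Real.add_one_le_exp (-(t / U)); linarith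
    have h3 : b * (t / U) ≤ t := by
      rw [mul_div_assoc', div_le_iff₀ (by linarith)]
      nlinarith
    calc a ≤ b - t := hab
      _ ≤ b * (1 - t / U) := by linarith
      _ ≤ _ := mul_le_mul_of_nonneg_left h2 hb.le
  calc a ^ j ≤ (b * Real.exp (-(t / U))) ^ j := pow_le_pow_left₀ ha h1 j
    _ = _ := by rw [mul_pow, ← Real.exp_nat_mul]; ring_nf

/-- The local sums are at most 1/(p - 1), so any k - 1 primes carry at most 1 + log k, which is the
loss allowed by `le_elemSymm`. -/
theorem pow_div_factorial_le_elemSymm_inv {w x : ℝ} {k : ℕ} {s : ℝ} (hs : 1 + Real.log k ≤ s)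
    (hUs : s ≤ ∑ p ∈ primesUpTo w, ∑ v ∈ exponents A w x p, 1 / (p : ℝ) ^ v) :
    (∑ p ∈ primesUpTo w, ∑ v ∈ exponents A w x p, 1 / (p : ℝ) ^ v - s) ^ (k - 1) /
        (k - 1).factorial ≤
      elemSymm (primesUpTo w) (fun p => ∑ v ∈ exponents A w x p, 1 / (p : ℝ) ^ v) (k - 1) := by
  refine le_elemSymm (fun p _ => sum_nonneg fun v _ => by positivity) (fun T hT hTk => ?_) hUs
  have hTp : ∀ p ∈ T, p.Prime := fun p hp => prime_of_mem_primesUpTo (hT hp)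
  refine (sum_le_sum fun p hp => sum_exponents_le A w x (hTp p hp)).trans ?_
  exact (sum_inv_pred_le hTp (hTk.trans (Nat.sub_le k 1))).trans hs

/-- The elementary symmetric sum with the savings is exponentially smaller than the one without. -/
theorem elemSymm_localBound_le {w x : ℝ} {k : ℕ} (h : Fin n → ℤ)
    {s t U₁ : ℝ} (hs : 1 + Real.log k ≤ s) (hs0 : 0 ≤ s) (ht : 0 ≤ t)
    (hU₁ : ∑ p ∈ primesUpTo w, ∑ v ∈ exponents A w x p, 1 / (p : ℝ) ^ v ≤ U₁)
    (hUs : s < ∑ p ∈ primesUpTo w, ∑ v ∈ exponents A w x p, 1 / (p : ℝ) ^ v)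
    (hloc : ∑ p ∈ primesUpTo x, ∑ v ∈ exponents A w x p, localBound A w h p v / (p : ℝ) ^ v ≤
      ∑ p ∈ primesUpTo w, ∑ v ∈ exponents A w x p, 1 / (p : ℝ) ^ v - s - t) :
    elemSymm (primesUpTo x)
        (fun p => ∑ v ∈ exponents A w x p, localBound A w h p v / (p : ℝ) ^ v) (k - 1) ≤
      elemSymm (primesUpTo w) (fun p => ∑ v ∈ exponents A w x p, 1 / (p : ℝ) ^ v) (k - 1) *
        Real.exp (-((k - 1 : ℕ) * (t / U₁))) := by
  have hnn : ∀ p ∈ primesUpTo x,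
      0 ≤ ∑ v ∈ exponents A w x p, localBound A w h p v / (p : ℝ) ^ v := fun p _ =>
    sum_nonneg fun v _ => div_nonneg (localBound_nonneg A w h p v) (by positivity)
  refine (elemSymm_le hnn (k - 1)).trans (le_trans ?_ (mul_le_mul_of_nonneg_right
    (pow_div_factorial_le_elemSymm_inv A hs hUs.le) (Real.exp_pos _).le))
  rw [div_mul_eq_mul_div]
  gcongr
  exact pow_div_le_exp_mul (sum_nonneg hnn) (by linarith) (by linarith) ht hloc

/-- The primes in T all divide a fixed nonzero entry of size at most 2^k, and a product of #T
distinct primes is at least 2^#T. So only few primes lose their saving. -/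
theorem card_common_primes_le {h : Fin n → ℤ} {H k : ℕ} (hh : h ∈ freqBox n H) (hH : H ≤ 2 ^ k)
    {T : Finset ℕ} (hT : ∀ p ∈ T, p.Prime) (hTh : ∀ p ∈ T, ∀ i, (p : ℤ) ∣ h i) : #T ≤ k := by
  rw [freqBox, mem_erase, Fintype.mem_piFinset] at hh
  obtain ⟨i, hi⟩ := Function.ne_iff.1 hh.1
  have hi0 : (h i).natAbs ≠ 0 := Int.natAbs_ne_zero.2 hi
  have hiH : (h i).natAbs ≤ H := by
    have := mem_Icc.1 (hh.2 i)
    omega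
  have hsub : T ⊆ (h i).natAbs.primeFactors := fun p hp =>
    Nat.mem_primeFactors.2 ⟨hT p hp, Int.natCast_dvd.1 (hTh p hp i), hi0⟩
  have h1 : 2 ^ #T ≤ 2 ^ k := by
    calc 2 ^ #T ≤ 2 ^ #(h i).natAbs.primeFactors :=
          Nat.pow_le_pow_right two_pos (card_le_card hsub)
      _ = ∏ p ∈ (h i).natAbs.primeFactors, 2 := (prod_const 2).symm
      _ ≤ ∏ p ∈ (h i).natAbs.primeFactors, p :=
          prod_le_prod' fun p hp => (Nat.prime_of_mem_primeFactors hp).two_le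
      _ ≤ (h i).natAbs := Nat.le_of_dvd (Nat.pos_of_ne_zero hi0) (Nat.prod_primeFactors_dvd _)
      _ ≤ 2 ^ k := hiH.trans hH
  exact (Nat.pow_le_pow_iff_right one_lt_two).1 h1

end CRTEquidist

/-! ### Bounds for primes with w = exp(L/k³) and y₀ = exp(L/(2k)) -/

namespace CRTEquidist

open Finset

variable {n : ℕ} (A : (m : ℕ) → Set (Fin n → ZMod m))

theorem le_exp_fifth {u : ℝ} (hu : 50 ≤ u) : u ≤ Real.exp (u / 5) := by
  have := Real.quadratic_le_exp_of_nonneg (x := u / 5) (by linarith)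
  nlinarith

theorem mul_le_of_pow_twelve_le {k : ℕ} {L : ℝ} (hk : 400 ≤ k) (hL : (k : ℝ) ^ 12 ≤ L) {j : ℕ}
    (hj : j ≤ 11) : 400 * (k : ℝ) ^ j ≤ L := by
  have hk' : (400 : ℝ) ≤ k := by exact_mod_cast hk
  calc 400 * (k : ℝ) ^ j ≤ k * (k : ℝ) ^ j := by gcongr
    _ = (k : ℝ) ^ (j + 1) := by ring
    _ ≤ (k : ℝ) ^ 12 := pow_le_pow_right₀ (by linarith) (by omega)
    _ ≤ L := hL

/-- In other words w^(k-1) ≤ x^(1/(10k)), a small power of y₀ = x^(1/(2k)); this is the room needed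
by the sieve. -/
theorem exp_pow_pred_le {k : ℕ} {L : ℝ} (hk : 400 ≤ k) (hL : 0 ≤ L) :
    Real.exp (L / (k : ℝ) ^ 3) ^ (k - 1) ≤ Real.exp (L / (10 * k)) := by
  have hk' : (400 : ℝ) ≤ k := by exact_mod_cast hk
  rw [← Real.exp_nat_mul, Real.exp_le_exp, Nat.cast_sub (by omega), Nat.cast_one,
    mul_div_assoc', div_le_div_iff₀ (by positivity) (by positivity)]
  have h1 : ((k : ℝ) - 1) * (10 * k) ≤ (k : ℝ) ^ 3 := by
    have h2 : 10 * (k : ℝ) ^ 2 ≤ k * (k : ℝ) ^ 2 := by gcongr; linarith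
    nlinarith
  calc ((k : ℝ) - 1) * L * (10 * k) = L * (((k : ℝ) - 1) * (10 * k)) := by ring
    _ ≤ L * (k : ℝ) ^ 3 := mul_le_mul_of_nonneg_left h1 hL

/-- Brun–Titchmarsh bound for the largest prime factor, with an admissible range of moduli. -/
theorem card_large_primes_modEq_le {k : ℕ} {L : ℝ} (hk : 400 ≤ k) (hL : (k : ℝ) ^ 12 ≤ L)
    {r : ℕ} (hr : r ≠ 0) (hrw : (r : ℝ) ≤ Real.exp (L / (k : ℝ) ^ 3) ^ (k - 1)) (c N : ℕ) :
    (#((Icc 1 N).filter fun P : ℕ =>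
      (P.Prime ∧ Real.exp (L / (2 * k)) ≤ (P : ℝ)) ∧ P ≡ c [MOD r]) : ℝ) ≤
      81 * k / L * N / r.totient := by
  have hk' : (400 : ℝ) ≤ k := by exact_mod_cast hk
  have hk0 : (0 : ℝ) < k := by linarith
  have hLk : 400 * (k : ℝ) ≤ L := by simpa using mul_le_of_pow_twelve_le hk hL (j := 1) (by norm_num)
  have hL0 : 0 < L := by nlinarith
  have hφ : (0 : ℝ) < r.totient := by exact_mod_cast Nat.totient_pos.2 (Nat.pos_of_ne_zero hr)
  rcases lt_or_ge (N : ℝ) (Real.exp (L / (2 * k))) with hN | hN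
  · rw [filter_eq_empty_iff.2]
    · simp only [card_empty, Nat.cast_zero]
      positivity
    · rintro P hP ⟨⟨-, h1⟩, -⟩
      have : (P : ℝ) ≤ N := by exact_mod_cast (mem_Icc.1 hP).2
      linarith
  set u : ℝ := L / k with hu
  have hu400 : 400 ≤ u := by rwa [hu, le_div_iff₀ hk0]
  have e2 : L / (2 * k) = u / 2 := by rw [hu]; field_simp
  have e10 : L / (10 * k) = u / 10 := by rw [hu]; field_simp
  rw [e2] at hN ⊢
  -- With this sieve level log D ≥ u/40 gives the main term 80k/L. As D⁴ ≤ e^(u/5), u ≤ e^(u/5) and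
  -- φ(r) ≤ e^(u/10), the product D⁴uφ(r) is at most e^(u/2) ≤ N, so D⁴ costs one further k/L.
  set D : ℕ := ⌊Real.exp (u / 20)⌋₊ with hD
  have hDle : (D : ℝ) ≤ Real.exp (u / 20) := Nat.floor_le (Real.exp_pos _).le
  have hDge : Real.exp (u / 40) ≤ D := by
    have h1 : Real.exp (u / 20) < D + 1 := Nat.lt_floor_add_one _
    have h2 : Real.exp (u / 20) = Real.exp (u / 40) * Real.exp (u / 40) := by
      rw [← Real.exp_add]; ring_nf
    have h3 := Real.add_one_le_exp (u / 40)
    nlinarith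
  have hD2 : 2 ≤ D := by
    have h3 := Real.add_one_le_exp (u / 40)
    have : (2 : ℝ) ≤ D := by linarith
    exact_mod_cast this
  have hlogD : u / 40 ≤ Real.log D := by
    rw [Real.le_log_iff_exp_le (by positivity)]; exact hDge
  have hsub : (Icc 1 N).filter (fun P : ℕ =>
      (P.Prime ∧ Real.exp (u / 2) ≤ (P : ℝ)) ∧ P ≡ c [MOD r]) ⊆
      (Ioc D N).filter fun p : ℕ => p.Prime ∧ p ≡ c [MOD r] := by
    intro P hP
    obtain ⟨h1, ⟨h2, h3⟩, h4⟩ := mem_filter.1 hP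
    refine mem_filter.2 ⟨mem_Ioc.2 ⟨?_, (mem_Icc.1 h1).2⟩, h2, h4⟩
    have : (D : ℝ) < P := hDle.trans_lt ((Real.exp_lt_exp.2 (by linarith)).trans_le h3)
    exact_mod_cast this
  refine ((Nat.cast_le.2 (card_le_card hsub)).trans
    (card_primes_modEq_le_totient (Nat.pos_of_ne_zero hr) hD2 N c)).trans ?_
  have t1 : 2 * (N : ℝ) / (r.totient * Real.log D) ≤ 80 * k / L * N / r.totient := by
    have : 80 * k / L * N / r.totient = 2 * (N : ℝ) / (r.totient * (u / 40)) := by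
      rw [hu]; field_simp; ring
    rw [this]
    gcongr
  have t2 : (D : ℝ) ^ 4 ≤ k / L * N / r.totient := by
    have hφr : (r.totient : ℝ) ≤ Real.exp (u / 10) := by
      rw [← e10]
      exact (Nat.cast_le.2 (Nat.totient_le r)).trans (hrw.trans (exp_pow_pred_le hk hL0.le))
    have : k / L * N / r.totient = N / (u * r.totient) := by
      rw [hu]; field_simp
    rw [this, le_div_iff₀ (by positivity)]
    calc (D : ℝ) ^ 4 * (u * r.totient)
        ≤ Real.exp (u / 20) ^ 4 * (Real.exp (u / 5) * Real.exp (u / 10)) := by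
          gcongr
          exact le_exp_fifth (by linarith)
      _ = Real.exp (u / 2) := by
          rw [← Real.exp_nat_mul, ← Real.exp_add, ← Real.exp_add]
          congr 1
          push_cast
          ring
      _ ≤ N := hN
  calc _ ≤ 80 * k / L * N / r.totient + k / L * N / r.totient := add_le_add t1 t2
    _ = _ := by ring

theorem ManyPrimes.mul_le_card_mul_log {α x₀ y : ℝ} (h : ManyPrimes A α x₀) (hx₀ : 2 ≤ x₀)
    (hy : x₀ ≤ y) : α * y ≤ #(primesQ A y) * Real.log y := by
  refine (h y hy).trans ?_
  rw [← nsmul_eq_mul]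
  refine sum_le_card_nsmul _ _ _ fun p hp => ?_
  obtain ⟨h1, -, h2⟩ := (mem_primesQ A (by linarith)).1 hp
  exact Real.log_le_log (by exact_mod_cast h1.pos) h2

/-- Compare the assumption at x₀ with Chebyshev's bound for θ(x₀). This upper bound for α lets a
lower bound for αδ log L become one for δ log L, and lets 1/α multiply every error term. -/
theorem ManyPrimes.le_log_four {α x₀ : ℝ} (h : ManyPrimes A α x₀) (hx₀ : 2 ≤ x₀) :
    α ≤ Real.log 4 := by
  have h1 : ∑ p ∈ primesQ A x₀, Real.log p ≤ Chebyshev.theta x₀ := by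
    rw [Chebyshev.theta_eq_sum_Icc]
    refine sum_le_sum_of_subset_of_nonneg (fun p hp => ?_) fun p _ _ => Real.log_natCast_nonneg p
    rw [primesQ, mem_filter, mem_Icc] at hp
    exact mem_filter.2 ⟨mem_Icc.2 ⟨Nat.zero_le _, hp.1.2⟩, hp.2.1⟩
  have h2 := (h x₀ le_rfl).trans (h1.trans (Chebyshev.theta_le_log4_mul_x (by linarith)))
  exact le_of_mul_le_mul_right h2 (by linarith)

/-- Lower bound for the number of choices of the largest prime factor. -/
theorem ManyPrimes.le_card_large_primes {α x₀ : ℝ} (h : ManyPrimes A α x₀) (hx₀ : 2 ≤ x₀)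
    (hα : 0 < α)
    {k : ℕ} {L : ℝ} (hk : 400 ≤ k) (hL : (k : ℝ) ^ 12 ≤ L) (hLx₀ : x₀ ≤ Real.exp (L / 2))
    (hLα : 2 * L ≤ α * Real.exp (L / 4)) {m : ℕ} (hm : m ≠ 0)
    (hmw : (m : ℝ) ≤ Real.exp (L / (k : ℝ) ^ 3) ^ (k - 1)) :
    α / (2 * L) * (Real.exp L / m) ≤
      #((primesQ A (Real.exp L / m)).filter fun P : ℕ => Real.exp (L / (k : ℝ) ^ 3) < (P : ℝ)) := by
  classical
  have hk' : (400 : ℝ) ≤ k := by exact_mod_cast hk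
  have hk0 : (0 : ℝ) < k := by linarith
  have hLk : 400 * (k : ℝ) ≤ L := by simpa using mul_le_of_pow_twelve_le hk hL (j := 1) (by norm_num)
  have hL0 : 0 < L := by nlinarith
  set w := Real.exp (L / (k : ℝ) ^ 3) with hw
  set Y := Real.exp L / m with hY
  have hm0 : (0 : ℝ) < m := by positivity
  have hm1 : (1 : ℝ) ≤ m := by exact_mod_cast Nat.one_le_iff_ne_zero.2 hm
  have hmL : (m : ℝ) ≤ Real.exp (L / 2) := by
    refine hmw.trans ((exp_pow_pred_le hk hL0.le).trans (Real.exp_le_exp.2 ?_))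
    gcongr
    linarith
  have hYL : Real.exp (L / 2) ≤ Y := by
    rw [hY, le_div_iff₀ hm0]
    calc Real.exp (L / 2) * m ≤ Real.exp (L / 2) * Real.exp (L / 2) := by gcongr
      _ = Real.exp L := by rw [← Real.exp_add]; ring_nf
  have hY0 : 0 < Y := by positivity
  have hlogY : Real.log Y ≤ L := by
    rw [Real.log_le_iff_le_exp hY0]
    exact div_le_self (Real.exp_pos _).le hm1
  have h1 : α * Y ≤ #(primesQ A Y) * L :=
    (h.mul_le_card_mul_log A hx₀ (hLx₀.trans hYL)).trans
      (mul_le_mul_of_nonneg_left hlogY (Nat.cast_nonneg _))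
  have hw0 : (0 : ℝ) ≤ w := (Real.exp_pos _).le
  have h2 : (#((primesQ A Y).filter fun P : ℕ => ¬ w < (P : ℝ)) : ℝ) ≤ w := by
    have hsub : (primesQ A Y).filter (fun P : ℕ => ¬ w < (P : ℝ)) ⊆ Icc 1 ⌊w⌋₊ := fun P hP => by
      obtain ⟨h3, h4⟩ := mem_filter.1 hP
      exact mem_Icc.2 ⟨((mem_primesQ A hY0.le).1 h3).1.one_le, Nat.le_floor (not_lt.1 h4)⟩
    refine (Nat.cast_le.2 (card_le_card hsub)).trans ?_
    rw [Nat.card_Icc, Nat.add_sub_cancel]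
    exact Nat.floor_le hw0
  have h3 : (#((primesQ A Y).filter fun P : ℕ => w < (P : ℝ)) : ℝ) +
      #((primesQ A Y).filter fun P : ℕ => ¬ w < (P : ℝ)) = #(primesQ A Y) := by
    exact_mod_cast card_filter_add_card_filter_not (s := primesQ A Y) fun P : ℕ => w < (P : ℝ)
  -- Discarding the at most w primes up to w thus costs at most half of the αY/L available.
  have h4 : 2 * L * w ≤ α * Y := by
    have hwL : w ≤ Real.exp (L / 4) := by
      rw [hw, Real.exp_le_exp]
      gcongr
      nlinarith [sq_nonneg ((k : ℝ))]
    calc 2 * L * w ≤ α * Real.exp (L / 4) * Real.exp (L / 4) := by gcongr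
      _ = α * Real.exp (L / 2) := by rw [mul_assoc, ← Real.exp_add]; ring_nf
      _ ≤ α * Y := by gcongr
  rw [div_mul_eq_mul_div, div_le_iff₀ (by positivity)]
  nlinarith

/-- Mertens' upper bound for the primes between `w = exp (L / k³)` and `exp L`. -/
theorem sum_large_primes_inv_le {k : ℕ} {L : ℝ} (hk : 400 ≤ k) (hlog : 6 ≤ Real.log k)
    (hL : (k : ℝ) ^ 12 ≤ L) :
    ∑ p ∈ (primesUpTo (Real.exp L)).filter
        fun p : ℕ => ¬ (p : ℝ) ≤ Real.exp (L / (k : ℝ) ^ 3), 1 / (p : ℝ) ≤ 5 * Real.log k := by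
  have hk' : (400 : ℝ) ≤ k := by exact_mod_cast hk
  have hk0 : (0 : ℝ) < k := by linarith
  have hLk : 400 * (k : ℝ) ^ 3 ≤ L := mul_le_of_pow_twelve_le hk hL (by norm_num)
  have hL0 : 0 < L := lt_of_lt_of_le (by positivity) hLk
  set u := L / (k : ℝ) ^ 3 with hu
  have hu400 : 400 ≤ u := by rwa [hu, le_div_iff₀ (by positivity)]
  have huL : u ≤ L := div_le_self hL0.le (one_le_pow₀ (by linarith))
  set a := ⌊Real.exp u⌋₊ with ha
  have hage : Real.exp (u / 2) ≤ a := by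
    have h1 : Real.exp u < a + 1 := Nat.lt_floor_add_one _
    have h2 : Real.exp u = Real.exp (u / 2) * Real.exp (u / 2) := by
      rw [← Real.exp_add]; ring_nf
    have h3 := Real.add_one_le_exp (u / 2)
    nlinarith
  have ha2 : 2 ≤ a := by
    have h3 := Real.add_one_le_exp (u / 2)
    have : (2 : ℝ) ≤ a := by linarith
    exact_mod_cast this
  have hloga : u / 2 ≤ Real.log a := by
    rw [Real.le_log_iff_exp_le (by positivity)]; exact hage
  set N := ⌊Real.exp L⌋₊ with hN
  have haN : a ≤ N := Nat.floor_le_floor (Real.exp_le_exp.2 huL)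
  have hlogN : Real.log N ≤ L := by
    rw [Real.log_le_iff_le_exp (by exact_mod_cast (by omega : 0 < N))]
    exact Nat.floor_le (Real.exp_pos _).le
  have hlogN0 : 0 < Real.log N :=
    lt_of_lt_of_le (by linarith) (hloga.trans (Real.log_le_log (by positivity) (by exact_mod_cast haN)))
  have hsub : (primesUpTo (Real.exp L)).filter (fun p : ℕ => ¬ (p : ℝ) ≤ Real.exp u) ⊆
      (Ioc a N).filter Nat.Prime := fun p hp => by
    obtain ⟨h1, h2⟩ := mem_filter.1 hp
    obtain ⟨h3, h4⟩ := (mem_primesUpTo (Real.exp_pos _).le).1 h1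
    exact mem_filter.2 ⟨mem_Ioc.2 ⟨Nat.floor_lt (Real.exp_pos _).le |>.2 (not_le.1 h2),
      Nat.le_floor h4⟩, h3⟩
  refine (sum_le_sum_of_subset_of_nonneg hsub fun p _ _ => by positivity).trans ?_
  refine (sum_prime_inv_Ioc_le ha2 haN).trans ?_
  have h1 : Real.log (Real.log N) ≤ Real.log L := Real.log_le_log hlogN0 hlogN
  -- As log a ≥ L/(2k³), the difference of the iterated logarithms is at most 3 log k + log 2. The
  -- final constant 5 exceeds 3 log 4 by enough to absorb the bounded terms once log k ≥ 6.
  have h2 : Real.log L - 3 * Real.log k - Real.log 2 ≤ Real.log (Real.log a) := by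
    refine le_trans (le_of_eq ?_) (Real.log_le_log (by positivity) hloga)
    rw [hu, Real.log_div (by positivity) two_ne_zero, Real.log_div hL0.ne' (by positivity),
      Real.log_pow]
    push_cast
    ring
  have h3 : 1 / Real.log a ≤ 1 / 200 := one_div_le_one_div_of_le (by norm_num) (by linarith)
  have h4 : Real.log 4 = 2 * Real.log 2 := by
    rw [show (4 : ℝ) = 2 ^ 2 by norm_num, Real.log_pow]; norm_num
  have h5 := Real.log_two_lt_d9
  have h6 := Real.log_two_gt_d9
  calc Real.log 4 * (Real.log (Real.log N) - Real.log (Real.log a) + 1 / Real.log a)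
      ≤ Real.log 4 * (3 * Real.log k + 1) :=
        mul_le_mul_of_nonneg_left (by linarith) (by linarith)
    _ ≤ 5 * Real.log k := by rw [h4]; nlinarith

/-- Mertens' upper bound for the sum of `1 / (p - 1)`. -/
theorem sum_primesUpTo_inv_pred_le {w L : ℝ} (hL : 100 ≤ Real.log L) (hw : 2 ≤ w)
    (hwL : w ≤ Real.exp L) :
    ∑ p ∈ primesUpTo w, 1 / ((p : ℝ) - 1) ≤ 2.2 * Real.log L := by
  have hw0 : 0 ≤ w := by linarith
  set N := ⌊w⌋₊ with hN
  have hN2 : 2 ≤ N := Nat.le_floor (by exact_mod_cast hw)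
  -- The prime 2 is set apart because 1/(p - 1) ≤ (3/2)/p needs p ≥ 3. The constant 2.2 leaves room
  -- above (3/2) log 4 for the bounded terms when log L ≥ 100.
  have hsub : primesUpTo w ⊆ insert 2 ((Ioc 2 N).filter Nat.Prime) := fun p hp => by
    obtain ⟨h1, h2⟩ := (mem_primesUpTo hw0).1 hp
    have h3 : p ≤ N := Nat.le_floor h2
    rcases h1.two_le.eq_or_lt with h4 | h4
    · simp [← h4]
    · exact mem_insert_of_mem (mem_filter.2 ⟨mem_Ioc.2 ⟨h4, h3⟩, h1⟩)
  have hnn : ∀ p ∈ insert 2 ((Ioc 2 N).filter Nat.Prime), 0 ≤ 1 / ((p : ℝ) - 1) := by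
    intro p hp
    have : 2 ≤ p := by
      rcases mem_insert.1 hp with h | h
      · omega
      · have := (mem_Ioc.1 (mem_filter.1 h).1).1
        omega
    have : (2 : ℝ) ≤ p := by exact_mod_cast this
    exact one_div_nonneg.2 (by linarith)
  refine (sum_le_sum_of_subset_of_nonneg hsub fun p hp _ => hnn p hp).trans ?_
  rw [sum_insert (by simp)]
  have h1 : ∑ p ∈ (Ioc 2 N).filter Nat.Prime, 1 / ((p : ℝ) - 1) ≤
      3 / 2 * ∑ p ∈ (Ioc 2 N).filter Nat.Prime, 1 / (p : ℝ) := by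
    rw [mul_sum]
    refine sum_le_sum fun p hp => ?_
    have h2 : 3 ≤ p := (mem_Ioc.1 (mem_filter.1 hp).1).1
    have h3 : (3 : ℝ) ≤ p := by exact_mod_cast h2
    rw [div_mul_div_comm, div_le_div_iff₀ (by linarith) (by linarith)]
    linarith
  have h2 := sum_prime_inv_Ioc_le le_rfl hN2
  have hlogN0 : 0 < Real.log N := Real.log_pos (by exact_mod_cast hN2)
  have hlogN : Real.log N ≤ L := by
    rw [Real.log_le_iff_le_exp (by positivity)]
    exact (Nat.floor_le hw0).trans hwL
  have h3 : Real.log (Real.log N) ≤ Real.log L := Real.log_le_log hlogN0 hlogN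
  have h4 : Real.log 4 = 2 * Real.log 2 := by
    rw [show (4 : ℝ) = 2 ^ 2 by norm_num, Real.log_pow]; norm_num
  have h5 := Real.log_two_lt_d9
  have h6 := Real.log_two_gt_d9
  have h7 : 1 / Real.log 2 ≤ 2 := by
    rw [div_le_iff₀ (by linarith)]; linarith
  have h8 : -1 ≤ Real.log (Real.log 2) := by
    have := Real.one_sub_inv_le_log_of_pos (x := Real.log 2) (by linarith)
    rw [← one_div] at this
    linarith
  have h9 : ∑ p ∈ (Ioc 2 N).filter Nat.Prime, 1 / (p : ℝ) ≤ Real.log 4 * (Real.log L + 3) := by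
    refine h2.trans ?_
    push_cast
    exact mul_le_mul_of_nonneg_left (by linarith) (by linarith)
  norm_num at h1 h9 ⊢
  nlinarith

end CRTEquidist

/-! ### Averages of Weyl sums over the moduli -/

namespace CRTEquidist

open Finset

variable {n : ℕ} (A : (m : ℕ) → Set (Fin n → ZMod m))

theorem two_le_exp_div {k : ℕ} {L : ℝ} (hk : 400 ≤ k) (hL : (k : ℝ) ^ 12 ≤ L) :
    2 ≤ Real.exp (L / (k : ℝ) ^ 3) := by
  have hk' : (400 : ℝ) ≤ k := by exact_mod_cast hk
  have h1 : 400 ≤ L / (k : ℝ) ^ 3 := by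
    rw [le_div_iff₀ (by positivity)]
    exact mul_le_of_pow_twelve_le hk hL (by norm_num)
  linarith [Real.add_one_le_exp (L / (k : ℝ) ^ 3)]

theorem exp_div_le_exp {k : ℕ} {L : ℝ} (hk : 400 ≤ k) (hL : (k : ℝ) ^ 12 ≤ L) :
    Real.exp (L / (k : ℝ) ^ 3) ≤ Real.exp L := by
  have hk' : (400 : ℝ) ≤ k := by exact_mod_cast hk
  have hL0 : 0 ≤ L := le_trans (by positivity) hL
  exact Real.exp_le_exp.2 (div_le_self hL0 (one_le_pow₀ (by linarith)))

theorem sum_inv_pow_exponents_le {k : ℕ} {L : ℝ} (hk : 400 ≤ k) (hL : (k : ℝ) ^ 12 ≤ L)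
    (hℓ : 100 ≤ Real.log L) :
    ∑ p ∈ primesUpTo (Real.exp (L / (k : ℝ) ^ 3)),
      ∑ v ∈ exponents A (Real.exp (L / (k : ℝ) ^ 3)) (Real.exp L) p, 1 / (p : ℝ) ^ v ≤
        2.2 * Real.log L :=
  (sum_le_sum fun _ hp => sum_exponents_le A _ _ (prime_of_mem_primesUpTo hp)).trans
    (sum_primesUpTo_inv_pred_le hℓ (two_le_exp_div hk hL) (exp_div_le_exp hk hL))

/-- The small primes carry almost all of the total deficit. -/
theorem le_sum_deficit_small {k : ℕ} {L d : ℝ} (hk : 400 ≤ k) (hlog : 6 ≤ Real.log k)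
    (hL : (k : ℝ) ^ 12 ≤ L)
    (hd : d ≤ ∑ p ∈ primesQ A (Real.exp L), (1 - (lam A p : ℝ) / rho A p) * (1 / (p : ℝ))) :
    d - 5 * Real.log k ≤ ∑ p ∈ primesQ A (Real.exp (L / (k : ℝ) ^ 3)),
      (1 - (lam A p : ℝ) / rho A p) * (1 / (p : ℝ)) := by
  have hV := sum_large_primes_inv_le hk hlog hL
  have hwx := exp_div_le_exp hk hL
  have hw0 := (Real.exp_pos (L / (k : ℝ) ^ 3)).le
  have hx0 := (Real.exp_pos L).le
  rw [← sum_filter_add_sum_filter_not (primesQ A (Real.exp L))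
    fun p : ℕ => (p : ℝ) ≤ Real.exp (L / (k : ℝ) ^ 3)] at hd
  have e1 : (primesQ A (Real.exp L)).filter (fun p : ℕ => (p : ℝ) ≤ Real.exp (L / (k : ℝ) ^ 3)) =
      primesQ A (Real.exp (L / (k : ℝ) ^ 3)) := by
    ext p
    rw [mem_filter, mem_primesQ A hx0, mem_primesQ A hw0]
    exact ⟨fun h => ⟨h.1.1, h.1.2.1, h.2⟩, fun h => ⟨⟨h.1, h.2.1, h.2.2.trans hwx⟩, h.2.2⟩⟩
  have e2 : ∑ p ∈ (primesQ A (Real.exp L)).filter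
      (fun p : ℕ => ¬ (p : ℝ) ≤ Real.exp (L / (k : ℝ) ^ 3)),
      (1 - (lam A p : ℝ) / rho A p) * (1 / (p : ℝ)) ≤
      ∑ p ∈ (primesUpTo (Real.exp L)).filter
        fun p : ℕ => ¬ (p : ℝ) ≤ Real.exp (L / (k : ℝ) ^ 3), 1 / (p : ℝ) := by
    refine (sum_le_sum fun p _ => mul_le_of_le_one_left (by positivity)
      (deficit_le_one A p)).trans (sum_le_sum_of_subset_of_nonneg (fun p hp => ?_)
        fun p _ _ => by positivity)
    rw [mem_filter, mem_primesQ A hx0] at hp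
    exact mem_filter.2 ⟨(mem_primesUpTo hx0).2 ⟨hp.1.1, hp.1.2.2⟩, hp.2⟩
  rw [e1] at hd
  linarith

/-- Each deficit is at most 1 and the exponent 1 is admissible when ρ(p) ≥ 1. Together with
`le_sum_deficit_small` this makes the total of the local sums much larger than the loss s, so that
the lower bound for the symmetric sum is not vacuous. -/
theorem sum_deficit_le_sum_inv_pow {k : ℕ} {L : ℝ} (hL : 0 ≤ L) :
    ∑ p ∈ primesQ A (Real.exp (L / (k : ℝ) ^ 3)),
      (1 - (lam A p : ℝ) / rho A p) * (1 / (p : ℝ)) ≤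
    ∑ p ∈ primesUpTo (Real.exp (L / (k : ℝ) ^ 3)),
      ∑ v ∈ exponents A (Real.exp (L / (k : ℝ) ^ 3)) (Real.exp L) p, 1 / (p : ℝ) ^ v := by
  have hw0 := (Real.exp_pos (L / (k : ℝ) ^ 3)).le
  refine (sum_le_sum (g := fun p => ∑ v ∈ exponents A (Real.exp (L / (k : ℝ) ^ 3)) (Real.exp L) p,
    1 / (p : ℝ) ^ v) fun p hp => ?_).trans (sum_le_sum_of_subset_of_nonneg (fun p hp => ?_)
      fun p _ _ => sum_nonneg fun v _ => by positivity)
  · obtain ⟨-, h1, -⟩ := (mem_primesQ A hw0).1 hp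
    refine (mul_le_of_le_one_left (by positivity) (deficit_le_one A p)).trans ?_
    refine le_trans (by rw [pow_one]) (single_le_sum
      (f := fun v => 1 / (p : ℝ) ^ v) (fun v _ => by positivity)
      (one_mem_exponents A (Real.one_le_exp hL) h1))
  · obtain ⟨h1, -, h2⟩ := (mem_primesQ A hw0).1 hp
    exact (mem_primesUpTo hw0).2 ⟨h1, h2⟩

open Classical in
-- The savings are at least half of d - 5 log k - (1 + log k), the last bracket paying for primes
-- dividing h; the primes above w add back at most 5 log k. Since d ≥ 600 log k, the margin 0.02 d
-- covers these losses and the reserve 1.2 log k for s.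
theorem sum_localBound_exp_le {k : ℕ} {L d : ℝ} (hk : 400 ≤ k) (hlog : 6 ≤ Real.log k)
    (hL : (k : ℝ) ^ 12 ≤ L)
    (hd : d ≤ ∑ p ∈ primesQ A (Real.exp L), (1 - (lam A p : ℝ) / rho A p) * (1 / (p : ℝ)))
    (hdk : 600 * Real.log k ≤ d) {H : ℕ} (hH : H ≤ 2 ^ k) {h : Fin n → ℤ} (hh : h ∈ freqBox n H) :
    ∑ p ∈ primesUpTo (Real.exp L),
      ∑ v ∈ exponents A (Real.exp (L / (k : ℝ) ^ 3)) (Real.exp L) p,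
        localBound A (Real.exp (L / (k : ℝ) ^ 3)) h p v / (p : ℝ) ^ v ≤
    ∑ p ∈ primesUpTo (Real.exp (L / (k : ℝ) ^ 3)),
      ∑ v ∈ exponents A (Real.exp (L / (k : ℝ) ^ 3)) (Real.exp L) p, 1 / (p : ℝ) ^ v -
      1.2 * Real.log k - 0.48 * d := by
  have hV := sum_large_primes_inv_le hk hlog hL
  have hwx := exp_div_le_exp hk hL
  have hw0 := (Real.exp_pos (L / (k : ℝ) ^ 3)).le
  have h1 := sum_localBound_le A ((by norm_num : (1 : ℝ) ≤ 2).trans (two_le_exp_div hk hL)) hwx h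
  have h2 := le_sum_deficit_small A hk hlog hL hd
  rw [← sum_filter_add_sum_filter_not (primesQ A (Real.exp (L / (k : ℝ) ^ 3)))
    fun p : ℕ => ∃ i, ¬ (p : ℤ) ∣ h i] at h2
  have h3 : ∑ p ∈ (primesQ A (Real.exp (L / (k : ℝ) ^ 3))).filter
      (fun p : ℕ => ¬ ∃ i, ¬ (p : ℤ) ∣ h i), (1 - (lam A p : ℝ) / rho A p) * (1 / (p : ℝ)) ≤
      1 + Real.log k := by
    have hT : ∀ p ∈ (primesQ A (Real.exp (L / (k : ℝ) ^ 3))).filter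
        (fun p : ℕ => ¬ ∃ i, ¬ (p : ℤ) ∣ h i), p.Prime := fun p hp =>
      ((mem_primesQ A hw0).1 (mem_filter.1 hp).1).1
    refine (sum_le_sum fun p _ => mul_le_of_le_one_left (by positivity)
      (deficit_le_one A p)).trans (sum_inv_le_one_add_log (fun p hp => (hT p hp).one_le)
        (card_common_primes_le hh hH hT fun p hp i => ?_))
    by_contra hi
    exact (mem_filter.1 hp).2 ⟨i, hi⟩
  linarith

/-- The average over good `q` of the Weyl sum of a nonzero frequency. -/
theorem ManyPrimes.sum_goodQk_weylSum_le {α x₀ : ℝ} (hA : ManyPrimes A α x₀) (hx₀ : 2 ≤ x₀)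
    (hα : 0 < α) {k : ℕ} {L δ : ℝ} (hk : 400 ≤ k) (hlog : 6 ≤ Real.log k) (hL : (k : ℝ) ^ 12 ≤ L)
    (hLx₀ : x₀ ≤ Real.exp (L / 2)) (hLα : 2 * L ≤ α * Real.exp (L / 4))
    (hδ0 : 0 ≤ δ) (hℓ : 100 ≤ Real.log L) (hδL : 600 * Real.log k ≤ δ * Real.log L)
    (hd : δ * Real.log L ≤
      ∑ p ∈ primesQ A (Real.exp L), (1 - (lam A p : ℝ) / rho A p) * (1 / (p : ℝ)))
    {H : ℕ} (hH : H ≤ 2 ^ k) {h : Fin n → ℤ} (hh : h ∈ freqBox n H) :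
    ∑ q ∈ goodQk A k (Real.exp (L / (k : ℝ) ^ 3)) (Real.exp (L / (2 * k))) (Real.exp L),
      ‖weylSum A q h‖ ≤
        162 * k / α * Real.exp (-(δ * k / 5)) * #(Qk A k (Real.exp L)) := by
  classical
  have hk' : (400 : ℝ) ≤ k := by exact_mod_cast hk
  have hk0 : (0 : ℝ) < k := by linarith
  have hL0 : 0 < L := lt_of_lt_of_le (by positivity) hL
  have hw : 1 ≤ Real.exp (L / (k : ℝ) ^ 3) := (by norm_num : (1 : ℝ) ≤ 2).trans (two_le_exp_div hk hL)
  have hx := (Real.exp_pos L).le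
  have h1 := sum_goodQk_le A (k := k) (by omega) hw hx
    (fun r hr hrw c N => card_large_primes_modEq_le hk hL hr hrw c N) h
  have h2 := le_card_Qk A (k := k) (by omega) hw hx
    (fun m hm hmw => hA.le_card_large_primes A hx₀ hα hk hL hLx₀ hLα hm hmw)
  have hU := (le_sum_deficit_small A hk hlog hL hd).trans
    (sum_deficit_le_sum_inv_pow A (k := k) hL0.le)
  have h3 := elemSymm_localBound_le A (k := k) h (s := 1.2 * Real.log k)
    (t := 0.48 * (δ * Real.log L)) (by linarith) (by linarith) (by linarith)
    (sum_inv_pow_exponents_le A hk hL hℓ) (by linarith)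
    (sum_localBound_exp_le A hk hlog hL hd hδL hH hh)
  -- Here 0.48/2.2 > 1/5, with enough room to replace k - 1 by k.
  have h4 : Real.exp (-((k - 1 : ℕ) * (0.48 * (δ * Real.log L) / (2.2 * Real.log L)))) ≤
      Real.exp (-(δ * k / 5)) := by
    rw [Real.exp_le_exp, neg_le_neg_iff, Nat.cast_sub (by omega), Nat.cast_one]
    have : 0.48 * (δ * Real.log L) / (2.2 * Real.log L) = 0.48 / 2.2 * δ := by
      field_simp
    rw [this]
    nlinarith
  set E := elemSymm (primesUpTo (Real.exp (L / (k : ℝ) ^ 3))) (fun p =>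
    ∑ v ∈ exponents A (Real.exp (L / (k : ℝ) ^ 3)) (Real.exp L) p, 1 / (p : ℝ) ^ v) (k - 1) with hE
  have hE0 : 0 ≤ E := elemSymm_nonneg (fun p _ => sum_nonneg fun v _ => by positivity) _
  refine h1.trans ?_
  calc _ ≤ 81 * k / L * Real.exp L * (E * Real.exp (-(δ * k / 5))) := by
        gcongr
        exact h3.trans (mul_le_mul_of_nonneg_left h4 hE0)
    _ = 162 * k / α * Real.exp (-(δ * k / 5)) * (α / (2 * L) * Real.exp L * E) := by
        field_simp
        ring
    _ ≤ _ := by gcongr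

/-- Lower bound for `|𝒬_k(x)|`. -/
theorem ManyPrimes.exp_le_card_Qk {α x₀ : ℝ} (hA : ManyPrimes A α x₀) (hx₀ : 2 ≤ x₀)
    (hα : 0 < α) {k : ℕ} {L d : ℝ} (hk : 400 ≤ k) (hlog : 6 ≤ Real.log k) (hL : (k : ℝ) ^ 12 ≤ L)
    (hLx₀ : x₀ ≤ Real.exp (L / 2)) (hLα : 2 * L ≤ α * Real.exp (L / 4))
    (hdk : 600 * Real.log k ≤ d)
    (hd : d ≤ ∑ p ∈ primesQ A (Real.exp L), (1 - (lam A p : ℝ) / rho A p) * (1 / (p : ℝ))) :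
    Real.exp L ≤ 2 * L / α * Real.exp ((k : ℝ) ^ 2) * #(Qk A k (Real.exp L)) := by
  classical
  have hk' : (400 : ℝ) ≤ k := by exact_mod_cast hk
  have hk0 : (0 : ℝ) < k := by linarith
  have hL0 : 0 < L := lt_of_lt_of_le (by positivity) hL
  have hw : 1 ≤ Real.exp (L / (k : ℝ) ^ 3) := (by norm_num : (1 : ℝ) ≤ 2).trans (two_le_exp_div hk hL)
  have hx := (Real.exp_pos L).le
  have h2 := le_card_Qk A (k := k) (by omega) hw hx
    (fun m hm hmw => hA.le_card_large_primes A hx₀ hα hk hL hLx₀ hLα hm hmw)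
  have hU := (le_sum_deficit_small A hk hlog hL hd).trans
    (sum_deficit_le_sum_inv_pow A (k := k) hL0.le)
  have h3 := pow_div_factorial_le_elemSymm_inv A (w := Real.exp (L / (k : ℝ) ^ 3))
    (x := Real.exp L) (k := k) (s := 1.2 * Real.log k) (by linarith) (by linarith)
  set E := elemSymm (primesUpTo (Real.exp (L / (k : ℝ) ^ 3))) (fun p =>
    ∑ v ∈ exponents A (Real.exp (L / (k : ℝ) ^ 3)) (Real.exp L) p, 1 / (p : ℝ) ^ v) (k - 1) with hE
  -- The total minus s is at least 1, so E ≥ 1/(k-1)!, and this factorial is at most k^k ≤ exp(k²).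
  have h4 : 1 ≤ Real.exp ((k : ℝ) ^ 2) * E := by
    have hfac : ((k - 1).factorial : ℝ) ≤ Real.exp ((k : ℝ) ^ 2) := by
      calc ((k - 1).factorial : ℝ) ≤ (k.factorial : ℝ) := by
            exact_mod_cast Nat.factorial_le (Nat.sub_le k 1)
        _ ≤ (k : ℝ) ^ k := by exact_mod_cast Nat.factorial_le_pow k
        _ ≤ Real.exp k ^ k := by
            gcongr
            linarith [Real.add_one_le_exp (k : ℝ)]
        _ = _ := by rw [← Real.exp_nat_mul, sq]
    have h5 : 1 / ((k - 1).factorial : ℝ) ≤ E := by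
      refine le_trans ?_ h3
      gcongr
      exact one_le_pow₀ (by linarith)
    rw [div_le_iff₀ (by positivity)] at h5
    have hE0 : 0 ≤ E := elemSymm_nonneg (fun p _ => sum_nonneg fun v _ => by positivity) _
    nlinarith
  calc Real.exp L ≤ Real.exp L * (Real.exp ((k : ℝ) ^ 2) * E) :=
        le_mul_of_one_le_right hx h4
    _ = 2 * L / α * Real.exp ((k : ℝ) ^ 2) * (α / (2 * L) * Real.exp L * E) := by
        field_simp
    _ ≤ _ := by gcongr

open Classical in
/-- The numbers that are not good form a negligible proportion. -/
theorem ManyPrimes.card_bad_le_card_Qk {α x₀ : ℝ} (hA : ManyPrimes A α x₀) (hx₀ : 2 ≤ x₀)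
    (hα : 0 < α) {k : ℕ} {L d : ℝ} (hk : 400 ≤ k) (hlog : 6 ≤ Real.log k) (hL : (k : ℝ) ^ 12 ≤ L)
    (hLx₀ : x₀ ≤ Real.exp (L / 2)) (hLα : 2 * L ≤ α * Real.exp (L / 4))
    (hdk : 600 * Real.log k ≤ d)
    (hd : d ≤ ∑ p ∈ primesQ A (Real.exp L), (1 - (lam A p : ℝ) / rho A p) * (1 / (p : ℝ))) :
    (#(Qk A k (Real.exp L) \
      goodQk A k (Real.exp (L / (k : ℝ) ^ 3)) (Real.exp (L / (2 * k))) (Real.exp L)) : ℝ) ≤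
        Real.exp (-k) / α * #(Qk A k (Real.exp L)) := by
  have hk' : (400 : ℝ) ≤ k := by exact_mod_cast hk
  have hk0 : (0 : ℝ) < k := by linarith
  have hL0 : 0 < L := lt_of_lt_of_le (by positivity) hL
  have hQ := hA.exp_le_card_Qk A hx₀ hα hk hlog hL hLx₀ hLα hdk hd
  -- With z = e^u one has z³ = w, as `card_bad_le` requires.
  set u := L / (3 * (k : ℝ) ^ 3) with hu
  have e1 : Real.exp (L / (k : ℝ) ^ 3) = Real.exp u ^ 3 := by
    rw [← Real.exp_nat_mul]
    congr 1
    rw [hu]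
    push_cast
    field_simp
  have hu0 : 0 ≤ u := by positivity
  have h3u : 3 * u ≤ L / (2 * k) := by
    rw [hu, mul_div_assoc', div_le_div_iff₀ (by positivity) (by positivity)]
    have : 3 * (2 * (k : ℝ)) ≤ 3 * (k : ℝ) ^ 3 := by nlinarith [sq_nonneg (k : ℝ)]
    calc 3 * L * (2 * k) = L * (3 * (2 * (k : ℝ))) := by ring
      _ ≤ L * (3 * (k : ℝ) ^ 3) := by gcongr
  have hbad := card_bad_le A (k := k) (z := Real.exp u) (y₀ := Real.exp (L / (2 * k)))
    (x := Real.exp L) (Real.exp_pos L).le (Real.one_le_exp hu0) (by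
      rw [← Real.exp_nat_mul, Real.exp_le_exp]
      push_cast
      exact h3u)
  rw [e1]
  refine hbad.trans ?_
  have hy : Real.exp (L / (2 * k)) ^ k = Real.exp (L / 2) := by
    rw [← Real.exp_nat_mul]
    congr 1
    field_simp
  have hux : u ≤ L / 2 := by
    have : L / (2 * k) ≤ L / 2 := by
      gcongr
      linarith
    linarith
  have h1 : 2 * Real.exp L / Real.exp u + Real.exp (L / (2 * k)) ^ k ≤
      3 * (Real.exp L * Real.exp (-u)) := by
    have h2 : Real.exp (L / 2) ≤ Real.exp L * Real.exp (-u) := by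
      rw [← Real.exp_add, Real.exp_le_exp]
      linarith
    rw [hy, Real.exp_neg, ← div_eq_mul_inv] at *
    rw [mul_div_assoc]
    linarith
  have hkey : 6 * L * Real.exp ((k : ℝ) ^ 2) * Real.exp (-u) ≤ Real.exp (-k) := by
    -- T is the fourth root of L. From k¹² ≤ L follow k³ ≤ T and u ≥ T³/3, which dominates 2 + log L
    -- + k² + k, all of these being of order at most T.
    set T := Real.exp (Real.log L / 4) with hT
    have hT4 : T ^ 4 = L := by
      rw [hT, ← Real.exp_nat_mul]
      push_cast
      rw [mul_div_cancel₀ _ (by norm_num), Real.exp_log hL0]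
    have hT0 : 0 < T := Real.exp_pos _
    have hTk : (k : ℝ) ^ 3 ≤ T := by
      refine le_of_pow_le_pow_left₀ (n := 4) (by norm_num) hT0.le ?_
      rw [hT4, ← pow_mul]
      exact hL
    have hk3 : (400 : ℝ) * (k : ℝ) ^ 2 ≤ (k : ℝ) ^ 3 := by
      rw [pow_succ (k : ℝ) 2, mul_comm]
      gcongr
    have hk2 : 400 * (k : ℝ) ≤ (k : ℝ) ^ 2 := by nlinarith
    have hlT : Real.log L ≤ 4 * T := by
      have := Real.add_one_le_exp (Real.log L / 4)
      linarith
    have huT : T ^ 3 / 3 ≤ u := by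
      rw [hu, ← hT4, div_le_div_iff₀ (by norm_num) (by positivity)]
      nlinarith [pow_pos hT0 3]
    have h6 : (6 : ℝ) ≤ Real.exp 2 := by
      have := Real.exp_one_gt_d9
      have h : Real.exp 2 = Real.exp 1 * Real.exp 1 := by rw [← Real.exp_add]; norm_num
      nlinarith
    calc 6 * L * Real.exp ((k : ℝ) ^ 2) * Real.exp (-u)
        ≤ Real.exp 2 * Real.exp (Real.log L) * Real.exp ((k : ℝ) ^ 2) * Real.exp (-u) := by
          rw [Real.exp_log hL0]
          gcongr
      _ = Real.exp (2 + Real.log L + (k : ℝ) ^ 2 + -u) := by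
          rw [Real.exp_add, Real.exp_add, Real.exp_add]
      _ ≤ Real.exp (-k) := by
          rw [Real.exp_le_exp]
          have hT400 : 400 ≤ T := by nlinarith
          have : 30 * T ≤ T ^ 3 := by nlinarith [mul_pos hT0 hT0]
          linarith
  calc _ ≤ 3 * (Real.exp L * Real.exp (-u)) := h1
    _ ≤ 3 * ((2 * L / α * Real.exp ((k : ℝ) ^ 2) * #(Qk A k (Real.exp L))) * Real.exp (-u)) := by
        gcongr
    _ = 6 * L * Real.exp ((k : ℝ) ^ 2) * Real.exp (-u) / α * #(Qk A k (Real.exp L)) := by ring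
    _ ≤ _ := by gcongr

end CRTEquidist

/-! ### The average discrepancy -/

namespace CRTEquidist

open Finset

variable {n : ℕ} (A : (m : ℕ) → Set (Fin n → ZMod m))

/-- The average over `𝒬_k(x)` of the Weyl sum of a nonzero frequency. -/
theorem ManyPrimes.sum_Qk_weylSum_le {α x₀ : ℝ} (hA : ManyPrimes A α x₀) (hx₀ : 2 ≤ x₀)
    (hα : 0 < α) {k : ℕ} {L δ : ℝ} (hk : 400 ≤ k) (hlog : 6 ≤ Real.log k) (hL : (k : ℝ) ^ 12 ≤ L)
    (hLx₀ : x₀ ≤ Real.exp (L / 2)) (hLα : 2 * L ≤ α * Real.exp (L / 4))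
    (hδ0 : 0 ≤ δ) (hℓ : 100 ≤ Real.log L) (hδL : 600 * Real.log k ≤ δ * Real.log L)
    (hd : δ * Real.log L ≤
      ∑ p ∈ primesQ A (Real.exp L), (1 - (lam A p : ℝ) / rho A p) * (1 / (p : ℝ)))
    {H : ℕ} (hH : H ≤ 2 ^ k) {h : Fin n → ℤ} (hh : h ∈ freqBox n H) :
    ∑ q ∈ Qk A k (Real.exp L), ‖weylSum A q h‖ ≤
      (162 * k * Real.exp (-(δ * k / 5)) + Real.exp (-k)) / α * #(Qk A k (Real.exp L)) := by
  classical
  have h1 := hA.sum_goodQk_weylSum_le A hx₀ hα hk hlog hL hLx₀ hLα hδ0 hℓ hδL hd hH hh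
  have h2 := hA.card_bad_le_card_Qk A hx₀ hα hk hlog hL hLx₀ hLα hδL hd
  have hsub : goodQk A k (Real.exp (L / (k : ℝ) ^ 3)) (Real.exp (L / (2 * k))) (Real.exp L) ⊆
      Qk A k (Real.exp L) := filter_subset _ _
  rw [← sum_sdiff hsub]
  have h3 : ∑ q ∈ Qk A k (Real.exp L) \ goodQk A k (Real.exp (L / (k : ℝ) ^ 3))
      (Real.exp (L / (2 * k))) (Real.exp L), ‖weylSum A q h‖ ≤
      #(Qk A k (Real.exp L) \ goodQk A k (Real.exp (L / (k : ℝ) ^ 3))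
        (Real.exp (L / (2 * k))) (Real.exp L)) := by
    refine (sum_le_card_nsmul _ _ 1 fun q hq => norm_weylSum_le_one A ?_ h).trans
      (le_of_eq (by rw [nsmul_eq_mul, mul_one]))
    have := ((mem_Qk A).1 (mem_sdiff.1 hq).1).1.1
    omega
  calc _ ≤ Real.exp (-k) / α * #(Qk A k (Real.exp L)) +
        162 * k / α * Real.exp (-(δ * k / 5)) * #(Qk A k (Real.exp L)) := by linarith
    _ = _ := by ring

/-- The average discrepancy over `𝒬_k(x)`. -/
theorem ManyPrimes.average_disc_le {α x₀ : ℝ} (hA : ManyPrimes A α x₀) (hx₀ : 2 ≤ x₀)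
    (hα : 0 < α) {k : ℕ} {L δ : ℝ} (hk : 400 ≤ k) (hlog : 6 ≤ Real.log k) (hL : (k : ℝ) ^ 12 ≤ L)
    (hLx₀ : x₀ ≤ Real.exp (L / 2)) (hLα : 2 * L ≤ α * Real.exp (L / 4))
    (hδ0 : 0 ≤ δ) (hδ1 : δ ≤ 1) (hℓ : 100 ≤ Real.log L)
    (hδL : 600 * Real.log k ≤ δ * Real.log L)
    (hkδ : (n + 1) * Real.log k ≤ δ * k / 10)
    (hd : δ * Real.log L ≤
      ∑ p ∈ primesQ A (Real.exp L), (1 - (lam A p : ℝ) / rho A p) * (1 / (p : ℝ))) :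
    (Qk A k (Real.exp L)).Nonempty ∧
    1 / (#(Qk A k (Real.exp L)) : ℝ) * ∑ q ∈ Qk A k (Real.exp L), disc (Delta A q) ≤
      (2 ^ (n + 2) + 163) / α * Real.exp (-(δ * k / 18)) := by
  have hk' : (400 : ℝ) ≤ k := by exact_mod_cast hk
  have hk0 : (0 : ℝ) < k := by linarith
  have hQ := hA.exp_le_card_Qk A hx₀ hα hk hlog hL hLx₀ hLα hδL hd
  have hcard : 0 < #(Qk A k (Real.exp L)) := by
    refine Nat.pos_of_ne_zero fun h0 => ?_
    rw [h0, Nat.cast_zero, mul_zero] at hQ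
    exact absurd hQ (not_le.2 (Real.exp_pos L))
  refine ⟨card_pos.1 hcard, ?_⟩
  have hδk : 0 ≤ δ * k := by positivity
  have hδk1 : δ * k ≤ k := mul_le_of_le_one_left hk0.le hδ1
  -- The factor 1/2 ensures 2ε ≤ 1. The exponent 1/18 makes H, of size ε⁻², about 4exp(δk/9), which
  -- stays below 2^k and has 3 + 2 log H ≤ k.
  set ε : ℝ := Real.exp (-(δ * k / 18)) / 2 with hε
  have hε0 : 0 < ε := by positivity
  have hε2 : 2 * ε ≤ 1 := by
    have : Real.exp (-(δ * k / 18)) ≤ 1 := Real.exp_le_one_iff.2 (by linarith)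
    linarith
  set H : ℕ := ⌈4 * Real.exp (δ * k / 9)⌉₊ with hHdef
  have hHε : 1 ≤ ε ^ 2 * H := by
    have h1 : 4 * Real.exp (δ * k / 9) ≤ H := Nat.le_ceil _
    calc (1 : ℝ) = ε ^ 2 * (4 * Real.exp (δ * k / 9)) := by
          have : Real.exp (-(δ * k / 18)) ^ 2 * Real.exp (δ * k / 9) = 1 := by
            rw [← Real.exp_nat_mul, ← Real.exp_add, Real.exp_eq_one_iff]
            push_cast
            ring
          rw [hε]
          linear_combination -this
      _ ≤ _ := by gcongr
  have hHle : (H : ℝ) ≤ Real.exp (4 + k / 9) := by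
    have h1 : (H : ℝ) < 4 * Real.exp (δ * k / 9) + 1 := Nat.ceil_lt_add_one (by positivity)
    have h2 : 1 ≤ Real.exp (δ * k / 9) := Real.one_le_exp (by positivity)
    calc (H : ℝ) ≤ 5 * Real.exp (δ * k / 9) := by linarith
      _ ≤ Real.exp 4 * Real.exp (k / 9) := by
          gcongr
          linarith [Real.add_one_le_exp (4 : ℝ)]
      _ = _ := (Real.exp_add _ _).symm
  have hlog2 := Real.log_two_gt_d9
  have hH2 : H ≤ 2 ^ k := by
    have : (H : ℝ) ≤ (2 : ℝ) ^ k := by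
      refine hHle.trans ?_
      rw [← Real.exp_log (show (0 : ℝ) < 2 ^ k by positivity), Real.exp_le_exp, Real.log_pow]
      nlinarith
    exact_mod_cast this
  have hH0 : (0 : ℝ) < H := by
    rcases Nat.eq_zero_or_pos H with h0 | h0
    · rw [h0, Nat.cast_zero, mul_zero] at hHε
      linarith
    · exact_mod_cast h0
  have hlogH : 3 + 2 * Real.log H ≤ k := by
    have := (Real.log_le_iff_le_exp hH0).2 hHle
    linarith
  have hlogH0 : 0 ≤ 3 + 2 * Real.log H := by
    linarith [Real.log_natCast_nonneg H]
  have hweights : ∑ h ∈ freqBox n H, ∏ i, freqWeight (h i) ≤ (k : ℝ) ^ n :=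
    (sum_prod_freqWeight_le n H).trans (pow_le_pow_left₀ hlogH0 hlogH n)
  set N : ℝ := ((Qk A k (Real.exp L)).card : ℝ) with hN
  have hN0 : 0 < N := Nat.cast_pos.2 hcard
  set S : ℝ := (162 * k * Real.exp (-(δ * k / 5)) + Real.exp (-k)) / α with hS
  have hS0 : 0 ≤ S := by positivity
  have hsum : ∑ q ∈ Qk A k (Real.exp L), disc (Delta A q) ≤
      N * (2 ^ n * (4 * ε)) + (k : ℝ) ^ n * (S * N) := by
    calc ∑ q ∈ Qk A k (Real.exp L), disc (Delta A q)
        ≤ ∑ q ∈ Qk A k (Real.exp L), (2 ^ n * (4 * ε) +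
            ∑ h ∈ freqBox n H, (∏ i, freqWeight (h i)) * ‖weylSum A q h‖) :=
          sum_le_sum fun q hq => disc_le A ((mem_Qk A).1 hq).2.1 hε0 hε2 hHε
      _ = N * (2 ^ n * (4 * ε)) + ∑ h ∈ freqBox n H, (∏ i, freqWeight (h i)) *
            ∑ q ∈ Qk A k (Real.exp L), ‖weylSum A q h‖ := by
          rw [sum_add_distrib, sum_const, nsmul_eq_mul, sum_comm, ← hN]
          simp_rw [mul_sum]
      _ ≤ N * (2 ^ n * (4 * ε)) + ∑ h ∈ freqBox n H, (∏ i, freqWeight (h i)) * (S * N) := by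
          gcongr with h hh
          · exact prod_nonneg fun i _ => freqWeight_nonneg _
          · exact hA.sum_Qk_weylSum_le A hx₀ hα hk hlog hL hLx₀ hLα hδ0 hℓ hδL hd hH2 hh
      _ ≤ _ := by
          rw [← sum_mul]
          gcongr
  have hpow : (k : ℝ) ^ n * k ≤ Real.exp (δ * k / 10) := by
    rw [← pow_succ, ← Real.exp_log (show (0 : ℝ) < k ^ (n + 1) by positivity), Real.exp_le_exp,
      Real.log_pow]
    push_cast
    exact hkδ
  -- The weights use up exp(δk/10), leaving the exponent 1/5 - 1/10 > 1/18.
  have h1 : (k : ℝ) ^ n * k * Real.exp (-(δ * k / 5)) ≤ Real.exp (-(δ * k / 18)) := by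
    calc _ ≤ Real.exp (δ * k / 10) * Real.exp (-(δ * k / 5)) := by gcongr
      _ ≤ _ := by
        rw [← Real.exp_add, Real.exp_le_exp]
        linarith
  have h2 : (k : ℝ) ^ n * Real.exp (-k) ≤ Real.exp (-(δ * k / 18)) := by
    have h3 : (k : ℝ) ^ n ≤ Real.exp (δ * k / 10) :=
      (le_mul_of_one_le_right (by positivity) (by linarith)).trans hpow
    calc _ ≤ Real.exp (δ * k / 10) * Real.exp (-k) := by gcongr
      _ ≤ _ := by
        rw [← Real.exp_add, Real.exp_le_exp]
        linarith
  have hα2 : α ≤ 2 := by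
    have h4 : Real.log 4 = 2 * Real.log 2 := by
      rw [show (4 : ℝ) = 2 ^ 2 by norm_num, Real.log_pow]; norm_num
    have h5 := Real.log_two_lt_d9
    linarith [hA.le_log_four A hx₀]
  have hfin : 2 ^ n * (4 * ε) + (k : ℝ) ^ n * S ≤
      (2 ^ (n + 2) + 163) / α * Real.exp (-(δ * k / 18)) := by
    have h6 : (k : ℝ) ^ n * S ≤ 163 / α * Real.exp (-(δ * k / 18)) := by
      rw [hS, mul_div_assoc', div_mul_eq_mul_div]
      refine div_le_div_of_nonneg_right ?_ hα.le
      linarith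
    have h7 : (2 : ℝ) ^ n * (4 * ε) ≤ 2 ^ (n + 2) / α * Real.exp (-(δ * k / 18)) := by
      rw [div_mul_eq_mul_div, le_div_iff₀ hα]
      calc (2 : ℝ) ^ n * (4 * ε) * α ≤ 2 ^ n * (4 * ε) * 2 := by gcongr
        _ = _ := by rw [hε]; ring
    calc _ ≤ _ := add_le_add h7 h6
      _ = _ := by ring
  rw [one_div, inv_mul_le_iff₀ hN0]
  calc _ ≤ _ := hsum
    _ = N * (2 ^ n * (4 * ε) + (k : ℝ) ^ n * S) := by ring
    _ ≤ _ := by gcongr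

/-- Write log k = log M + log(k/M): the first term is at most k/M by assumption, the second because
log y ≤ y. -/
theorem div_mul_log_le {M k : ℝ} (hM : 1 < M) (hk : M * Real.log M ≤ k) :
    M * Real.log k ≤ 2 * k := by
  have hlogM : 0 < Real.log M := Real.log_pos hM
  have hM0 : 0 < M := by linarith
  have hk0 : 0 < k := lt_of_lt_of_le (by positivity) hk
  have h1 : Real.log M ≤ k / M := by rwa [le_div_iff₀' hM0]
  have h2 : Real.log k = Real.log M + Real.log (k / M) := by
    rw [Real.log_div hk0.ne' hM0.ne']
    ring
  have h3 := Real.log_le_sub_one_of_pos (div_pos hk0 hM0)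
  have h4 : Real.log k ≤ 2 * (k / M) := by linarith
  calc M * Real.log k ≤ M * (2 * (k / M)) := by gcongr
    _ = 2 * k := by field_simp

end CRTEquidist
-- Choice of X and verification of the ranges
theorem theorem3 :
    ∃ C : ℕ → ℝ, ∀ α x₀ : ℝ, 0 < α → 2 ≤ x₀ → ∃ X : ℝ,
      ∀ n : ℕ, 1 ≤ n → ∀ A : (m : ℕ) → Set (Fin n → ZMod m), ManyPrimes A α x₀ →
      ∀ x : ℝ, X ≤ x → ∀ δ : ℝ, 0 < δ → δ ≤ 1 →
      δ * Real.log (Real.log x) ≤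
        ∑ p ∈ primesQ A x, (1 - (lam A p : ℝ) / (rho A p : ℝ)) * (1 / (p : ℝ)) →
      ∀ k : ℕ,
      20 * (6 + (n : ℝ)) / δ * Real.log (20 * (6 + (n : ℝ)) / δ) ≤ (k : ℝ) →
      (k : ℝ) ≤ Real.exp (Real.sqrt (α * δ * Real.log (Real.log x) / (20 * (6 + (n : ℝ))))) →
      (Qk A k x).Nonempty ∧
      1 / ((Qk A k x).card : ℝ) * ∑ q ∈ Qk A k x, disc (Delta A q) ≤
        C n / α * (Real.exp (-(δ * (k : ℝ) / 18)) + Real.log x ^ (-(α * δ / 18))) := by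
  refine ⟨fun n => 2 ^ (n + 2) + 163, fun α x₀ hα hx₀ =>
    -- The first bound gives x₀ ≤ √x. The second gives αL ≥ 64, so that 2L ≤ αL²/32 ≤ α exp(L/4).
    ⟨max (x₀ ^ 2) (Real.exp (64 / α)), fun n hn A hA x hx δ hδ0 hδ1 hd k hk1 hk2 => ?_⟩⟩
  have hxx₀ : x₀ ^ 2 ≤ x := (le_max_left _ _).trans hx
  have hxα : Real.exp (64 / α) ≤ x := (le_max_right _ _).trans hx
  have hx0 : 0 < x := (Real.exp_pos _).trans_le hxα
  set L := Real.log x with hLdef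
  have hxL : x = Real.exp L := (Real.exp_log hx0).symm
  have hLα64 : 64 / α ≤ L := (Real.le_log_iff_exp_le hx0).2 hxα
  have hL0 : 0 < L := (div_pos (by norm_num) hα).trans_le hLα64
  have hLx₀ : x₀ ≤ Real.exp (L / 2) := by
    refine le_of_pow_le_pow_left₀ two_ne_zero (Real.exp_pos _).le ?_
    rw [← Real.exp_nat_mul]
    push_cast
    rw [mul_div_cancel₀ _ two_ne_zero, ← hxL]
    exact hxx₀
  have hLα : 2 * L ≤ α * Real.exp (L / 4) := by
    have h1 := Real.quadratic_le_exp_of_nonneg (x := L / 4) (by positivity)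
    have h2 : 64 ≤ L * α := (div_le_iff₀ hα).1 hLα64
    have h3 : L ^ 2 / 32 ≤ Real.exp (L / 4) := by nlinarith
    calc 2 * L ≤ L * α / 32 * L := by gcongr; linarith
      _ = α * (L ^ 2 / 32) := by ring
      _ ≤ _ := by gcongr
  have hn' : (1 : ℝ) ≤ n := by exact_mod_cast hn
  set c : ℝ := 20 * (6 + (n : ℝ)) with hc
  have hc140 : 140 ≤ c := by linarith
  have hM140 : 140 ≤ c / δ := by
    rw [le_div_iff₀ hδ0]
    nlinarith
  have hlogM : 4 ≤ Real.log (c / δ) := by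
    rw [Real.le_log_iff_exp_le (by linarith)]
    have h1 := Real.exp_one_lt_d9
    have h2 : Real.exp 4 = Real.exp 1 ^ 4 := by rw [← Real.exp_nat_mul]; norm_num
    have h3 : Real.exp 1 ^ 4 ≤ 3 ^ 4 := pow_le_pow_left₀ (Real.exp_pos _).le (by linarith) 4
    linarith
  have hk560 : (560 : ℝ) ≤ k := by nlinarith
  have hlog6 : 6 ≤ Real.log k := by
    rw [Real.le_log_iff_exp_le (by linarith)]
    have h1 := Real.exp_one_lt_d9
    have h2 : Real.exp 6 = Real.exp 1 ^ 6 := by rw [← Real.exp_nat_mul]; norm_num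
    have h3 : Real.exp 1 ^ 6 ≤ 2.8 ^ 6 := pow_le_pow_left₀ (Real.exp_pos _).le (by linarith) 6
    norm_num at h3
    linarith
  have hkM := div_mul_log_le (by linarith) hk1
  -- The lower bound for k gives 20(6 + n) log k ≤ 2δk, which is stronger than needed.
  have hkδ : ((n : ℝ) + 1) * Real.log k ≤ δ * k / 10 := by
    rw [div_mul_eq_mul_div, div_le_iff₀ hδ0] at hkM
    nlinarith
  have hk3 : Real.log k ^ 2 ≤ α * δ * Real.log L / c := by
    rw [← Real.le_sqrt' (by linarith), Real.log_le_iff_le_exp (by linarith)]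
    exact hk2
  rw [le_div_iff₀ (by linarith)] at hk3
  have hαlog : α ≤ 1.4 := by
    have h4 : Real.log 4 = 2 * Real.log 2 := by
      rw [show (4 : ℝ) = 2 ^ 2 by norm_num, Real.log_pow]; norm_num
    have h5 := Real.log_two_lt_d9
    linarith [hA.le_log_four A hx₀]
  -- One factor log k ≥ 6 and c ≥ 140 are spent here. Dividing by α ≤ 1.4 gives the constant 600,
  -- and then δ ≤ 1 gives k¹² ≤ L.
  have h840 : 840 * Real.log k ≤ α * (δ * Real.log L) := by
    calc 840 * Real.log k = 6 * Real.log k * 140 := by ring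
      _ ≤ Real.log k ^ 2 * c := by
          rw [sq]
          gcongr
      _ ≤ _ := by linarith
  have hδℓ0 : 0 < δ * Real.log L :=
    pos_of_mul_pos_right (lt_of_lt_of_le (by linarith) h840) hα.le
  have hδL : 600 * Real.log k ≤ δ * Real.log L := by nlinarith
  have hℓ : δ * Real.log L ≤ Real.log L :=
    mul_le_of_le_one_left (pos_of_mul_pos_right hδℓ0 hδ0.le).le hδ1
  have hkL : (k : ℝ) ^ 12 ≤ L := by
    rw [← Real.log_le_log_iff (by positivity) hL0, Real.log_pow]
    push_cast
    linarith
  rw [hxL] at hd ⊢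
  obtain ⟨h1, h2⟩ := hA.average_disc_le A hx₀ hα (by exact_mod_cast (by linarith : (400 : ℝ) ≤ k))
    hlog6 hkL hLx₀ hLα hδ0.le hδ1 (by linarith) hδL hkδ hd
  refine ⟨h1, h2.trans ?_⟩
  gcongr
  exact le_add_of_nonneg_right (Real.rpow_nonneg hL0.le _)
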